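/- **Setting.** Let $Z_1,Z_2,\dots$ be i.i.d. random vectors in $\mathbb R^p$ with the law of $Z$, let $\Theta\subset\mathbb R^d$ be the parameter space (derivatives relative to $\Theta$ being uniquely determined at each of its points, as for a convex body), and let $\psi_\theta(z)\in\mathbb R^d$ for $\theta\in\Theta$, $z\in\mathbb R^p$; $\nabla$ denotes the derivative in $\theta$. For each $k$ let $\hat\theta_k$ be a measurable, $\Theta$-valued function of a sample $(z_1,\dots,z_k)$ that solves $\sum_{i=1}^k\psi_\theta(z_i)=0$ in $\theta$ for almost every sample for which a solution in $\Theta$ exists. For each $N$ let $k_N\le N$, and let $\mathcal S$ consist of $m_N$ subsets $s=\{s_1<\dots<s_{k_N}\}$ of $\{1,\dots,N\}$, drawn independently of each other and of the data, uniformly from the $\binom N{k_N}$ subsets of size $k_N$ (repetitions are allowed and counted). Put $\hat\theta_{k_N,s}=\hat\theta_{k_N}(Z_{s_1},\dots,Z_{s_{k_N}})$, $\hat\theta_{k_N,m_N}=m_N^{-1}\sum_{s\in\mathcal S}\hat\theta_{k_N,s}$ and $$\widehat\Omega_{k_N,m_N}=\frac1{m_N}\sum_{s\in\mathcal S}(\hat\theta_{k_N,s}-\hat\theta_{k_N,m_N})(\hat\theta_{k_N,s}-\hat\theta_{k_N,m_N})^\top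 .$$ Let $\Sigma_\theta=\mathrm{Var}(\psi_\theta(Z))$, $V_\theta=\mathrm E\{\partial\psi_\theta(Z)/\partial\theta^\top\}$, $V^{(2)}_\theta=\mathrm E\{\partial^2\psi_\theta(Z)/(\partial\theta^\top\otimes\partial\theta^\top)\}$ (a $d\times d^2$ matrix), $H_\theta=\mathrm E[\psi_\theta(Z)^\top\otimes\{\partial\psi_\theta(Z)/\partial\theta^\top\}]$, $\Xi_{\theta}=V_{\theta}^{-1}\Sigma_{\theta}(V_{\theta}^{-1})^\top$ and $$B_\theta=-V_\theta^{-1}\{-H_\theta\,\mathrm{vec}(V_\theta^{-1})+\tfrac12V_\theta^{(2)}(V_\theta^{-1}\otimes V_\theta^{-1})\,\mathrm{vec}(\Sigma_\theta)\}.$$ For a sample $(z_1,\dots,z_k)$ let $\widehat V(\theta)=k^{-1}\sum_i\partial\psi_\theta(z_i)/\partial\theta^\top$, $\widehat V^{(2)}(\theta)=k^{-1}\sum_i\partial^2\psi_\theta(z_i)/(\partial\theta^\top\otimes\partial\theta^\top)$ and $$\widehat B(\theta)=-\widehat V^{-1}(\theta)\Big[-\frac1k\sum_{i}\Big\{\frac{\partial\psi_\theta(z_i)}{\partial\theta^\top}-\widehat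 V(\theta)\Big\}\widehat V^{-1}(\theta)\psi_\theta(z_i)+\frac12\widehat V^{(2)}(\theta)\frac1k\sum_i\big\{\widehat V^{-1}(\theta)\psi_\theta(z_i)\otimes\widehat V^{-1}(\theta)\psi_\theta(z_i)\big\}\Big].$$ **Common assumptions.** $\Theta$ is compact; $\theta_0$ is an interior point of $\Theta$ and the unique root in $\Theta$ of $\mathrm E\,\psi_\theta(Z)=0$; $z\mapsto\psi_\theta(z)$ is measurable for each $\theta\in\Theta$; $\theta\mapsto\psi_\theta(z)$ is three times continuously differentiable in $\Theta$ for almost every $z$; $\mathrm E\sup_{\theta\in\Theta}\|\nabla^\kappa\psi_\theta(Z)\|^2<\infty$ for $\kappa=0,1,2,3$; $\Sigma_{\theta_0}$ and $V_{\theta_0}$ are nonsingular; $\mathrm E\|\psi_{\theta_0}(Z)\|^4<\infty$; $k_N\to\infty$ and $k_N/N\to0$ as $N\to\infty$. **(a)** Suppose that either (i) $k_Nm_N/N\to\alpha\in(0,\infty]$ and $k_N/\sqrt N\to\infty$, or (ii) $k_Nm_N/N\to0$, $m_N\to\infty$ and $k_N/m_N\to\infty$. Then $k_N\widehat\Omega_{k_N,m_N}\to\Xi_{\theta_0}$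 in probability. **(b)** Suppose in addition to the common assumptions that $\theta\mapsto\psi_\theta(z)$ is four times continuously differentiable in $\Theta$ for almost every $z$, that $\mathrm E\sup_{\theta\in\Theta}\|\nabla^4\psi_\theta(Z)\|^2<\infty$, that $\mathrm E\|\nabla^\kappa\psi_{\theta_0}(Z)\|^4<\infty$ for $\kappa=1,2,3$, and that either (i) $k_Nm_N/N\to\alpha\in(0,\infty]$, $k_N=O(\sqrt N)$ and $k_N/\sqrt[3]N\to\infty$, or (ii) $k_Nm_N/N\to0$, $m_N\to\infty$, $k_N=O(m_N)$ and $k_N/\sqrt{m_N}\to\infty$. Let $\hat\theta^{(bc)}_k$ be any one of the following functions of a sample of size $k$: (bc1) $\hat\theta_k-k^{-1}B_{\hat\theta_k}$, if $V_\theta$ is nonsingular for every $\theta\in\Theta$ (so that $B_\theta$ is defined on $\Theta$); (bc2) a measurable function with values in a bounded set $K\supseteq\Theta$ (for instance $K=\Theta$) that does not depend on $k$ and the sample, equal to $\hat\theta_k-k^{-1}\widehat B(\hat\theta_k)$ for almost every sample for which $\widehat V(\hat\theta_k)$ is nonsingular and this vector lies in $K$; (bc3) if $V_\theta$ is nonsingular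 for every $\theta\in\Theta$, a measurable $\Theta$-valued function that solves $\sum_i\psi_\theta(z_i)+\widehat V(\theta)\widehat B(\theta)=0$ with $\widehat V(\theta)$ nonsingular for almost every sample for which such a solution $\theta\in\Theta$ exists. Let $\widehat\Omega^{(bc)}_{k_N,m_N}$ be defined as $\widehat\Omega_{k_N,m_N}$ with $\hat\theta^{(bc)}_{k_N}$ in place of $\hat\theta_{k_N}$. Then $k_N\widehat\Omega^{(bc)}_{k_N,m_N}\to\Xi_{\theta_0}$ in probability. -/

import Mathlib

open MeasureTheory ProbabilityTheory Filter Topology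
open scoped ENNReal Matrix Kronecker Asymptotics

noncomputable section

namespace Subbagging

/-- `d`-dimensional Euclidean space. -/
abbrev Vec (d : ℕ) : Type := EuclideanSpace ℝ (Fin d)

/-! ### Derivatives of the estimating function

`ψ θ z` is the estimating function. All derivatives in `θ` are taken within the parameter
space `Θ`; they are ordinary derivatives at interior points of `Θ`. -/

section Derivatives

variable {d p : ℕ}

/-- The `κ`-th derivative `∇^κ ψ_θ(z)` in `θ`, within `Θ`. -/
def gradPow (ψ : Vec d → Vec p → Vec d) (Θ : Set (Vec d)) (κ : ℕ) (θ : Vec d) (z : Vec p) :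
    ContinuousMultilinearMap ℝ (fun _ : Fin κ => Vec d) (Vec d) :=
  iteratedFDerivWithin ℝ κ (fun t => ψ t z) Θ θ

/-- The Jacobian matrix `∂ψ_θ(z)/∂θᵀ`, with entries `∂ψ_i/∂θ_j`. -/
def jac (ψ : Vec d → Vec p → Vec d) (Θ : Set (Vec d)) (θ : Vec d) (z : Vec p) :
    Matrix (Fin d) (Fin d) ℝ :=
  Matrix.of fun i j =>
    (fderivWithin ℝ (fun t => ψ t z) Θ θ (EuclideanSpace.single j (1 : ℝ))) i

/-- The `d × d²` matrix `∂²ψ_θ(z)/(∂θᵀ ⊗ ∂θᵀ)`: the entry `(i, j)` of the Jacobian matrix is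
replaced by the row vector of its partial derivatives. -/
def hess (ψ : Vec d → Vec p → Vec d) (Θ : Set (Vec d)) (θ : Vec d) (z : Vec p) :
    Matrix (Fin d) (Fin d × Fin d) ℝ :=
  Matrix.of fun i jl =>
    fderivWithin ℝ (fun t => jac ψ Θ t z i jl.1) Θ θ (EuclideanSpace.single jl.2 (1 : ℝ))

end Derivatives

/-! ### Population quantities -/

section Population

variable {d p : ℕ}

/-- `Σ_θ = Var (ψ_θ(Z))`. -/
def Sig (P : Measure (Vec p)) (ψ : Vec d → Vec p → Vec d) (θ : Vec d) :
    Matrix (Fin d) (Fin d) ℝ :=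
  Matrix.of fun i j => covariance (fun z => ψ θ z i) (fun z => ψ θ z j) P

/-- `V_θ = E {∂ψ_θ(Z)/∂θᵀ}`. -/
def V (P : Measure (Vec p)) (ψ : Vec d → Vec p → Vec d) (Θ : Set (Vec d)) (θ : Vec d) :
    Matrix (Fin d) (Fin d) ℝ :=
  Matrix.of fun i j => ∫ z, jac ψ Θ θ z i j ∂P

/-- `V_θ^{(2)} = E {∂²ψ_θ(Z)/(∂θᵀ ⊗ ∂θᵀ)}`. -/
def V2 (P : Measure (Vec p)) (ψ : Vec d → Vec p → Vec d) (Θ : Set (Vec d)) (θ : Vec d) :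
    Matrix (Fin d) (Fin d × Fin d) ℝ :=
  Matrix.of fun i jl => ∫ z, hess ψ Θ θ z i jl ∂P

/-- `H_θ = E [ψ_θ(Z)ᵀ ⊗ {∂ψ_θ(Z)/∂θᵀ}]`, a `d × d²` matrix whose `j`-th block is
`E [(ψ_θ(Z))_j ∂ψ_θ(Z)/∂θᵀ]`. -/
def H (P : Measure (Vec p)) (ψ : Vec d → Vec p → Vec d) (Θ : Set (Vec d)) (θ : Vec d) :
    Matrix (Fin d) (Fin d × Fin d) ℝ :=
  Matrix.of fun i jl => ∫ z, ψ θ z jl.1 * jac ψ Θ θ z i jl.2 ∂P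

/-- The sandwich matrix `Ξ_θ = V_θ⁻¹ Σ_θ (V_θ⁻¹)ᵀ`. -/
def Xi (P : Measure (Vec p)) (ψ : Vec d → Vec p → Vec d) (Θ : Set (Vec d)) (θ : Vec d) :
    Matrix (Fin d) (Fin d) ℝ :=
  (V P ψ Θ θ)⁻¹ * Sig P ψ θ * ((V P ψ Θ θ)⁻¹)ᵀ

/-- `B_θ = -V_θ⁻¹ {-H_θ vec(V_θ⁻¹) + ½ V_θ^{(2)} (V_θ⁻¹ ⊗ V_θ⁻¹) vec(Σ_θ)}`. -/
def B (P : Measure (Vec p)) (ψ : Vec d → Vec p → Vec d) (Θ : Set (Vec d)) (θ : Vec d) :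
    Fin d → ℝ :=
  -((V P ψ Θ θ)⁻¹ *ᵥ
    (-(H P ψ Θ θ *ᵥ ((V P ψ Θ θ)⁻¹).vec)
      + (1 / 2 : ℝ) •
        (V2 P ψ Θ θ *ᵥ (((V P ψ Θ θ)⁻¹ ⊗ₖ (V P ψ Θ θ)⁻¹) *ᵥ (Sig P ψ θ).vec))))

end Population

/-! ### Sample versions, for a sample `z` of size `k` -/

section Sample

variable {d p k : ℕ}

/-- `V̂(θ) = k⁻¹ ∑ ∂ψ_θ(z_i)/∂θᵀ`. -/
def Vhat (ψ : Vec d → Vec p → Vec d) (Θ : Set (Vec d)) (z : Fin k → Vec p) (θ : Vec d) :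
    Matrix (Fin d) (Fin d) ℝ :=
  (k : ℝ)⁻¹ • ∑ i, jac ψ Θ θ (z i)

/-- `V̂^{(2)}(θ) = k⁻¹ ∑ ∂²ψ_θ(z_i)/(∂θᵀ ⊗ ∂θᵀ)`. -/
def V2hat (ψ : Vec d → Vec p → Vec d) (Θ : Set (Vec d)) (z : Fin k → Vec p) (θ : Vec d) :
    Matrix (Fin d) (Fin d × Fin d) ℝ :=
  (k : ℝ)⁻¹ • ∑ i, hess ψ Θ θ (z i)

/-- The Kronecker product `u ⊗ v` of two vectors. -/
def kronVec (u v : Fin d → ℝ) : Fin d × Fin d → ℝ := fun jl => u jl.1 * v jl.2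

/-- `B̂(θ)`, the sample version of `B_θ`. -/
def Bhat (ψ : Vec d → Vec p → Vec d) (Θ : Set (Vec d)) (z : Fin k → Vec p) (θ : Vec d) :
    Fin d → ℝ :=
  -((Vhat ψ Θ z θ)⁻¹ *ᵥ
    (-((k : ℝ)⁻¹ • ∑ i, (jac ψ Θ θ (z i) - Vhat ψ Θ z θ) *ᵥ
          ((Vhat ψ Θ z θ)⁻¹ *ᵥ (ψ θ (z i)).ofLp))
      + (1 / 2 : ℝ) •
        (V2hat ψ Θ z θ *ᵥ ((k : ℝ)⁻¹ • ∑ i,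
          kronVec ((Vhat ψ Θ z θ)⁻¹ *ᵥ (ψ θ (z i)).ofLp)
            ((Vhat ψ Θ z θ)⁻¹ *ᵥ (ψ θ (z i)).ofLp)))))

end Sample

/-! ### The estimators -/

section Estimators

variable {d p : ℕ}

/-- `T`, a measurable function of a sample of any size `k` with values in `Θ`, is a `Z`-estimator:
it solves the estimating equations `∑ ψ_θ(z_i) = 0` for almost every sample for which they have a
solution in `Θ`. -/
structure IsZEstimator (P : Measure (Vec p)) (ψ : Vec d → Vec p → Vec d) (Θ : Set (Vec d))
    (T : (k : ℕ) → (Fin k → Vec p) → Vec d) : Prop where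
  measurable : ∀ k, Measurable (T k)
  mem : ∀ k z, T k z ∈ Θ
  solves : ∀ k, ∀ᵐ z ∂(Measure.pi fun _ : Fin k => P),
    (∃ θ ∈ Θ, ∑ i, ψ θ (z i) = 0) → ∑ i, ψ (T k z) (z i) = 0

/-- The first bias correction `θ̂ - k⁻¹ B_θ̂`. -/
def IsBC1 (P : Measure (Vec p)) (ψ : Vec d → Vec p → Vec d) (Θ : Set (Vec d))
    (θhat T : (k : ℕ) → (Fin k → Vec p) → Vec d) : Prop :=
  ∀ k z, T k z = θhat k z - (k : ℝ)⁻¹ • WithLp.toLp 2 (B P ψ Θ (θhat k z))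

/-- The second bias correction `θ̂ - k⁻¹ B̂(θ̂)`, with values in `K`: the formula holds for almost
every sample for which it is defined and gives a point of `K`. -/
structure IsBC2 (P : Measure (Vec p)) (ψ : Vec d → Vec p → Vec d) (Θ K : Set (Vec d))
    (θhat T : (k : ℕ) → (Fin k → Vec p) → Vec d) : Prop where
  measurable : ∀ k, Measurable (T k)
  mem : ∀ k z, T k z ∈ K
  formula : ∀ k, ∀ᵐ z ∂(Measure.pi fun _ : Fin k => P),
    (Vhat ψ Θ z (θhat k z)).det ≠ 0 →
    θhat k z - (k : ℝ)⁻¹ • WithLp.toLp 2 (Bhat ψ Θ z (θhat k z)) ∈ K →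
    T k z = θhat k z - (k : ℝ)⁻¹ • WithLp.toLp 2 (Bhat ψ Θ z (θhat k z))

/-- `θ` solves the bias-corrected estimating equations `∑ ψ_θ(z_i) + V̂(θ) B̂(θ) = 0`; the matrix
`V̂(θ)` has to be nonsingular for `B̂(θ)` to be defined. -/
def SolvesBC3 {k : ℕ} (ψ : Vec d → Vec p → Vec d) (Θ : Set (Vec d)) (z : Fin k → Vec p)
    (θ : Vec d) : Prop :=
  (Vhat ψ Θ z θ).det ≠ 0 ∧
    ∑ i, ψ θ (z i) + WithLp.toLp 2 (Vhat ψ Θ z θ *ᵥ Bhat ψ Θ z θ) = 0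

/-- The third bias correction: a measurable function of the sample with values in `Θ` that solves
the bias-corrected estimating equations for almost every sample for which they have a solution
in `Θ`. -/
structure IsBC3 (P : Measure (Vec p)) (ψ : Vec d → Vec p → Vec d) (Θ : Set (Vec d))
    (T : (k : ℕ) → (Fin k → Vec p) → Vec d) : Prop where
  measurable : ∀ k, Measurable (T k)
  mem : ∀ k z, T k z ∈ Θ
  solves : ∀ k, ∀ᵐ z ∂(Measure.pi fun _ : Fin k => P),
    (∃ θ ∈ Θ, SolvesBC3 ψ Θ z θ) → SolvesBC3 ψ Θ z (T k z)

end Estimators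

/-! ### Subsampling and the variance estimator -/

/-- The set `S_N^k` of the subsets of size `k` of the index set of the data. -/
def Subsample (N k : ℕ) : Type := {t : Finset (Fin N) // t.card = k}

instance (N k : ℕ) : MeasurableSpace (Subsample N k) := ⊤

/-- The data points with index in the subset `s`. -/
def pick {E : Type*} {N k : ℕ} (z : ℕ → E) (s : Subsample N k) : Fin k → E :=
  fun i => z (s.1.orderEmbOfFin s.2 i)

/-- `S 0, …, S (m - 1)` are independent, uniformly distributed on the `N.choose k` subsets of size
`k`, and independent of the data `Z`. -/
structure IsSubsampling {Ω E : Type*} [MeasurableSpace Ω] [MeasurableSpace E] (μ : Measure Ω)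
    (Z : ℕ → Ω → E) (N k m : ℕ) (S : Fin m → Ω → Subsample N k) : Prop where
  measurable : ∀ j, Measurable (S j)
  uniform : ∀ j (t : Subsample N k), μ (S j ⁻¹' {t}) = (N.choose k : ℝ≥0∞)⁻¹
  indep : iIndepFun S μ
  indep_data : IndepFun (fun ω j => S j ω) (fun ω i => Z i ω) μ

/-- The subbagging estimator: the average of the `m` subsample estimates `e j`. -/
def subbag {d m : ℕ} (e : Fin m → Vec d) : Vec d := (m : ℝ)⁻¹ • ∑ j, e j

/-- The empirical covariance matrix `m⁻¹ ∑ (e_j - ē)(e_j - ē)ᵀ` of the subsample estimates. -/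
def Omega {d m : ℕ} (e : Fin m → Vec d) : Matrix (Fin d) (Fin d) ℝ :=
  (m : ℝ)⁻¹ • ∑ j, Matrix.vecMulVec (e j - subbag e).ofLp (e j - subbag e).ofLp

/-! ### The technical conditions -/

section Conditions

variable {d p : ℕ}

/-- The parameter space `Θ` is compact, `θ₀` is an interior point of it and the unique root in it
of `E ψ_θ(Z) = 0`. -/
structure CondC1 (P : Measure (Vec p)) (ψ : Vec d → Vec p → Vec d) (Θ : Set (Vec d))
    (θ₀ : Vec d) : Prop where
  compact : IsCompact Θ
  interior : θ₀ ∈ interior Θ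
  root : ∀ θ ∈ Θ, ∫ z, ψ θ z ∂P = 0 ↔ θ = θ₀

/-- `z ↦ ψ_θ(z)` is measurable for every `θ ∈ Θ`. -/
def CondMeasurable (ψ : Vec d → Vec p → Vec d) (Θ : Set (Vec d)) : Prop :=
  ∀ θ ∈ Θ, Measurable (ψ θ)

/-- `θ ↦ ψ_θ(z)` is `r` times continuously differentiable in `Θ` for almost every `z`. -/
def CondSmooth (P : Measure (Vec p)) (ψ : Vec d → Vec p → Vec d) (Θ : Set (Vec d)) (r : ℕ) :
    Prop :=
  ∀ᵐ z ∂P, ContDiffOn ℝ r (fun θ => ψ θ z) Θ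

/-- `E sup_{θ ∈ Θ} ‖∇^κ ψ_θ(Z)‖² < ∞`. -/
def CondEnvelope (P : Measure (Vec p)) (ψ : Vec d → Vec p → Vec d) (Θ : Set (Vec d)) (κ : ℕ) :
    Prop :=
  ∫⁻ z, ⨆ θ ∈ Θ, ‖gradPow ψ Θ κ θ z‖ₑ ^ 2 ∂P < ∞

/-- `E ‖∇^κ ψ_{θ₀}(Z)‖⁴ < ∞`. -/
def CondFourth (P : Measure (Vec p)) (ψ : Vec d → Vec p → Vec d) (Θ : Set (Vec d)) (θ₀ : Vec d)
    (κ : ℕ) : Prop :=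
  ∫⁻ z, ‖gradPow ψ Θ κ θ₀ z‖ₑ ^ 4 ∂P < ∞

end Conditions

/-- `k_N m_N / N` tends to a limit `α ∈ (0, ∞]`. -/
def PosRatio (k m : ℕ → ℕ) : Prop :=
  ∃ α : ℝ≥0∞, 0 < α ∧ Tendsto (fun N => ((k N * m N : ℕ) : ℝ≥0∞) / N) atTop (𝓝 α)

/-- `k_N m_N / N → 0`. -/
def ZeroRatio (k m : ℕ → ℕ) : Prop :=
  Tendsto (fun N => ((k N * m N : ℕ) : ℝ) / N) atTop (𝓝 0)

/-- The two settings for the uncorrected estimator. -/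
def Setting (k m : ℕ → ℕ) : Prop :=
  (PosRatio k m ∧ Tendsto (fun N => (k N : ℝ) / √(N : ℝ)) atTop atTop) ∨
  (ZeroRatio k m ∧ Tendsto m atTop atTop ∧
    Tendsto (fun N => (k N : ℝ) / (m N : ℝ)) atTop atTop)

/-- The two settings for the bias-corrected estimators. -/
def SettingBC (k m : ℕ → ℕ) : Prop :=
  (PosRatio k m ∧ (fun N => (k N : ℝ)) =O[atTop] (fun N => √(N : ℝ)) ∧
    Tendsto (fun N => (k N : ℝ) / (N : ℝ) ^ (1 / 3 : ℝ)) atTop atTop) ∨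
  (ZeroRatio k m ∧ Tendsto m atTop atTop ∧
    (fun N => (k N : ℝ)) =O[atTop] (fun N => (m N : ℝ)) ∧
    Tendsto (fun N => (k N : ℝ) / √(m N : ℝ)) atTop atTop)

end Subbagging

end

set_option linter.unusedSectionVars false

noncomputable section

namespace Subbagging

/-! ### Moments of sums of independent variables -/

/-! The proof rests on one notion, `AsympLinear`: an estimator `T` satisfies `T k = θ₀ + mean of φ +
error` with `k` times the mean squared error tending to `0`, where `φ = -V⁻¹ ψ_{θ₀}` is the
`influence` function. Any such estimator has a consistent subbagging variance
(`tendstoInMeasure_omega`), and the uncorrected estimator and its three corrections are all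
asymptotically linear with the same `φ`, whose covariance matrix is `Ξ`.

From linearity to the variance. On each subsample, `√k (T - θ₀)` is a normalized sum of `φ` plus a
remainder. The remainders are handled by Markov's inequality, since every subsample has the law of a
sample of size `k`. For the sums, the average of a statistic over `m` random subsets has second
moment at most `C / m + D`, with `C` for one subset and `D` for the average over all subsets of size
`k` (`IsSubsampling.second_moment`). Counting subsets makes the complete averages explicit, and `D`
is of order `k / N` for linear statistics and `1 / N + (k / N)²` for centred products of two. Both
settings force `m` to tend to infinity, so averages of `φ` vanish and averages of products tend to
their expectations.

To linearity. The estimators are bounded, at least for large `k`, so events of probability `o(1 /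
k)` cost nothing after multiplication by `k` (`asympLinear_of_bound`). Off such rare events it is
enough to bound the linearization error by a small multiple of the linear term plus `C / k`. The
tool is a law of large numbers whose failure probability is `o(1 / k)` under second moments only
(`lln_of_memLp`): a simple approximation has all moments, hence failure probability `O(k⁻²)`, and
the rest has small variance. Applied in the Banach space `C(Θ, F)`, it becomes a uniform law over
the parameter space for `ψ` and its derivatives.

Roots. Off a rare event the averaged equations are nearly linear around `θ₀`, hence have a root
there, and are uniformly close to their expectation, hence have no root elsewhere
(`Regular.zEstimator_local`).

Corrections. The correction terms involve sample means of `e²` for an envelope `e` with a second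
moment only. The largest `e` in a sample is at most `η k` off a rare event, for any fixed `η > 0`
(`negligible_max_large`), so such a mean is at most `η k` times the mean of `e`; after division by
`k` it is a small constant. At `θ₀` itself the fourth moments give a bounded mean. Hence the
corrections contribute `C / k` plus a small multiple of the distance to `θ₀`, and linearity is
preserved. -/

theorem integrable_pow_of_memLp {Ω : Type*} [MeasurableSpace Ω] {μ : Measure Ω} [IsFiniteMeasure μ]
    {f : Ω → ℝ} {q : ℕ} (hf : MemLp f q μ) {r : ℕ} (hr : r ≤ q) : Integrable (fun ω => f ω ^ r) μ := by
  have h : MemLp f r μ := hf.mono_exponent (by exact_mod_cast hr)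
  rcases Nat.eq_zero_or_pos r with rfl | h0
  · simp
  have := h.integrable_norm_pow (by omega)
  refine this.mono' (h.1.pow r) (ae_of_all _ fun ω => ?_)
  simp

/-- Moments of a sum of independent centered variables. -/
theorem sum_moments {Ω ι : Type*} [MeasurableSpace Ω] {μ : Measure Ω} [IsProbabilityMeasure μ]
    {X : ι → Ω → ℝ} (hX : iIndepFun X μ) (hL : ∀ i, MemLp (X i) 4 μ)
    (h0 : ∀ i, ∫ ω, X i ω ∂μ = 0) {σ τ : ℝ} (hσ : ∀ i, ∫ ω, X i ω ^ 2 ∂μ ≤ σ)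
    (hτ : ∀ i, ∫ ω, X i ω ^ 4 ∂μ ≤ τ) (s : Finset ι) :
    MemLp (fun ω => ∑ i ∈ s, X i ω) 4 μ ∧ ∫ ω, ∑ i ∈ s, X i ω ∂μ = 0 ∧
      ∫ ω, (∑ i ∈ s, X i ω) ^ 2 ∂μ ≤ s.card * σ ∧
      ∫ ω, (∑ i ∈ s, X i ω) ^ 4 ∂μ ≤ s.card * τ + 3 * s.card ^ 2 * σ ^ 2 := by
  classical
  induction s using Finset.induction_on with
  | empty => simp
  | insert a s ha ih =>
    obtain ⟨hS, hS0, hS2, hS4⟩ := ih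
    have hi : IndepFun (fun ω => ∑ i ∈ s, X i ω) (X a) μ := by
      have := hX.indepFun_finsetSum_of_notMem₀ (fun i => (hL i).1.aemeasurable) ha
      convert this using 1
      ext ω; simp
    set S := fun ω => ∑ i ∈ s, X i ω with hSdef
    have e : (fun ω => ∑ i ∈ insert a s, X i ω) = fun ω => S ω + X a ω := by
      ext ω; rw [Finset.sum_insert ha, add_comm]
    have e' : ∀ ω, ∑ i ∈ insert a s, X i ω = S ω + X a ω := fun ω => congrFun e ω
    have hprod : ∀ p q : ℕ, p ≤ 4 → q ≤ 4 →
        Integrable (fun ω => S ω ^ p * X a ω ^ q) μ ∧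
        ∫ ω, S ω ^ p * X a ω ^ q ∂μ = (∫ ω, S ω ^ p ∂μ) * ∫ ω, X a ω ^ q ∂μ := by
      intro p q hp hq
      have hpq : IndepFun (fun ω => S ω ^ p) (fun ω => X a ω ^ q) μ :=
        hi.comp (φ := fun x : ℝ => x ^ p) (ψ := fun x : ℝ => x ^ q) (by fun_prop) (by fun_prop)
      exact ⟨hpq.integrable_mul (integrable_pow_of_memLp (q := 4) hS hp) (integrable_pow_of_memLp (q := 4) (hL a) hq),
        hpq.integral_fun_mul_eq_mul_integral (hS.1.pow p) ((hL a).1.pow q)⟩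
    have hXa0 := h0 a
    have i1 := hprod 1 1 (by norm_num) (by norm_num)
    have i31 := hprod 3 1 (by norm_num) (by norm_num)
    have i13 := hprod 1 3 (by norm_num) (by norm_num)
    have i22 := hprod 2 2 (by norm_num) (by norm_num)
    have iS : ∀ p : ℕ, p ≤ 4 → Integrable (fun ω => S ω ^ p) μ :=
      fun p hp => integrable_pow_of_memLp (q := 4) hS hp
    have iX : ∀ p : ℕ, p ≤ 4 → Integrable (fun ω => X a ω ^ p) μ :=
      fun p hp => integrable_pow_of_memLp (q := 4) (hL a) hp
    -- Cross terms with a factor of degree one vanish, since both the old sum and the new variable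
    -- are centred. Only the `(2, 2)` term survives in the fourth moment.
    simp only [pow_one, hXa0, hS0, mul_zero, zero_mul] at i1 i31 i13
    have hcard : ((insert a s).card : ℝ) = s.card + 1 := by
      rw [Finset.card_insert_of_notMem ha]; push_cast; ring
    simp only [e', hcard]
    have hS2' : (0:ℝ) ≤ ∫ ω, S ω ^ 2 ∂μ := integral_nonneg fun ω => by positivity
    have hX2' : (0:ℝ) ≤ ∫ ω, X a ω ^ 2 ∂μ := integral_nonneg fun ω => by positivity
    refine ⟨hS.add (hL a), ?_, ?_, ?_⟩
    · rw [integral_add (by simpa using iS 1 (by norm_num)) (by simpa using iX 1 (by norm_num)), hS0,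
        hXa0, add_zero]
    · have : ∀ ω, (S ω + X a ω) ^ 2 = S ω ^ 2 + 2 * (S ω * X a ω) + X a ω ^ 2 := fun ω => by ring
      simp only [this]
      have g2 : ∫ ω, (S ω ^ 2 + 2 * (S ω * X a ω) + X a ω ^ 2) ∂μ
          = (∫ ω, S ω ^ 2 ∂μ) + ∫ ω, X a ω ^ 2 ∂μ := by
        refine (integral_add ((iS 2 (by norm_num)).add (i1.1.const_mul 2))
          (iX 2 (by norm_num))).trans ?_
        congr 1
        refine (integral_add (iS 2 (by norm_num)) (i1.1.const_mul 2)).trans ?_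
        rw [integral_const_mul, i1.2, mul_zero, add_zero]
      rw [g2]
      linarith [hσ a]
    · have : ∀ ω, (S ω + X a ω) ^ 4 = S ω ^ 4 + 4 * (S ω ^ 3 * X a ω)
          + 6 * (S ω ^ 2 * X a ω ^ 2) + 4 * (S ω * X a ω ^ 3) + X a ω ^ 4 := fun ω => by ring
      simp only [this]
      have j1 := (iS 4 le_rfl).add (i31.1.const_mul 4)
      have j2 := j1.add (i22.1.const_mul 6)
      have j3 := j2.add (i13.1.const_mul 4)
      have g4 : ∫ ω, (S ω ^ 4 + 4 * (S ω ^ 3 * X a ω)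
          + 6 * (S ω ^ 2 * X a ω ^ 2) + 4 * (S ω * X a ω ^ 3) + X a ω ^ 4) ∂μ
          = (∫ ω, S ω ^ 4 ∂μ) + 6 * ((∫ ω, S ω ^ 2 ∂μ) * ∫ ω, X a ω ^ 2 ∂μ)
            + ∫ ω, X a ω ^ 4 ∂μ := by
        refine (integral_add j3 (iX 4 le_rfl)).trans ?_
        congr 1
        refine (integral_add j2 (i13.1.const_mul 4)).trans ?_
        rw [integral_const_mul, i13.2, mul_zero, add_zero]
        refine (integral_add j1 (i22.1.const_mul 6)).trans ?_
        rw [integral_const_mul, i22.2]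
        congr 1
        refine (integral_add (iS 4 le_rfl) (i31.1.const_mul 4)).trans ?_
        rw [integral_const_mul, i31.2, mul_zero, add_zero]
      rw [g4]
      have hσ0 : 0 ≤ σ := hX2'.trans (hσ a)
      have := mul_le_mul hS2 (hσ a) hX2' (by positivity)
      -- With `n = s.card`, the cross term is at most `6 n σ²`, which fits into the increment `3 (2
      -- n + 1) σ²` of `3 n² σ²`.
      nlinarith [hτ a, sq_nonneg σ]

/-! ### Rare events -/

section Negligible

variable {E : Type*} [MeasurableSpace E]

/-- The events `A k`, about a sample of size `k`, have probability `o(1 / k)`. -/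
def Negligible (P : Measure E) (A : (k : ℕ) → Set (Fin k → E)) : Prop :=
  Tendsto (fun k : ℕ => (k : ℝ≥0∞) * Measure.pi (fun _ : Fin k => P) (A k)) atTop (𝓝 0)

variable {P : Measure E}

theorem negligible_of_subset_empty {A : (k : ℕ) → Set (Fin k → E)} (h : ∀ k, A k ⊆ ∅) :
    Negligible P A := by
  simp only [Negligible, Set.subset_empty_iff.1 (h _), measure_empty, mul_zero, tendsto_const_nhds]

/-- The inclusion is needed only for large `k` and almost surely, so that almost sure facts about
samples (smoothness at every point, the equation that the estimator solves) may be used when bad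
events are compared. The events need not be measurable. -/
theorem Negligible.mono {A B : (k : ℕ) → Set (Fin k → E)} (hA : Negligible P A)
    (h : ∀ᶠ k in atTop, ∀ᵐ z ∂(Measure.pi fun _ : Fin k => P), z ∈ B k → z ∈ A k) :
    Negligible P B := by
  refine tendsto_of_tendsto_of_tendsto_of_le_of_le' tendsto_const_nhds hA
    (Eventually.of_forall fun _ => zero_le) ?_
  filter_upwards [h] with k hk
  gcongr 1
  exact measure_mono_ae hk

theorem Negligible.union {A B : (k : ℕ) → Set (Fin k → E)} (hA : Negligible P A)
    (hB : Negligible P B) : Negligible P fun k => A k ∪ B k := by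
  have := hA.add hB
  rw [add_zero] at this
  refine tendsto_of_tendsto_of_tendsto_of_le_of_le tendsto_const_nhds this
    (fun _ => zero_le) fun k => ?_
  simp only
  rw [← mul_add]
  gcongr
  exact measure_union_le _ _

/-- Almost every sample consists of points with an almost sure property. -/
theorem ae_pi_forall [IsProbabilityMeasure P] {q : E → Prop} (h : ∀ᵐ x ∂P, q x) (k : ℕ) :
    ∀ᵐ z ∂(Measure.pi fun _ : Fin k => P), ∀ i, q (z i) :=
  ae_all_iff.2 fun i =>
    (measurePreserving_eval (fun _ : Fin k => P) i).quasiMeasurePreserving.ae h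

theorem negligible_of_le {A : (k : ℕ) → Set (Fin k → E)} {u : ℕ → ℝ}
    (h : ∀ᶠ k in atTop, Measure.pi (fun _ : Fin k => P) (A k) ≤ ENNReal.ofReal (u k))
    (hu : Tendsto (fun k : ℕ => k * u k) atTop (𝓝 0)) : Negligible P A := by
  have h1 : Tendsto (fun k : ℕ => ENNReal.ofReal (k * u k)) atTop (𝓝 0) := by
    simpa using ENNReal.tendsto_ofReal hu
  refine tendsto_of_tendsto_of_tendsto_of_le_of_le' tendsto_const_nhds h1
    (Eventually.of_forall fun _ => zero_le) ?_
  filter_upwards [h] with k hk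
  rw [ENNReal.ofReal_mul (by positivity), ENNReal.ofReal_natCast]
  gcongr

variable [IsProbabilityMeasure P]

theorem iIndepFun_eval {g : E → ℝ} (hg : AEMeasurable g P) (k : ℕ) :
    iIndepFun (fun (i : Fin k) (z : Fin k → E) => g (z i)) (Measure.pi fun _ : Fin k => P) :=
  iIndepFun_pi (X := fun _ => g) fun _ => hg

/-- Moments of a sum over a sample. -/
theorem sample_moments {g : E → ℝ} (hg : MemLp g 4 P) (h0 : ∫ x, g x ∂P = 0) (k : ℕ) :
    MemLp (fun z : Fin k → E => ∑ i, g (z i)) 4 (Measure.pi fun _ : Fin k => P) ∧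
      ∫ z : Fin k → E, (∑ i, g (z i)) ^ 2 ∂(Measure.pi fun _ : Fin k => P)
        ≤ k * ∫ x, g x ^ 2 ∂P ∧
      ∫ z : Fin k → E, (∑ i, g (z i)) ^ 4 ∂(Measure.pi fun _ : Fin k => P)
        ≤ k * ∫ x, g x ^ 4 ∂P + 3 * k ^ 2 * (∫ x, g x ^ 2 ∂P) ^ 2 := by
  have hmp := fun i => measurePreserving_eval (fun _ : Fin k => P) i
  have hL : ∀ i, MemLp (fun z : Fin k → E => g (z i)) 4 (Measure.pi fun _ : Fin k => P) :=
    fun i => hg.comp_measurePreserving (hmp i)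
  have hintg : ∀ (i : Fin k) {f : E → ℝ}, AEStronglyMeasurable f P →
      ∫ z : Fin k → E, f (z i) ∂(Measure.pi fun _ : Fin k => P) = ∫ x, f x ∂P :=
    fun i f hf => by
      have h := integral_map (μ := Measure.pi fun _ : Fin k => P) (hmp i).aemeasurable
        (f := f) (by rw [(hmp i).map_eq]; exact hf)
      rw [(hmp i).map_eq] at h
      exact h.symm
  have := sum_moments (iIndepFun_eval hg.1.aemeasurable k) hL
    (fun i => (hintg i hg.1).trans h0)
    (fun i => (hintg i (f := fun x => g x ^ 2) (hg.1.pow 2)).le)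
    (fun i => (hintg i (f := fun x => g x ^ 4) (hg.1.pow 4)).le) Finset.univ
  rw [Finset.card_univ, Fintype.card_fin] at this
  exact ⟨this.1, this.2.2⟩

/-- The variance of a sum over a sample. -/
theorem sample_variance {g : E → ℝ} (hg : MemLp g 2 P) (k : ℕ) :
    ∫ z : Fin k → E, (∑ i, (g (z i) - ∫ x, g x ∂P)) ^ 2 ∂(Measure.pi fun _ : Fin k => P)
        ≤ k * ∫ x, g x ^ 2 ∂P ∧
    MemLp (fun z : Fin k → E => ∑ i, (g (z i) - ∫ x, g x ∂P)) 2
      (Measure.pi fun _ : Fin k => P) := by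
  have hmp := fun i => measurePreserving_eval (fun _ : Fin k => P) i
  set c := ∫ x, g x ∂P
  have hL : ∀ i, MemLp (fun z : Fin k → E => g (z i)) 2 (Measure.pi fun _ : Fin k => P) :=
    fun i => hg.comp_measurePreserving (hmp i)
  have hintg : ∀ (i : Fin k) {f : E → ℝ}, AEStronglyMeasurable f P →
      ∫ z : Fin k → E, f (z i) ∂(Measure.pi fun _ : Fin k => P) = ∫ x, f x ∂P :=
    fun i f hf => by
      have h := integral_map (μ := Measure.pi fun _ : Fin k => P) (hmp i).aemeasurable
        (f := f) (by rw [(hmp i).map_eq]; exact hf)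
      rw [(hmp i).map_eq] at h
      exact h.symm
  have hLc : ∀ i : Fin k, MemLp (fun z : Fin k → E => g (z i) - c) 2
    (Measure.pi fun _ : Fin k => P) := fun i => (hL i).sub (memLp_const _)
  refine ⟨?_, ?_⟩
  · have hv := IndepFun.variance_sum (μ := Measure.pi fun _ : Fin k => P) (s := Finset.univ)
      (X := fun (i : Fin k) (z : Fin k → E) => g (z i)) (fun i _ => hL i)
      (fun i _ j _ hij => (iIndepFun_eval hg.1.aemeasurable k).indepFun hij)
    have h1 : Var[∑ i, fun z : Fin k → E => g (z i); Measure.pi fun _ : Fin k => P] =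
        ∫ z : Fin k → E, (∑ i, (g (z i) - c)) ^ 2 ∂(Measure.pi fun _ : Fin k => P) := by
      rw [variance_eq_integral (by
        exact (memLp_finsetSum' _ fun i _ => hL i).1.aemeasurable)]
      congr 1; ext z
      simp only [Finset.sum_apply]
      rw [integral_finsetSum _ fun i _ => (hL i).integrable (by norm_num)]
      rw [Finset.sum_congr rfl fun i _ => hintg i hg.1, ← Finset.sum_sub_distrib]
    rw [← h1, hv]
    calc _ ≤ ∑ i : Fin k, ∫ x, g x ^ 2 ∂P := by
          refine Finset.sum_le_sum fun i _ => ?_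
          refine (variance_le_expectation_sq (hL i).1).trans ?_
          exact (hintg i (hg.1.pow 2)).le
      _ = _ := by simp
  · exact memLp_finsetSum _ fun i _ => hLc i

/-- Chebyshev's inequality, in the form used below. -/
theorem measure_ge_le_of_integral {Ω : Type*} [MeasurableSpace Ω] {μ : Measure Ω}
    {f : Ω → ℝ} (hf0 : ∀ ω, 0 ≤ f ω) (hf : Integrable f μ) {B t : ℝ} (ht : 0 < t)
    (hB : ∫ ω, f ω ∂μ ≤ B) : μ {ω | t ≤ f ω} ≤ ENNReal.ofReal (B / t) := by
  have h1 := mul_meas_ge_le_lintegral₀ (μ := μ) (f := fun ω => ENNReal.ofReal (f ω))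
    hf.1.aemeasurable.ennreal_ofReal (ENNReal.ofReal t)
  rw [← ofReal_integral_eq_lintegral_ofReal hf (ae_of_all _ hf0)] at h1
  have h2 : {ω | t ≤ f ω} ⊆ {ω | ENNReal.ofReal t ≤ ENNReal.ofReal (f ω)} :=
    fun ω h => ENNReal.ofReal_le_ofReal h
  rw [ENNReal.ofReal_div_of_pos ht, ENNReal.le_div_iff_mul_le (by simp [ht]) (by simp), mul_comm]
  calc _ ≤ ENNReal.ofReal t * μ {ω | ENNReal.ofReal t ≤ ENNReal.ofReal (f ω)} := by gcongr
    _ ≤ _ := h1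
    _ ≤ _ := ENNReal.ofReal_le_ofReal hB

end Negligible

/-! ### Laws of large numbers with rate `o(1 / k)` -/

section LLN

variable {E : Type*} [MeasurableSpace E] {P : Measure E} [IsProbabilityMeasure P]

/-- The fourth moment of the centred sum is `O(k²)`, so Markov's inequality for fourth powers gives
probability `O(k⁻²)`. The variance alone would give only `O(1 / k)`. -/
theorem negligible_mean_of_memLp_four {g : E → ℝ} (hg : MemLp g 4 P) {ε : ℝ} (hε : 0 < ε) :
    Negligible P fun k => {z | ε ≤ |(k : ℝ)⁻¹ * ∑ i, g (z i) - ∫ x, g x ∂P|} := by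
  set c := ∫ x, g x ∂P with hc
  have hgc : MemLp (fun x => g x - c) 4 P := hg.sub (memLp_const _)
  have h0 : ∫ x, (g x - c) ∂P = 0 := by
    rw [integral_sub (hg.integrable (by norm_num)) (integrable_const _)]; simp [hc]
  set τ := ∫ x, (g x - c) ^ 4 ∂P
  set σ := ∫ x, (g x - c) ^ 2 ∂P
  refine negligible_of_le (u := fun k => (k * τ + 3 * k ^ 2 * σ ^ 2) / (k * ε) ^ 4) ?_ ?_
  · filter_upwards [eventually_gt_atTop 0] with k hk
    have hk' : (0 : ℝ) < k := by exact_mod_cast hk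
    obtain ⟨m1, -, m3⟩ := sample_moments hgc h0 k
    refine (measure_mono ?_).trans (measure_ge_le_of_integral
      (f := fun z : Fin k → E => (∑ i, (g (z i) - c)) ^ 4) (fun z => by positivity)
      (integrable_pow_of_memLp (q := 4) m1 le_rfl) (t := (k * ε) ^ 4) (by positivity) m3)
    intro z hz
    simp only [Set.mem_ofPred_eq] at hz ⊢
    have : ∑ i, (g (z i) - c) = k * ((k : ℝ)⁻¹ * ∑ i, g (z i) - c) := by
      rw [Finset.sum_sub_distrib]; simp; field_simp
    rw [this, mul_pow _ (_ - c), ← Even.pow_abs (by decide : Even 4) (_ - c), ← mul_pow]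
    exact pow_le_pow_left₀ (by positivity) (mul_le_mul_of_nonneg_left hz hk'.le) 4
  · have h1 : Tendsto (fun k : ℕ => τ / ε ^ 4 * (k : ℝ)⁻¹ ^ 2 + 3 * σ ^ 2 / ε ^ 4 * (k : ℝ)⁻¹)
        atTop (𝓝 (τ / ε ^ 4 * 0 ^ 2 + 3 * σ ^ 2 / ε ^ 4 * 0)) :=
      ((tendsto_inv_atTop_nhds_zero_nat.pow 2).const_mul _).add
        (tendsto_inv_atTop_nhds_zero_nat.const_mul _)
    norm_num at h1
    refine h1.congr' ?_
    filter_upwards [eventually_gt_atTop 0] with k hk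
    have hk' : (0 : ℝ) < k := by exact_mod_cast hk
    field_simp

variable {F : Type*} [NormedAddCommGroup F] [NormedSpace ℝ F]

/-- The law of large numbers holds for `X` with probability `1 - o(1 / k)`. -/
def LLN (P : Measure E) (X : E → F) : Prop :=
  ∀ ε > 0, Negligible P fun k => {z | ε ≤ ‖(k : ℝ)⁻¹ • ∑ i, X (z i) - ∫ x, X x ∂P‖}

/-- A multiple of an indicator reduces to a scalar variable with all moments. These are the building
blocks of the simple functions in `lln_of_memLp`; the `+ 1` below covers `c = 0`. -/
theorem lln_indicator [CompleteSpace F] {s : Set E} (hs : MeasurableSet s) (c : F) :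
    LLN P (s.indicator fun _ => c) := by
  intro ε hε
  have hg : MemLp (s.indicator fun _ => (1 : ℝ)) 4 P := (memLp_const _).indicator hs
  refine (negligible_mean_of_memLp_four hg (ε := ε / (‖c‖ + 1)) (by positivity)).mono
    (Eventually.of_forall fun k => ae_of_all _ fun z hz => ?_)
  simp only [Set.mem_ofPred_eq] at hz ⊢
  have hfun : ∀ x, s.indicator (fun _ => c) x = s.indicator (fun _ => (1 : ℝ)) x • c := by
    intro x; by_cases hx : x ∈ s <;> simp [hx]
  simp only [hfun] at hz
  rw [integral_smul_const, ← Finset.sum_smul, smul_smul, ← sub_smul, norm_smul,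
    Real.norm_eq_abs] at hz
  rw [div_le_iff₀ (by positivity)]
  refine hz.trans (mul_le_mul_of_nonneg_left (by linarith) (abs_nonneg _))

theorem LLN.add {X Y : E → F} (hX : LLN P X) (hY : LLN P Y) (iX : Integrable X P)
    (iY : Integrable Y P) : LLN P (X + Y) := by
  intro ε hε
  refine ((hX (ε / 2) (by positivity)).union (hY (ε / 2) (by positivity))).mono
    (Eventually.of_forall fun k => ae_of_all _ fun z hz => ?_)
  simp only [Set.mem_ofPred_eq, Set.mem_union] at hz ⊢
  by_contra! h
  have : (k : ℝ)⁻¹ • ∑ i, (X + Y) (z i) - ∫ x, (X + Y) x ∂P =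
      ((k : ℝ)⁻¹ • ∑ i, X (z i) - ∫ x, X x ∂P) + ((k : ℝ)⁻¹ • ∑ i, Y (z i) - ∫ x, Y x ∂P) := by
    simp only [Pi.add_apply]
    rw [integral_add iX iY, Finset.sum_add_distrib, smul_add]; abel
  rw [this] at hz
  linarith [norm_add_le ((k : ℝ)⁻¹ • ∑ i, X (z i) - ∫ x, X x ∂P)
    ((k : ℝ)⁻¹ • ∑ i, Y (z i) - ∫ x, Y x ∂P)]

/-- A square integrable random vector satisfies the law of large numbers with rate
`o(1 / k)`. -/
theorem lln_of_memLp [CompleteSpace F] {X : E → F} (hX : MemLp X 2 P) : LLN P X := by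
  intro ε hε
  rw [Negligible, ENNReal.tendsto_nhds_zero]
  intro δ hδ
  -- approximation by a simple function
  obtain ⟨η, hη0, hη1, hηδ⟩ : ∃ η : ℝ, 0 < η ∧ η ≤ ε / 8 ∧
      ENNReal.ofReal (η ^ 2 / (ε / 4) ^ 2) ≤ δ / 2 := by
    have h1 : Tendsto (fun η : ℝ => ENNReal.ofReal (η ^ 2 / (ε / 4) ^ 2)) (𝓝[>] 0) (𝓝 0) := by
      have : Continuous fun η : ℝ => ENNReal.ofReal (η ^ 2 / (ε / 4) ^ 2) :=
        ENNReal.continuous_ofReal.comp (by fun_prop)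
      simpa using (this.tendsto 0).mono_left nhdsWithin_le_nhds
    have h2 := (ENNReal.tendsto_nhds_zero.1 h1 (δ / 2) (by simpa using hδ.ne')).and
      ((eventually_mem_nhdsWithin).and
        (nhdsWithin_le_nhds (Iio_mem_nhds (show (0:ℝ) < ε / 8 by positivity))))
    obtain ⟨η, h, h', h''⟩ := h2.exists
    exact ⟨η, h', le_of_lt h'', h⟩
  obtain ⟨Y, hXY, hYm, hYL⟩ := MemLp.induction_dense (p := 2) (by norm_num)
    (P := fun g : E → F => MemLp g 2 P ∧ LLN P g)
    (fun c s hs _ e _ => ⟨s.indicator fun _ => c, by simp,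
      (memLp_const _).indicator hs, lln_indicator hs c⟩)
    (fun f g hf hg => ⟨hf.1.add hg.1, hf.2.add hg.2 (hf.1.integrable (by norm_num))
      (hg.1.integrable (by norm_num))⟩)
    (fun f hf => hf.1.1) hX (ε := ENNReal.ofReal η) (by simpa using hη0)
  have hD : MemLp (fun x => ‖X x - Y x‖) 2 P := (hX.sub hYm).norm
  have hD2 : ∫ x, ‖X x - Y x‖ ^ 2 ∂P ≤ η ^ 2 := by
    have h := (hX.sub hYm).eLpNorm_eq_integral_rpow_norm (by norm_num) (by norm_num)
    rw [h, ENNReal.ofReal_le_ofReal_iff hη0.le] at hXY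
    norm_num at hXY
    rw [← Real.sqrt_eq_rpow, Real.sqrt_le_left hη0.le] at hXY
    exact hXY
  have hD1 : ∫ x, ‖X x - Y x‖ ∂P ≤ η := by
    have hv := variance_nonneg (fun x => ‖X x - Y x‖) P
    rw [variance_eq_sub hD] at hv
    have h3 : (∫ x, ‖X x - Y x‖ ∂P) ^ 2 ≤ η ^ 2 := by
      refine le_trans ?_ hD2
      simpa using hv
    exact abs_le_of_sq_le_sq' h3 hη0.le |>.2
  have hYn := hYL (ε / 4) (by positivity)
  filter_upwards [ENNReal.tendsto_nhds_zero.1 hYn (δ / 2) (by simpa using hδ.ne'),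
    eventually_gt_atTop 0] with k hk hk0
  have hk' : (0 : ℝ) < k := by exact_mod_cast hk0
  obtain ⟨v1, v2⟩ := sample_variance hD k
  set c := ∫ x, ‖X x - Y x‖ ∂P
  -- Chebyshev's inequality for the scalar `‖X - Y‖`. After multiplication by `k` the bound is `η² /
  -- (ε / 4)²`, which does not decay in `k` but is small because `Y` was chosen close to `X`.
  have hB : Measure.pi (fun _ : Fin k => P)
      {z | (k * (ε / 4)) ^ 2 ≤ (∑ i, (‖X (z i) - Y (z i)‖ - c)) ^ 2} ≤
      ENNReal.ofReal (k * η ^ 2 / (k * (ε / 4)) ^ 2) := by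
    refine measure_ge_le_of_integral (fun z => by positivity)
      (integrable_pow_of_memLp (q := 2) v2 le_rfl) (by positivity) (v1.trans ?_)
    gcongr
  -- Off both events the three pieces of the deviation of `X` add up to less than `(ε / 4 + η) + ε /
  -- 4 + η`, which is at most `3 ε / 4` because `η ≤ ε / 8`.
  have hsub : {z : Fin k → E | ε ≤ ‖(k : ℝ)⁻¹ • ∑ i, X (z i) - ∫ x, X x ∂P‖} ⊆
      {z | ε / 4 ≤ ‖(k : ℝ)⁻¹ • ∑ i, Y (z i) - ∫ x, Y x ∂P‖} ∪
      {z | (k * (ε / 4)) ^ 2 ≤ (∑ i, (‖X (z i) - Y (z i)‖ - c)) ^ 2} := by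
    intro z hz
    simp only [Set.mem_ofPred_eq, Set.mem_union] at hz ⊢
    by_contra! h
    obtain ⟨h1, h2⟩ := h
    have h3 : ∑ i, (‖X (z i) - Y (z i)‖ - c) < k * (ε / 4) :=
      lt_of_pow_lt_pow_left₀ 2 (by positivity) h2
    have h4 : ‖(k : ℝ)⁻¹ • ∑ i, (X (z i) - Y (z i))‖ ≤ ε / 4 + η := by
      rw [norm_smul, norm_inv, Real.norm_of_nonneg hk'.le]
      rw [Finset.sum_sub_distrib] at h3
      simp only [Finset.sum_const, Finset.card_univ, Fintype.card_fin, nsmul_eq_mul] at h3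
      rw [inv_mul_le_iff₀ hk']
      refine (norm_sum_le _ _).trans ?_
      nlinarith
    have h5 : ‖∫ x, X x ∂P - ∫ x, Y x ∂P‖ ≤ η := by
      rw [← integral_sub (hX.integrable (by norm_num)) (hYm.integrable (by norm_num))]
      exact (norm_integral_le_integral_norm _).trans hD1
    have h6 : (k : ℝ)⁻¹ • ∑ i, X (z i) - ∫ x, X x ∂P =
        (k : ℝ)⁻¹ • ∑ i, (X (z i) - Y (z i)) + ((k : ℝ)⁻¹ • ∑ i, Y (z i) - ∫ x, Y x ∂P)
          - (∫ x, X x ∂P - ∫ x, Y x ∂P) := by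
      rw [Finset.sum_sub_distrib, smul_sub]; abel
    rw [h6] at hz
    have h7 := norm_sub_le ((k : ℝ)⁻¹ • ∑ i, (X (z i) - Y (z i)) +
      ((k : ℝ)⁻¹ • ∑ i, Y (z i) - ∫ x, Y x ∂P)) (∫ x, X x ∂P - ∫ x, Y x ∂P)
    have h8 := norm_add_le ((k : ℝ)⁻¹ • ∑ i, (X (z i) - Y (z i)))
      ((k : ℝ)⁻¹ • ∑ i, Y (z i) - ∫ x, Y x ∂P)
    linarith
  calc
    (k : ℝ≥0∞) * Measure.pi (fun _ : Fin k => P)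
        {z | ε ≤ ‖(k : ℝ)⁻¹ • ∑ i, X (z i) - ∫ x, X x ∂P‖}
      ≤ k * (Measure.pi (fun _ : Fin k => P)
          {z | ε / 4 ≤ ‖(k : ℝ)⁻¹ • ∑ i, Y (z i) - ∫ x, Y x ∂P‖} +
          ENNReal.ofReal (k * η ^ 2 / (k * (ε / 4)) ^ 2)) := by
        gcongr
        exact (measure_mono hsub).trans ((measure_union_le _ _).trans (by gcongr))
    _ ≤ δ / 2 + δ / 2 := by
        rw [mul_add]
        gcongr
        rw [← ENNReal.ofReal_natCast, ← ENNReal.ofReal_mul (by positivity)]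
        refine le_trans (le_of_eq ?_) hηδ
        congr 1
        field_simp
    _ = δ := ENNReal.add_halves δ

/-- The sample mean of a square integrable variable is bounded off a rare event. -/
theorem negligible_mean_large {e : E → ℝ} (he : MemLp e 2 P) :
    Negligible P fun k => {z | ∫ x, e x ∂P + 1 ≤ (k : ℝ)⁻¹ * ∑ i, e (z i)} := by
  refine (lln_of_memLp he 1 one_pos).mono (Eventually.of_forall fun k => ae_of_all _ fun z hz => ?_)
  simp only [Set.mem_ofPred_eq, smul_eq_mul, Real.norm_eq_abs] at hz ⊢
  exact le_trans (by linarith) (le_abs_self _)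

/-- The largest of the values of a square integrable variable is `o(k)` off a rare event. -/
theorem negligible_max_large {e : E → ℝ} (he : MemLp e 2 P) {η : ℝ} (hη : 0 < η) :
    Negligible P fun k => {z | ∃ i, η * k < |e (z i)|} := by
  set f : E → ℝ≥0∞ := fun x => ‖e x‖ₑ ^ 2
  have hf : ∫⁻ x, f x ∂P ≠ ∞ := by
    have := he.2
    rw [eLpNorm_lt_top_iff_lintegral_rpow_enorm_lt_top (by norm_num) (by norm_num)] at this
    simpa using this.ne
  have hnull : ∀ k : ℕ, NullMeasurableSet {x | η * k < |e x|} P := fun k =>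
    nullMeasurableSet_lt aemeasurable_const he.1.aemeasurable.norm
  have h2 : ∀ k : ℕ, ENNReal.ofReal ((η * k) ^ 2) * P {x | η * k < |e x|} ≤
      ∫⁻ x in {x | η * k < |e x|}, f x ∂P := by
    intro k
    refine le_trans ?_ (mul_meas_ge_le_lintegral₀ (μ := P.restrict {x | η * k < |e x|}) (f := f)
      (he.1.enorm.pow_const 2).restrict (ENNReal.ofReal ((η * k) ^ 2)))
    refine mul_le_mul_right ?_ _
    rw [Measure.restrict_apply₀' (hnull k)]
    refine measure_mono fun x hx => ⟨?_, hx⟩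
    simp only [Set.mem_ofPred_eq, f] at hx ⊢
    rw [← ofReal_norm, ← ENNReal.ofReal_pow (norm_nonneg _)]
    exact ENNReal.ofReal_le_ofReal (pow_le_pow_left₀ (by positivity) hx.le 2)
  -- Since the tail sets have vanishing probability, the second moment restricted to them vanishes
  -- too. This improves Markov's `O(k⁻²)` to `o(k⁻²)`, which pays for the union bound over `k`
  -- points and for the factor `k`.
  have hPA : Tendsto (fun k : ℕ => P {x | η * k < |e x|}) atTop (𝓝 0) := by
    have hlim : Tendsto (fun k : ℕ => (∫⁻ x, f x ∂P) / ENNReal.ofReal ((η * k) ^ 2)) atTop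
        (𝓝 0) := by
      have h3 : Tendsto (fun k : ℕ => ENNReal.ofReal ((η * k) ^ 2)) atTop (𝓝 ∞) :=
        ENNReal.tendsto_ofReal_atTop.comp ((tendsto_pow_atTop two_ne_zero).comp
          (tendsto_natCast_atTop_atTop.const_mul_atTop hη))
      simpa using ENNReal.Tendsto.const_div h3 (Or.inr hf)
    refine tendsto_of_tendsto_of_tendsto_of_le_of_le' tendsto_const_nhds hlim
      (Eventually.of_forall fun _ => zero_le) ?_
    filter_upwards [eventually_gt_atTop 0] with k hk
    have hk' : (0 : ℝ) < k := by exact_mod_cast hk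
    rw [ENNReal.le_div_iff_mul_le (Or.inl (ENNReal.ofReal_pos.2 (by positivity)).ne') (by simp), mul_comm]
    exact (h2 k).trans (setLIntegral_le_lintegral _ _)
  have hintg := tendsto_setLIntegral_zero hf hPA
  have hlim := ENNReal.Tendsto.const_mul (a := (ENNReal.ofReal (η ^ 2))⁻¹) hintg
    (Or.inr (by simp; positivity))
  rw [mul_zero] at hlim
  refine tendsto_of_tendsto_of_tendsto_of_le_of_le' tendsto_const_nhds hlim
    (Eventually.of_forall fun _ => zero_le) ?_
  filter_upwards [eventually_gt_atTop 0] with k hk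
  have hk' : (0 : ℝ) < k := by exact_mod_cast hk
  have h1 : Measure.pi (fun _ : Fin k => P) {z | ∃ i, η * k < |e (z i)|} ≤
      k * P {x | η * k < |e x|} := by
    rw [show {z : Fin k → E | ∃ i, η * k < |e (z i)|} =
      ⋃ i, {z : Fin k → E | η * k < |e (z i)|} by ext; simp]
    refine (measure_iUnion_fintype_le _ _).trans ?_
    have : ∀ i : Fin k, Measure.pi (fun _ : Fin k => P) {z | η * k < |e (z i)|} =
        P {x | η * k < |e x|} := fun i =>
      (measurePreserving_eval (fun _ : Fin k => P) i).measure_preimage (hnull k)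
    simp [this]
  calc
    (k : ℝ≥0∞) * Measure.pi (fun _ : Fin k => P) {z | ∃ i, η * k < |e (z i)|}
      ≤ k * (k * P {x | η * k < |e x|}) := by gcongr
    _ = (ENNReal.ofReal (η ^ 2))⁻¹ *
        (ENNReal.ofReal ((η * k) ^ 2) * P {x | η * k < |e x|}) := by
      rw [mul_pow, ENNReal.ofReal_mul (by positivity), ← mul_assoc, ← mul_assoc, ← mul_assoc,
        ENNReal.inv_mul_cancel (by simp; positivity) (by simp), one_mul,
        ENNReal.ofReal_pow (by positivity), ENNReal.ofReal_natCast, sq]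
    _ ≤ _ := by
      gcongr
      exact h2 k

end LLN

/-! ### Measurability of derivatives in the parameter -/

section Measurability

variable {E : Type*} [MeasurableSpace E] {P : Measure E}
  {F : Type*} [NormedAddCommGroup F] [NormedSpace ℝ F] {d : ℕ}

/-- In finite dimension a linear map is a fixed finite combination of its values on the basis
vectors. -/
theorem aestronglyMeasurable_of_forall_apply {L : E → Vec d →L[ℝ] F}
    (h : ∀ v, AEStronglyMeasurable (fun z => L z v) P) : AEStronglyMeasurable L P := by
  have : L = fun z => ∑ j : Fin d, ContinuousLinearMap.smulRightL ℝ (Vec d) F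
      (EuclideanSpace.proj j : Vec d →L[ℝ] ℝ) (L z (EuclideanSpace.single j (1 : ℝ))) := by
    ext z v
    rw [sum_apply]
    conv_lhs => rw [← (EuclideanSpace.basisFun (Fin d) ℝ).sum_repr v]
    simp [EuclideanSpace.basisFun_apply]
  rw [this]
  exact Finset.aestronglyMeasurable_fun_sum _ fun j _ =>
    (ContinuousLinearMap.continuous _).comp_aestronglyMeasurable (h _)

/-- The derivative within a set of a family of functions that depends measurably on a parameter
depends measurably on it. -/
theorem aestronglyMeasurable_fderivWithin {f : Vec d → E → F} {Θ : Set (Vec d)} {θ : Vec d}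
    (hθ : θ ∈ Θ) (hΘ : UniqueDiffWithinAt ℝ Θ θ) (hf : ∀ t ∈ Θ, AEStronglyMeasurable (f t) P)
    (hd : ∀ᵐ z ∂P, DifferentiableWithinAt ℝ (fun t => f t z) Θ θ) :
    AEStronglyMeasurable (fun z => fderivWithin ℝ (fun t => f t z) Θ θ) P := by
  refine aestronglyMeasurable_of_forall_apply fun v => ?_
  -- The directions in which the derivative is measurable form a subspace, closed by finite
  -- dimension. It contains the tangent cone, along which the derivative is a limit of scaled
  -- differences of measurable functions, and the cone spans a dense subspace by unique
  -- differentiability.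
  let S : Submodule ℝ (Vec d) :=
    { carrier := {v | AEStronglyMeasurable (fun z => fderivWithin ℝ (fun t => f t z) Θ θ v) P}
      add_mem' := fun {a b} ha hb => by
        simp only [Set.mem_ofPred_eq, map_add] at *
        exact ha.add hb
      zero_mem' := by simp only [Set.mem_ofPred_eq, map_zero]; exact aestronglyMeasurable_const
      smul_mem' := fun c a ha => by
        simp only [Set.mem_ofPred_eq, map_smul] at *
        exact ha.const_smul c }
  have hcone : tangentConeAt ℝ Θ θ ⊆ S := by
    intro y hy
    obtain ⟨c, u, hu, huΘ, hcu⟩ := mem_tangentConeAt_iff_exists_seq.1 hy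
    obtain ⟨n, hn⟩ := eventually_atTop.1 huΘ
    refine aestronglyMeasurable_of_tendsto_ae atTop
      (f := fun j z => c (j + n) • (f (θ + u (j + n)) z - f θ z)) (fun j => ?_) ?_
    · exact ((hf _ (hn _ (by omega))).sub (hf θ hθ)).const_smul _
    · filter_upwards [hd] with z hz
      have h := hz.hasFDerivWithinAt.lim hu huΘ hcu
      exact h.comp (tendsto_add_atTop_nat n)
  have hspan : Submodule.span ℝ (tangentConeAt ℝ Θ θ) ≤ S := Submodule.span_le.2 hcone
  have hclosed : IsClosed (S : Set (Vec d)) := S.closed_of_finiteDimensional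
  have : (Set.univ : Set (Vec d)) ⊆ S := by
    rw [← hΘ.dense_tangentConeAt.closure_eq]
    exact closure_minimal hspan hclosed
  exact this (Set.mem_univ v)

/-! ### Random continuous functions -/

/-- A closed ball of `C(K, F)` is cut out by conditions at the points of a countable dense set, and
every open set of this separable space is a countable union of closed balls. Measurability of all
evaluations is therefore enough. -/
theorem aestronglyMeasurable_of_forall_eval {K : Type*} [TopologicalSpace K] [CompactSpace K]
    [SecondCountableTopology K] [LocallyCompactSpace K] [SecondCountableTopology F]
    {X : E → C(K, F)} (h : ∀ θ, AEStronglyMeasurable (fun z => X z θ) P) :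
    AEStronglyMeasurable X P := by
  borelize C(K, F)
  have hball : ∀ (g : C(K, F)) (r : ℝ), 0 ≤ r →
      NullMeasurableSet (X ⁻¹' Metric.closedBall g r) P := by
    intro g r hr
    obtain ⟨D, hDc, hD⟩ := TopologicalSpace.exists_countable_dense K
    have : X ⁻¹' Metric.closedBall g r = ⋂ θ ∈ D, {z | ‖X z θ - g θ‖ ≤ r} := by
      ext z
      simp only [Set.mem_preimage, Metric.mem_closedBall, Set.mem_iInter, Set.mem_ofPred_eq]
      rw [ContinuousMap.dist_le hr]
      simp only [dist_eq_norm]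
      refine ⟨fun H θ _ => H θ, fun H θ => ?_⟩
      have hcl : IsClosed {θ | ‖X z θ - g θ‖ ≤ r} :=
        isClosed_le (by fun_prop) continuous_const
      exact closure_minimal (fun θ hθ => H θ hθ) hcl (hD.closure_eq ▸ Set.mem_univ θ)
    rw [this]
    refine NullMeasurableSet.biInter hDc fun θ _ => ?_
    exact nullMeasurableSet_le (((h θ).sub aestronglyMeasurable_const).norm.aemeasurable)
      aemeasurable_const
  have hX : NullMeasurable X P := by
    refine measurable_of_isOpen (γ := C(K, F)) (δ := NullMeasurableSpace E P) (f := X)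
      fun U hU => ?_
    choose! r hr0 hrU using fun g (hg : g ∈ U) =>
      Metric.nhds_basis_closedBall.mem_iff.1 (hU.mem_nhds hg)
    obtain ⟨T, hTU, hTc, hT⟩ := TopologicalSpace.isOpen_biUnion_countable U
      (fun g => Metric.ball g (r g)) fun _ _ => Metric.isOpen_ball
    have hUeq : U = ⋃ g ∈ T, Metric.closedBall g (r g) := by
      refine Set.Subset.antisymm (fun g hg => ?_) (Set.iUnion₂_subset fun g hg => hrU g (hTU hg))
      have : g ∈ ⋃ i ∈ T, Metric.ball i (r i) :=
        hT ▸ Set.mem_biUnion hg (Metric.mem_ball_self (hr0 g hg))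
      obtain ⟨i, hi, hgi⟩ := Set.mem_iUnion₂.1 this
      exact Set.mem_biUnion hi (Metric.ball_subset_closedBall hgi)
    have h : NullMeasurableSet (X ⁻¹' U) P := by
      rw [hUeq, Set.preimage_iUnion₂]
      exact NullMeasurableSet.biUnion hTc fun g hg => hball g _ (hr0 g (hTU hg)).le
    exact h
  exact hX.aemeasurable.aestronglyMeasurable

/-- A random function on `Θ` with continuous paths and a square integrable envelope. -/
structure SquareEnveloped (P : Measure E) (Θ : Set (Vec d)) (g : Vec d → E → F) : Prop where
  continuous : ∀ᵐ z ∂P, ContinuousOn (fun θ => g θ z) Θ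
  measurable : ∀ θ ∈ Θ, AEStronglyMeasurable (g θ) P
  bound : ∫⁻ z, ⨆ θ ∈ Θ, ‖g θ z‖ₑ ^ 2 ∂P < ∞

open Classical in
/-- The path of a random function, as a continuous function. -/
def path (Θ : Set (Vec d)) (g : Vec d → E → F) (z : E) : C(Θ, F) :=
  if h : ContinuousOn (fun θ => g θ z) Θ then ⟨_, h.domRestrict⟩ else 0

variable {Θ : Set (Vec d)} {g : Vec d → E → F}

theorem path_apply {z : E} (h : ContinuousOn (fun θ => g θ z) Θ) (θ : Θ) :
    path Θ g z θ = g θ z := by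
  simp [path, h, Set.domRestrict]

variable [FiniteDimensional ℝ F]

theorem SquareEnveloped.memLp_path (hg : SquareEnveloped P Θ g) [CompactSpace Θ] :
    MemLp (path Θ g) 2 P := by
  have := FiniteDimensional.proper ℝ F
  refine ⟨aestronglyMeasurable_of_forall_eval fun θ => ?_, ?_⟩
  · refine (hg.measurable θ θ.2).congr ?_
    filter_upwards [hg.continuous] with z hz
    rw [path_apply hz]
  · rw [eLpNorm_lt_top_iff_lintegral_rpow_enorm_lt_top (by norm_num) (by norm_num)]
    refine lt_of_le_of_lt (lintegral_mono_ae ?_) hg.bound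
    filter_upwards [hg.continuous] with z hz
    simp only [ENNReal.toReal_ofNat, ENNReal.rpow_ofNat]
    rcases isEmpty_or_nonempty Θ with hΘ | hΘ
    · have : path Θ g z = 0 := by ext θ; exact hΘ.elim θ
      simp [this]
    -- The norm of a path is attained at a parameter, so it is at most the supremum in the envelope
    -- condition; measurability of that supremum is not needed.
    · obtain ⟨θ, -, hθ⟩ := isCompact_univ.exists_isMaxOn Set.univ_nonempty
        (path Θ g z).continuous.norm.continuousOn
      have hle : ‖path Θ g z‖ ≤ ‖path Θ g z θ‖ :=
        (ContinuousMap.norm_le _ (norm_nonneg _)).2 fun t => hθ (Set.mem_univ t)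
      rw [path_apply hz] at hle
      refine le_trans ?_ (le_iSup₂ (f := fun θ (_ : θ ∈ Θ) => ‖g θ z‖ₑ ^ 2) θ.1 θ.2)
      rw [← ofReal_norm, ← ofReal_norm]
      gcongr

/-- The envelope is the norm of the path in `C(Θ, F)`, whose measurability is already known. -/
theorem SquareEnveloped.exists_envelope (hg : SquareEnveloped P Θ g) (hΘ : IsCompact Θ) :
    ∃ e : E → ℝ, MemLp e 2 P ∧ (∀ z, 0 ≤ e z) ∧ ∀ᵐ z ∂P, ∀ θ ∈ Θ, ‖g θ z‖ ≤ e z := by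
  have := isCompact_iff_compactSpace.1 hΘ
  refine ⟨fun z => ‖path Θ g z‖, hg.memLp_path.norm, fun z => norm_nonneg _, ?_⟩
  filter_upwards [hg.continuous] with z hz θ hθ
  rw [← path_apply hz ⟨θ, hθ⟩]
  exact ContinuousMap.norm_coe_le_norm _ _

variable [IsProbabilityMeasure P]

theorem SquareEnveloped.memLp (hg : SquareEnveloped P Θ g) (hΘ : IsCompact Θ) {θ : Vec d}
    (hθ : θ ∈ Θ) : MemLp (g θ) 2 P := by
  obtain ⟨e, he, -, hge⟩ := hg.exists_envelope hΘ
  refine he.mono (hg.measurable θ hθ) ?_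
  filter_upwards [hge] with z hz
  exact (hz θ hθ).trans (le_abs_self _)

theorem SquareEnveloped.integrable (hg : SquareEnveloped P Θ g) (hΘ : IsCompact Θ) {θ : Vec d}
    (hθ : θ ∈ Θ) : Integrable (g θ) P :=
  (hg.memLp hΘ hθ).integrable (by norm_num)

/-- Evaluation is a continuous linear map and commutes with the Bochner integral. The expectations
for all parameters are thus the values of one continuous function, which yields both their
continuity and, from the law of large numbers in `C(Θ, F)`, the uniform law. -/
theorem SquareEnveloped.integral_path (hg : SquareEnveloped P Θ g) [CompactSpace Θ] (θ : Θ) :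
    (∫ z, path Θ g z ∂P) θ = ∫ z, g θ z ∂P := by
  have := FiniteDimensional.complete ℝ F
  have h := (ContinuousMap.evalCLM ℝ θ : C(Θ, F) →L[ℝ] F).integral_comp_comm
    (hg.memLp_path.integrable (by norm_num))
  simp only [ContinuousMap.evalCLM_apply] at h
  rw [← h]
  refine integral_congr_ae ?_
  filter_upwards [hg.continuous] with z hz
  rw [path_apply hz]

theorem SquareEnveloped.continuousOn_integral (hg : SquareEnveloped P Θ g) (hΘ : IsCompact Θ) :
    ContinuousOn (fun θ => ∫ z, g θ z ∂P) Θ := by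
  have := isCompact_iff_compactSpace.1 hΘ
  rw [continuousOn_iff_continuous_domRestrict]
  have : Θ.domRestrict (fun θ => ∫ z, g θ z ∂P) = ∫ z, path Θ g z ∂P := by
    ext θ; rw [hg.integral_path]; rfl
  rw [this]
  exact ContinuousMap.continuous _

/-- The uniform law of large numbers. -/
theorem SquareEnveloped.negligible (hg : SquareEnveloped P Θ g) (hΘ : IsCompact Θ) {ε : ℝ}
    (hε : 0 < ε) :
    Negligible P fun k => {z | ∃ θ ∈ Θ, ε ≤ ‖(k : ℝ)⁻¹ • ∑ i, g θ (z i) - ∫ x, g θ x ∂P‖} := by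
  have := isCompact_iff_compactSpace.1 hΘ
  have := FiniteDimensional.complete ℝ F
  refine (lln_of_memLp hg.memLp_path ε hε).mono (Eventually.of_forall fun k => ?_)
  filter_upwards [ae_pi_forall hg.continuous k] with z hz
  rintro ⟨θ, hθ, h⟩
  refine h.trans ?_
  have := ContinuousMap.norm_coe_le_norm
    ((k : ℝ)⁻¹ • ∑ i, path Θ g (z i) - ∫ x, path Θ g x ∂P) ⟨θ, hθ⟩
  refine le_trans (le_of_eq ?_) this
  rw [ContinuousMap.sub_apply, ContinuousMap.smul_apply, hg.integral_path, ContinuousMap.sum_apply]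
  simp only [path_apply (hz _)]

end Measurability

/-! ### Uniform random subsets -/

section Subsets

instance (N k : ℕ) : Fintype (Subsample N k) :=
  inferInstanceAs (Fintype {t : Finset (Fin N) // t.card = k})

instance (N k : ℕ) : DiscreteMeasurableSpace (Subsample N k) := ⟨fun _ => trivial⟩

theorem card_subsample (N k : ℕ) : Fintype.card (Subsample N k) = N.choose k := by
  have : Fintype.card (Subsample N k) = Fintype.card {t : Finset (Fin N) // t.card = k} := rfl
  rw [this, Fintype.card_finset_len, Fintype.card_fin]

theorem sum_subsample {N k : ℕ} {M : Type*} [AddCommMonoid M] (f : Finset (Fin N) → M) :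
    ∑ t : Subsample N k, f t.1 = ∑ t ∈ Finset.powersetCard k Finset.univ, f t := by
  have : ∑ t : Subsample N k, f t.1 = ∑ t : {t : Finset (Fin N) // t.card = k}, f t.1 := rfl
  rw [this]
  exact (Finset.sum_subtype _ (by simp [Finset.mem_powersetCard]) f).symm

/-- The number of subsets of size `k` that contain a given subset. -/
theorem card_filter_subset {N k : ℕ} (u : Finset (Fin N)) (hk : u.card ≤ k) :
    ((Finset.powersetCard k Finset.univ).filter (u ⊆ ·)).card
      = (N - u.card).choose (k - u.card) := by
  have : (Finset.powersetCard (k - u.card) uᶜ).card = (N - u.card).choose (k - u.card) := by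
    rw [Finset.card_powersetCard, Finset.card_compl, Fintype.card_fin]
  rw [← this]
  refine Finset.card_bij' (fun t _ => t \ u) (fun t _ => t ∪ u) ?_ ?_ ?_ ?_
  · intro t ht
    simp only [Finset.mem_filter, Finset.mem_powersetCard, Finset.subset_univ, true_and] at ht
    rw [Finset.mem_powersetCard, Finset.card_sdiff_of_subset ht.2, ht.1]
    exact ⟨fun x hx => by simp at hx ⊢; exact hx.2, rfl⟩
  · intro t ht
    rw [Finset.mem_powersetCard] at ht
    have hd : Disjoint t u := Finset.disjoint_left.2 fun x hx => by simpa using ht.1 hx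
    simp only [Finset.mem_filter, Finset.mem_powersetCard, Finset.subset_univ, true_and]
    rw [Finset.card_union_of_disjoint hd, ht.2]
    exact ⟨by omega, Finset.subset_union_right⟩
  · intro t ht
    simp only [Finset.mem_filter] at ht
    exact Finset.sdiff_union_of_subset ht.2
  · intro t ht
    rw [Finset.mem_powersetCard] at ht
    have hd : Disjoint t u := Finset.disjoint_left.2 fun x hx => by simpa using ht.1 hx
    exact Finset.union_sdiff_cancel_right hd

/-- The average of a linear statistic over all subsets of size `k`. -/
theorem average_linear {N k : ℕ} (hk : k ≤ N) (hk0 : 0 < k) (a : Fin N → ℝ) :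
    (N.choose k : ℝ)⁻¹ * ∑ t : Subsample N k, ∑ i ∈ t.1, a i = k / N * ∑ i, a i := by
  rw [sum_subsample (fun t => ∑ i ∈ t, a i)]
  have h1 : ∑ t ∈ Finset.powersetCard k (Finset.univ : Finset (Fin N)), ∑ i ∈ t, a i =
      ∑ i, ((N - 1).choose (k - 1) : ℝ) * a i := by
    -- Double counting: each index lies in `(N - 1).choose (k - 1)` subsets.
    rw [Finset.sum_comm' (t' := Finset.univ)
      (s' := fun i => (Finset.powersetCard k Finset.univ).filter ({i} ⊆ ·))
      (by intro x y; simp)]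
    refine Finset.sum_congr rfl fun i _ => ?_
    rw [Finset.sum_const, card_filter_subset _ (by rw [Finset.card_singleton]; exact hk0)]
    simp
  rw [h1, ← Finset.mul_sum, ← mul_assoc]
  congr 1
  obtain ⟨n, rfl⟩ : ∃ n, N = n + 1 := ⟨N - 1, by omega⟩
  obtain ⟨l, rfl⟩ : ∃ l, k = l + 1 := ⟨k - 1, by omega⟩
  have h2 := Nat.add_one_mul_choose_eq n l
  have h3 : (0 : ℝ) < ((n + 1).choose (l + 1) : ℝ) := by exact_mod_cast Nat.choose_pos hk
  have h2' : ((n : ℝ) + 1) * (n.choose l : ℝ) = ((n + 1).choose (l + 1) : ℝ) * (l + 1) := by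
    exact_mod_cast h2
  simp only [Nat.add_sub_cancel]
  push_cast
  field_simp
  linarith

/-- The average of a bilinear statistic over all subsets of size `k`. -/
theorem average_bilinear {N k : ℕ} (hk : k ≤ N) (hk0 : 1 < k) (a : Fin N → Fin N → ℝ) :
    (N.choose k : ℝ)⁻¹ * ∑ t : Subsample N k, ∑ i ∈ t.1, ∑ l ∈ t.1, a i l =
      k / N * ∑ i, a i i + k * (k - 1) / (N * (N - 1)) * (∑ i, ∑ l, a i l - ∑ i, a i i) := by
  have hsplit : ∀ t : Finset (Fin N), ∑ i ∈ t, ∑ l ∈ t, a i l =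
      ∑ i ∈ t, a i i + ∑ q ∈ t.offDiag, a q.1 q.2 := by
    intro t
    rw [← Finset.sum_product' t t a, ← Finset.diag_union_offDiag,
      Finset.sum_union (Finset.disjoint_diag_offDiag t), Finset.sum_diag]
  simp only [hsplit, Finset.sum_add_distrib, mul_add, average_linear hk (by omega)]
  rw [add_sub_cancel_left]
  congr 1
  rw [sum_subsample (fun t => ∑ q ∈ t.offDiag, a q.1 q.2)]
  have h1 : ∑ t ∈ Finset.powersetCard k (Finset.univ : Finset (Fin N)),
      ∑ q ∈ t.offDiag, a q.1 q.2 =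
      ∑ q ∈ Finset.univ.offDiag, ((N - 2).choose (k - 2) : ℝ) * a q.1 q.2 := by
    -- Each ordered pair of distinct indices lies in `(N - 2).choose (k - 2)` subsets.
    rw [Finset.sum_comm' (t' := Finset.univ.offDiag)
      (s' := fun q => (Finset.powersetCard k Finset.univ).filter ({q.1, q.2} ⊆ ·))
      (by intro x y; simp [Finset.mem_offDiag, Finset.insert_subset_iff]; tauto)]
    refine Finset.sum_congr rfl fun q hq => ?_
    have hc : ({q.1, q.2} : Finset (Fin N)).card = 2 :=
      Finset.card_pair (Finset.mem_offDiag.1 hq).2.2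
    rw [Finset.sum_const, card_filter_subset _ (by rw [hc]; exact hk0), hc]
    simp
  rw [h1, ← Finset.mul_sum, ← mul_assoc]
  congr 1
  obtain ⟨n, rfl⟩ : ∃ n, N = n + 2 := ⟨N - 2, by omega⟩
  obtain ⟨l, rfl⟩ : ∃ l, k = l + 2 := ⟨k - 2, by omega⟩
  have h3 : (0 : ℝ) < ((n + 2).choose (l + 2) : ℝ) := by exact_mod_cast Nat.choose_pos hk
  have h2 : ((n : ℝ) + 2) * ((n + 1).choose (l + 1) : ℝ) =
      ((n + 2).choose (l + 2) : ℝ) * (l + 2) := by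
    exact_mod_cast Nat.add_one_mul_choose_eq (n + 1) (l + 1)
  have h4 : ((n : ℝ) + 1) * (n.choose l : ℝ) = ((n + 1).choose (l + 1) : ℝ) * (l + 1) := by
    exact_mod_cast Nat.add_one_mul_choose_eq n l
  simp only [Nat.add_sub_cancel]
  push_cast
  have h5 : (n : ℝ) + 2 - 1 = n + 1 := by ring
  have h6 : (l : ℝ) + 2 - 1 = l + 1 := by ring
  rw [h5, h6]
  field_simp
  calc (n.choose l : ℝ) * (n + 2) * (n + 1) = (n + 2) * ((n + 1) * n.choose l) := by ring
    _ = ((n + 2) * ((n + 1).choose (l + 1))) * (l + 1) := by rw [h4]; ring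
    _ = _ := by rw [h2]

end Subsets

/-! ### Averages over random subsets -/

section Random

variable {Ω : Type*} [MeasurableSpace Ω] {μ : Measure Ω} [IsProbabilityMeasure μ]

/-- Conditioning on a finitely valued variable without conditional expectations: the integrand is
split along the values of `ξ`, and independence factors each piece. -/
theorem lintegral_of_indep_finite {τ 𝒴 : Type*} [Fintype τ] [MeasurableSpace τ]
    [MeasurableSingletonClass τ] [MeasurableSpace 𝒴] {ξ : Ω → τ} {Y : Ω → 𝒴} (hξ : Measurable ξ)
    (hY : Measurable Y) (hi : IndepFun ξ Y μ) {f : τ → 𝒴 → ℝ≥0∞} (hf : ∀ t, Measurable (f t)) :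
    ∫⁻ ω, f (ξ ω) (Y ω) ∂μ = ∑ t, μ (ξ ⁻¹' {t}) * ∫⁻ ω, f t (Y ω) ∂μ := by
  classical
  have h1 : ∀ ω, f (ξ ω) (Y ω) = ∑ t, ({t} : Set τ).indicator 1 (ξ ω) * f t (Y ω) := by
    intro ω
    rw [Finset.sum_eq_single (ξ ω)]
    · simp
    · intro b _ hb; simp [Ne.symm hb]
    · simp
  simp only [h1]
  have hm : ∀ t, Measurable fun ω => ({t} : Set τ).indicator (1 : τ → ℝ≥0∞) (ξ ω) := fun t =>
    (measurable_one.indicator (measurableSet_singleton t)).comp hξ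
  refine (lintegral_finsetSum _ fun t _ => (hm t).mul ((hf t).comp hY)).trans ?_
  refine Finset.sum_congr rfl fun t _ => ?_
  have := lintegral_mul_eq_lintegral_mul_lintegral_of_indepFun (hm t) ((hf t).comp hY)
    (hi.comp (φ := ({t} : Set τ).indicator (1 : τ → ℝ≥0∞)) (ψ := f t)
      (measurable_one.indicator (measurableSet_singleton t)) (hf t))
  refine this.trans ?_
  congr 1
  rw [← lintegral_indicator_one (hξ (measurableSet_singleton t))]
  rfl

theorem integral_of_indep_finite {τ 𝒴 : Type*} [Fintype τ] [MeasurableSpace τ]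
    [MeasurableSingletonClass τ] [MeasurableSpace 𝒴] {ξ : Ω → τ} {Y : Ω → 𝒴} (hξ : Measurable ξ)
    (hi : IndepFun ξ Y μ) {f : τ → 𝒴 → ℝ} (hf : ∀ t, Measurable (f t))
    (hintg : ∀ t, Integrable (fun ω => f t (Y ω)) μ) :
    Integrable (fun ω => f (ξ ω) (Y ω)) μ ∧
    ∫ ω, f (ξ ω) (Y ω) ∂μ = ∑ t, μ.real (ξ ⁻¹' {t}) * ∫ ω, f t (Y ω) ∂μ := by
  classical
  have h1 : ∀ ω, f (ξ ω) (Y ω) = ∑ t, ({t} : Set τ).indicator 1 (ξ ω) * f t (Y ω) := by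
    intro ω
    rw [Finset.sum_eq_single (ξ ω)]
    · simp
    · intro b _ hb; simp [Ne.symm hb]
    · simp
  simp only [h1]
  have hm : ∀ t, Measurable (({t} : Set τ).indicator (1 : τ → ℝ)) := fun t =>
    measurable_one.indicator (measurableSet_singleton t)
  have hI : ∀ t, IndepFun (fun ω => ({t} : Set τ).indicator (1 : τ → ℝ) (ξ ω))
      (fun ω => f t (Y ω)) μ := fun t => hi.comp (hm t) (hf t)
  have hb : ∀ t, Integrable (fun ω => ({t} : Set τ).indicator (1 : τ → ℝ) (ξ ω)) μ := fun t =>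
    (integrable_const (1 : ℝ)).mono' ((hm t).comp hξ).aestronglyMeasurable (ae_of_all _ fun ω => by
      by_cases h : ξ ω = t <;> simp [h])
  have hp : ∀ t, Integrable (fun ω => ({t} : Set τ).indicator (1 : τ → ℝ) (ξ ω) * f t (Y ω)) μ :=
    fun t => (hI t).integrable_mul (hb t) (hintg t)
  refine ⟨integrable_finsetSum _ fun t _ => hp t, ?_⟩
  rw [integral_finsetSum _ fun t _ => hp t]
  refine Finset.sum_congr rfl fun t _ => ?_
  rw [(hI t).integral_fun_mul_eq_mul_integral (hb t).1 (hintg t).1]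
  congr 1
  rw [← integral_indicator_one (hξ (measurableSet_singleton t))]
  rfl

variable {E : Type*} [MeasurableSpace E] {Z : ℕ → Ω → E} {N k m : ℕ}
  {S : Fin m → Ω → Subsample N k}

theorem sum_pick {M : Type*} [AddCommMonoid M] (z : ℕ → E) (t : Subsample N k) (g : E → M) :
    ∑ i, g (pick z t i) = ∑ i ∈ t.1, g (z i) := by
  conv_rhs => rw [← Finset.map_orderEmbOfFin_univ t.1 t.2]
  rw [Finset.sum_map]
  rfl

theorem measurable_pick (t : Subsample N k) : Measurable fun z : ℕ → E => pick z t :=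
  measurable_pi_lambda _ fun _ => measurable_pi_apply _

/-- Distinct positions of a fixed subset refer to distinct data points, so this is a reindexing of
an independent family along an injection. -/
theorem map_pick {P : Measure E} [IsProbabilityMeasure P] (hZ : ∀ i, Measurable (Z i))
    (hlaw : ∀ i, μ.map (Z i) = P) (hind : iIndepFun Z μ) (t : Subsample N k) :
    μ.map (fun ω => pick (fun i => Z i ω) t) = Measure.pi fun _ : Fin k => P := by
  have hinj : Function.Injective fun i : Fin k => ((t.1.orderEmbOfFin t.2 i : Fin N) : ℕ) :=
    Fin.val_injective.comp (t.1.orderEmbOfFin t.2).injective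
  have h := (iIndepFun_iff_map_fun_eq_pi_map (fun i => (hZ _).aemeasurable)).1
    (hind.precomp hinj)
  simp only [hlaw] at h
  exact h

theorem IsSubsampling.indepFun_data (hS : IsSubsampling μ Z N k m S) (j : Fin m) :
    IndepFun (S j) (fun ω i => Z i ω) μ := by
  have hp : Measurable fun v : Fin m → Subsample N k => v j := by fun_prop
  have h := hS.indep_data.comp (ψ := (id : (ℕ → E) → (ℕ → E))) hp measurable_id
  exact h

theorem IsSubsampling.indepFun_data_pair (hS : IsSubsampling μ Z N k m S) (j j' : Fin m) :
    IndepFun (fun ω => (S j ω, S j' ω)) (fun ω i => Z i ω) μ := by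
  have hp : Measurable fun v : Fin m → Subsample N k => (v j, v j') := by fun_prop
  have h := hS.indep_data.comp (ψ := (id : (ℕ → E) → (ℕ → E))) hp measurable_id
  exact h

/-- The expectation of a statistic of a random subsample. -/
theorem IsSubsampling.lintegral_pick {P : Measure E} [IsProbabilityMeasure P]
    (hS : IsSubsampling μ Z N k m S) (hk : k ≤ N) (hZ : ∀ i, Measurable (Z i))
    (hlaw : ∀ i, μ.map (Z i) = P) (hind : iIndepFun Z μ) {R : (Fin k → E) → ℝ≥0∞}
    (hR : Measurable R) (j : Fin m) :
    ∫⁻ ω, R (pick (fun i => Z i ω) (S j ω)) ∂μ = ∫⁻ z, R z ∂(Measure.pi fun _ => P) := by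
  rw [lintegral_of_indep_finite (f := fun t z => R (pick z t)) (hS.measurable j)
    (measurable_pi_lambda _ hZ) (hS.indepFun_data j) fun t => hR.comp (measurable_pick t)]
  have : ∀ t : Subsample N k, ∫⁻ ω, R (pick (fun i => Z i ω) t) ∂μ =
      ∫⁻ z, R z ∂(Measure.pi fun _ => P) := by
    intro t
    rw [← map_pick hZ hlaw hind t]
    exact (lintegral_map hR ((measurable_pick t).comp (measurable_pi_lambda _ hZ))).symm
  simp only [this, hS.uniform]
  rw [Finset.sum_const, Finset.card_univ, card_subsample, nsmul_eq_mul, ← mul_assoc,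
    ENNReal.mul_inv_cancel (by exact_mod_cast (Nat.choose_pos hk).ne') (by simp), one_mul]

/-- The second moment of the average of a statistic over random subsamples. -/
theorem IsSubsampling.second_moment (hS : IsSubsampling μ Z N k m S)
    (hZ : ∀ i, Measurable (Z i)) {f : Subsample N k → (ℕ → E) → ℝ} (hf : ∀ t, Measurable (f t))
    (hL : ∀ t, MemLp (fun ω => f t fun i => Z i ω) 2 μ) {C D : ℝ}
    (hC : ∀ t, ∫ ω, f t (fun i => Z i ω) ^ 2 ∂μ ≤ C)
    (hD : ∫ ω, ((N.choose k : ℝ)⁻¹ * ∑ t, f t fun i => Z i ω) ^ 2 ∂μ ≤ D) (hm : 0 < m)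
    (hk : k ≤ N) :
    Integrable (fun ω => ((m : ℝ)⁻¹ * ∑ j, f (S j ω) fun i => Z i ω) ^ 2) μ ∧
    ∫ ω, ((m : ℝ)⁻¹ * ∑ j, f (S j ω) fun i => Z i ω) ^ 2 ∂μ ≤ C / m + D := by
  have hY : Measurable fun ω i => Z i ω := measurable_pi_lambda _ hZ
  set p : ℝ := (N.choose k : ℝ)⁻¹ with hp
  have hch : (0 : ℝ) < N.choose k := by exact_mod_cast Nat.choose_pos hk
  have hprob : ∀ j t, μ.real (S j ⁻¹' {t}) = p := by
    intro j t
    rw [Measure.real, hS.uniform, ENNReal.toReal_inv, ENNReal.toReal_natCast]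
  have hD0 : 0 ≤ D := (integral_nonneg fun ω => by positivity).trans hD
  -- For `j ≠ j'` the two subsets are independent and uniform, so the mixed moment is exactly the
  -- second moment of the average over all subsets, hence at most `D`. The `m` diagonal terms, each
  -- at most `C`, produce `C / m`; the extra `D` there only makes the bound uniform.
  have hpair : ∀ j j', Integrable (fun ω => f (S j ω) (fun i => Z i ω) *
      f (S j' ω) (fun i => Z i ω)) μ ∧
      ∫ ω, f (S j ω) (fun i => Z i ω) * f (S j' ω) (fun i => Z i ω) ∂μ ≤
        (if j = j' then C else 0) + D := by
    intro j j'
    have hmul : ∀ t t', Integrable (fun ω => f t (fun i => Z i ω) * f t' (fun i => Z i ω)) μ :=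
      fun t t' => (hL t).integrable_mul (hL t')
    by_cases hj : j = j'
    · subst hj
      obtain ⟨h1, h2⟩ := integral_of_indep_finite (f := fun t z => f t z * f t z)
        (hS.measurable j) (hS.indepFun_data j) (fun t => (hf t).mul (hf t)) (fun t => hmul t t)
      refine ⟨h1, ?_⟩
      rw [h2]
      simp only [hprob, if_true]
      rw [← Finset.mul_sum]
      have h3 : ∑ t : Subsample N k, ∫ ω, f t (fun i => Z i ω) * f t (fun i => Z i ω) ∂μ ≤
          N.choose k * C := by
        rw [← card_subsample, ← Finset.card_univ, ← nsmul_eq_mul]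
        refine Finset.sum_le_card_nsmul _ _ _ fun t _ => ?_
        simpa only [← sq] using hC t
      calc p * _ ≤ p * (N.choose k * C) := by gcongr
        _ = C := by rw [hp]; field_simp
        _ ≤ C + D := by linarith
    · obtain ⟨h1, h2⟩ := integral_of_indep_finite (f := fun t z => f t.1 z * f t.2 z)
        ((hS.measurable j).prodMk (hS.measurable j')) (hS.indepFun_data_pair j j') (fun t => (hf _).mul (hf _))
        (fun t => hmul _ _)
      refine ⟨h1, ?_⟩
      have hpr : ∀ t : Subsample N k × Subsample N k,
          μ.real ((fun ω => (S j ω, S j' ω)) ⁻¹' {t}) = p * p := by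
        intro t
        rw [show p * p = μ.real (S j ⁻¹' {t.1}) * μ.real (S j' ⁻¹' {t.2}) by rw [hprob, hprob]]
        have := (hS.indep.indepFun hj).measure_inter_preimage_eq_mul {t.1} {t.2}
          (MeasurableSet.of_discrete) (MeasurableSet.of_discrete)
        rw [Measure.real, Measure.real, Measure.real, ← ENNReal.toReal_mul, ← this]
        congr 2
        ext ω
        simp [Prod.ext_iff]
      rw [h2]
      simp only [hpr, hj, if_false, zero_add]
      refine le_trans (le_of_eq ?_) hD
      have : ∀ ω, (p * ∑ t, f t fun i => Z i ω) ^ 2 =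
          ∑ t : Subsample N k × Subsample N k,
            p * p * (f t.1 (fun i => Z i ω) * f t.2 (fun i => Z i ω)) := by
        intro ω
        rw [Fintype.sum_prod_type, mul_pow, sq (∑ t, _), Finset.sum_mul_sum, Finset.mul_sum]
        simp only [Finset.mul_sum, sq]
      simp only [this]
      rw [integral_finsetSum _ fun t _ => (hmul _ _).const_mul _]
      simp only [integral_const_mul]
  have hm' : (0 : ℝ) < m := by exact_mod_cast hm
  have hexp : ∀ ω, ((m : ℝ)⁻¹ * ∑ j, f (S j ω) fun i => Z i ω) ^ 2 =
      (m : ℝ)⁻¹ ^ 2 * ∑ j, ∑ j', f (S j ω) (fun i => Z i ω) * f (S j' ω) (fun i => Z i ω) := by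
    intro ω
    rw [mul_pow, sq (∑ j, _), Finset.sum_mul_sum]
  simp only [hexp]
  have hintg : Integrable (fun ω => ∑ j, ∑ j', f (S j ω) (fun i => Z i ω) *
      f (S j' ω) (fun i => Z i ω)) μ :=
    integrable_finsetSum _ fun j _ => integrable_finsetSum _ fun j' _ => (hpair j j').1
  refine ⟨hintg.const_mul _, ?_⟩
  rw [integral_const_mul, integral_finsetSum _ fun j _ =>
    integrable_finsetSum _ fun j' _ => (hpair j j').1]
  have h4 : ∀ j, ∫ ω, ∑ j', f (S j ω) (fun i => Z i ω) * f (S j' ω) (fun i => Z i ω) ∂μ ≤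
      C + m * D := by
    intro j
    rw [integral_finsetSum _ fun j' _ => (hpair j j').1]
    refine (Finset.sum_le_sum fun j' _ => (hpair j j').2).trans ?_
    rw [Finset.sum_add_distrib]
    simp
  calc (m : ℝ)⁻¹ ^ 2 * _ ≤ (m : ℝ)⁻¹ ^ 2 * ∑ _j : Fin m, (C + m * D) := by
        gcongr with j; exact h4 j
    _ = C / m + D := by simp; field_simp

end Random

/-! ### Linear and bilinear statistics of random subsamples -/

section Statistics

variable {Ω : Type*} [MeasurableSpace Ω] {μ : Measure Ω} [IsProbabilityMeasure μ]
  {E : Type*} [MeasurableSpace E] {P : Measure E} [IsProbabilityMeasure P] {Z : ℕ → Ω → E}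
  {N k m : ℕ} {S : Fin m → Ω → Subsample N k}

theorem integral_comp_data (hZ : ∀ i, Measurable (Z i)) (hlaw : ∀ i, μ.map (Z i) = P) (i : ℕ)
    {f : E → ℝ} (hf : Measurable f) : ∫ ω, f (Z i ω) ∂μ = ∫ x, f x ∂P := by
  rw [← hlaw i, integral_map (hZ i).aemeasurable hf.aestronglyMeasurable]

theorem memLp_comp_data (hZ : ∀ i, Measurable (Z i)) (hlaw : ∀ i, μ.map (Z i) = P) (i : ℕ)
    {f : E → ℝ} {q : ℝ≥0∞} (hf : MemLp f q P) : MemLp (fun ω => f (Z i ω)) q μ :=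
  hf.comp_measurePreserving ⟨hZ i, hlaw i⟩

theorem data_moments (hZ : ∀ i, Measurable (Z i)) (hlaw : ∀ i, μ.map (Z i) = P)
    (hind : iIndepFun Z μ) {g : E → ℝ} (hg : Measurable g) (hL : MemLp g 4 P)
    (h0 : ∫ x, g x ∂P = 0) (s : Finset (Fin N)) :
    MemLp (fun ω => ∑ i ∈ s, g (Z i ω)) 4 μ ∧
    ∫ ω, (∑ i ∈ s, g (Z i ω)) ^ 2 ∂μ ≤ s.card * ∫ x, g x ^ 2 ∂P ∧
    ∫ ω, (∑ i ∈ s, g (Z i ω)) ^ 4 ∂μ ≤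
      s.card ^ 2 * (∫ x, g x ^ 4 ∂P + 3 * (∫ x, g x ^ 2 ∂P) ^ 2) := by
  have hi : iIndepFun (fun (i : Fin N) ω => g (Z i ω)) μ :=
    (hind.precomp (g := fun i : Fin N => (i : ℕ)) Fin.val_injective).comp _ fun _ => hg
  obtain ⟨h1, -, h2, h3⟩ := sum_moments hi (fun i => memLp_comp_data hZ hlaw i hL)
    (fun i => (integral_comp_data hZ hlaw i hg).trans h0)
    (fun i => (integral_comp_data hZ hlaw i (hg.pow_const 2)).le)
    (fun i => (integral_comp_data hZ hlaw i (hg.pow_const 4)).le) s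
  refine ⟨h1, h2, h3.trans ?_⟩
  have h4 : (0 : ℝ) ≤ ∫ x, g x ^ 4 ∂P := integral_nonneg fun x => by positivity
  -- For a natural number `n ≤ n²`, so the term linear in the size is absorbed by the quadratic one.
  have h5 : (s.card : ℝ) ≤ (s.card : ℝ) ^ 2 := by exact_mod_cast Nat.le_self_pow two_ne_zero _
  nlinarith

/-- Because `2 x² y² ≤ x⁴ + y⁴`, fourth moments of the two sums control the square of their product,
which has the order of the squared number of terms. -/
theorem data_product_moment (hZ : ∀ i, Measurable (Z i)) (hlaw : ∀ i, μ.map (Z i) = P)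
    (hind : iIndepFun Z μ) {g h : E → ℝ} (hg : Measurable g) (hh : Measurable h)
    (hgL : MemLp g 4 P) (hhL : MemLp h 4 P) (hg0 : ∫ x, g x ∂P = 0) (hh0 : ∫ x, h x ∂P = 0)
    {K : ℝ} (hgK : ∫ x, g x ^ 4 ∂P + 3 * (∫ x, g x ^ 2 ∂P) ^ 2 ≤ K)
    (hhK : ∫ x, h x ^ 4 ∂P + 3 * (∫ x, h x ^ 2 ∂P) ^ 2 ≤ K) (s : Finset (Fin N)) :
    MemLp (fun ω => (∑ i ∈ s, g (Z i ω)) * ∑ i ∈ s, h (Z i ω)) 2 μ ∧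
    ∫ ω, ((∑ i ∈ s, g (Z i ω)) * ∑ i ∈ s, h (Z i ω)) ^ 2 ∂μ ≤ s.card ^ 2 * K := by
  obtain ⟨g1, -, g2⟩ := data_moments hZ hlaw hind hg hgL hg0 s
  obtain ⟨h1, -, h2⟩ := data_moments hZ hlaw hind hh hhL hh0 s
  have gi := integrable_pow_of_memLp (q := 4) g1 le_rfl
  have hi := integrable_pow_of_memLp (q := 4) h1 le_rfl
  have hbd : ∀ ω, ((∑ i ∈ s, g (Z i ω)) * ∑ i ∈ s, h (Z i ω)) ^ 2 ≤
      1 / 2 * ((∑ i ∈ s, g (Z i ω)) ^ 4 + (∑ i ∈ s, h (Z i ω)) ^ 4) := by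
    intro ω
    nlinarith [sq_nonneg ((∑ i ∈ s, g (Z i ω)) ^ 2 - (∑ i ∈ s, h (Z i ω)) ^ 2)]
  have hintg : Integrable (fun ω => ((∑ i ∈ s, g (Z i ω)) * ∑ i ∈ s, h (Z i ω)) ^ 2) μ :=
    ((gi.add hi).const_mul (1 / 2)).mono' ((g1.1.mul h1.1).pow 2) (ae_of_all _ fun ω => by
      rw [Real.norm_of_nonneg (by positivity)]; exact hbd ω)
  refine ⟨(memLp_two_iff_integrable_sq (g1.1.mul h1.1)).2 hintg, ?_⟩
  refine (integral_mono hintg ((gi.add hi).const_mul (1 / 2)) hbd).trans ?_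
  rw [integral_const_mul]
  simp only [Pi.add_apply]
  rw [integral_add gi hi]
  nlinarith [sq_nonneg (s.card : ℝ), mul_le_mul_of_nonneg_left hgK (sq_nonneg (s.card : ℝ)),
    mul_le_mul_of_nonneg_left hhK (sq_nonneg (s.card : ℝ))]

theorem map_data (hZ : ∀ i, Measurable (Z i)) (hlaw : ∀ i, μ.map (Z i) = P)
    (hind : iIndepFun Z μ) (N : ℕ) :
    μ.map (fun ω (i : Fin N) => Z i ω) = Measure.pi fun _ : Fin N => P := by
  have h := (iIndepFun_iff_map_fun_eq_pi_map (fun i => (hZ _).aemeasurable)).1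
    (hind.precomp (g := fun i : Fin N => (i : ℕ)) Fin.val_injective)
  simp only [hlaw] at h
  exact h

/-- The variance of a sum over the data. -/
theorem data_variance (hZ : ∀ i, Measurable (Z i)) (hlaw : ∀ i, μ.map (Z i) = P)
    (hind : iIndepFun Z μ) {g : E → ℝ} (hL : MemLp g 2 P) (N : ℕ) :
    Integrable (fun ω => (∑ i : Fin N, (g (Z i ω) - ∫ x, g x ∂P)) ^ 2) μ ∧
    ∫ ω, (∑ i : Fin N, (g (Z i ω) - ∫ x, g x ∂P)) ^ 2 ∂μ ≤ N * ∫ x, g x ^ 2 ∂P := by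
  obtain ⟨h1, h2⟩ := sample_variance hL N
  have hm : AEMeasurable (fun ω (i : Fin N) => Z i ω) μ :=
    (measurable_pi_lambda _ fun i : Fin N => hZ i).aemeasurable
  rw [← map_data hZ hlaw hind N] at h1 h2
  have h3 := integrable_pow_of_memLp (q := 2) h2 le_rfl
  refine ⟨h3.comp_aemeasurable hm, ?_⟩
  rw [integral_map hm h3.1] at h1
  exact h1

/-- The average of a linear statistic over random subsamples. -/
theorem IsSubsampling.linear_moment (hS : IsSubsampling μ Z N k m S) (hk : k ≤ N) (hk0 : 0 < k)
    (hm : 0 < m) (hZ : ∀ i, Measurable (Z i)) (hlaw : ∀ i, μ.map (Z i) = P)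
    (hind : iIndepFun Z μ) {g : E → ℝ} (hg : Measurable g) (hL : MemLp g 4 P)
    (h0 : ∫ x, g x ∂P = 0) :
    Integrable (fun ω => ((m : ℝ)⁻¹ * ∑ j, (√k)⁻¹ * ∑ i ∈ (S j ω).1, g (Z i ω)) ^ 2) μ ∧
    ∫ ω, ((m : ℝ)⁻¹ * ∑ j, (√k)⁻¹ * ∑ i ∈ (S j ω).1, g (Z i ω)) ^ 2 ∂μ ≤
      (∫ x, g x ^ 2 ∂P) / m + (∫ x, g x ^ 2 ∂P) * (k / N) := by
  set σ := ∫ x, g x ^ 2 ∂P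
  have hk' : (0 : ℝ) < k := by exact_mod_cast hk0
  have hN' : (0 : ℝ) < N := by exact_mod_cast hk0.trans_le hk
  refine hS.second_moment hZ (f := fun t z => (√k)⁻¹ * ∑ i ∈ t.1, g (z i)) ?_ ?_ ?_ ?_ hm hk
  · intro t
    exact (Finset.measurable_fun_sum _ fun i _ => hg.comp (measurable_pi_apply _)).const_mul _
  · intro t
    exact ((data_moments hZ hlaw hind hg hL h0 t.1).1.mono_exponent (by norm_num)).const_mul _
  · intro t
    have h := (data_moments hZ hlaw hind hg hL h0 t.1).2.1
    rw [t.2] at h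
    simp only [mul_pow, integral_const_mul, inv_pow, Real.sq_sqrt hk'.le]
    rw [inv_mul_le_iff₀ hk']
    exact h
  · have h := (data_moments hZ hlaw hind hg hL h0 (Finset.univ : Finset (Fin N))).2.1
    rw [Finset.card_univ, Fintype.card_fin] at h
    -- The average over all subsets is a multiple of the full sum, whose second moment is at most `N
    -- σ`; the factors combine to `σ k / N`.
    have : ∀ ω, (N.choose k : ℝ)⁻¹ * ∑ t : Subsample N k, (√k)⁻¹ * ∑ i ∈ t.1, g (Z i ω) =
        (√k)⁻¹ * (k / N) * ∑ i : Fin N, g (Z i ω) := by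
      intro ω
      rw [← Finset.mul_sum, mul_left_comm, average_linear hk hk0 fun i => g (Z i ω), mul_assoc]
    simp only [this, mul_pow, integral_const_mul, inv_pow, Real.sq_sqrt hk'.le]
    calc (k : ℝ)⁻¹ * (k / N) ^ 2 * _ ≤ (k : ℝ)⁻¹ * (k / N) ^ 2 * (N * σ) := by gcongr
      _ = σ * (k / N) := by field_simp

/-- The average of a bilinear statistic over random subsamples. -/
theorem IsSubsampling.bilinear_moment (hS : IsSubsampling μ Z N k m S) (hk : k ≤ N)
    (hk0 : 1 < k) (hm : 0 < m) (hZ : ∀ i, Measurable (Z i)) (hlaw : ∀ i, μ.map (Z i) = P)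
    (hind : iIndepFun Z μ) {g h : E → ℝ} (hg : Measurable g) (hh : Measurable h)
    (hgL : MemLp g 4 P) (hhL : MemLp h 4 P) (hg0 : ∫ x, g x ∂P = 0) (hh0 : ∫ x, h x ∂P = 0)
    {K : ℝ} (hgK : ∫ x, g x ^ 4 ∂P + 3 * (∫ x, g x ^ 2 ∂P) ^ 2 ≤ K)
    (hhK : ∫ x, h x ^ 4 ∂P + 3 * (∫ x, h x ^ 2 ∂P) ^ 2 ≤ K) :
    Integrable (fun ω => ((m : ℝ)⁻¹ * ∑ j, ((k : ℝ)⁻¹ * ((∑ i ∈ (S j ω).1, g (Z i ω)) *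
      ∑ i ∈ (S j ω).1, h (Z i ω)) - ∫ x, g x * h x ∂P)) ^ 2) μ ∧
    ∫ ω, ((m : ℝ)⁻¹ * ∑ j, ((k : ℝ)⁻¹ * ((∑ i ∈ (S j ω).1, g (Z i ω)) *
      ∑ i ∈ (S j ω).1, h (Z i ω)) - ∫ x, g x * h x ∂P)) ^ 2 ∂μ ≤
      (2 * K + 2 * (∫ x, g x * h x ∂P) ^ 2) / m + 6 * K * (1 / N + (k / N) ^ 2) := by
  set c := ∫ x, g x * h x ∂P
  have hk' : (0 : ℝ) < k := by exact_mod_cast (by omega : 0 < k)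
  have hN' : (0 : ℝ) < N := by exact_mod_cast (by omega : 0 < N)
  have hghi : Integrable (fun x => (g x * h x) ^ 2) P := by
    refine ((integrable_pow_of_memLp (q := 4) hgL le_rfl).add
      (integrable_pow_of_memLp (q := 4) hhL le_rfl)).mono' ((hgL.1.mul hhL.1).pow 2)
      (ae_of_all _ fun x => ?_)
    rw [Real.norm_of_nonneg (by positivity)]
    simp only [Pi.add_apply]
    nlinarith [sq_nonneg (g x ^ 2 - h x ^ 2), sq_nonneg (g x ^ 2), sq_nonneg (h x ^ 2)]
  have hghL : MemLp (fun x => g x * h x) 2 P :=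
    (memLp_two_iff_integrable_sq (hgL.1.mul hhL.1)).2 hghi
  have hghK : ∫ x, (g x * h x) ^ 2 ∂P ≤ K := by
    have gi := integrable_pow_of_memLp (q := 4) hgL le_rfl
    have hi := integrable_pow_of_memLp (q := 4) hhL le_rfl
    have h1 : ∫ x, (g x * h x) ^ 2 ∂P ≤ ∫ x, 1 / 2 * (g x ^ 4 + h x ^ 4) ∂P := by
      refine integral_mono hghi ((gi.add hi).const_mul (1 / 2)) fun x => ?_
      simp only
      nlinarith [sq_nonneg (g x ^ 2 - h x ^ 2)]
    rw [integral_const_mul, integral_add gi hi] at h1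
    nlinarith [sq_nonneg (∫ x, g x ^ 2 ∂P), sq_nonneg (∫ x, h x ^ 2 ∂P)]
  have hK0 : 0 ≤ K := (integral_nonneg fun x => by positivity).trans hghK
  have hprod := fun s : Finset (Fin N) =>
    data_product_moment hZ hlaw hind hg hh hgL hhL hg0 hh0 hgK hhK s
  refine hS.second_moment hZ (f := fun t z => (k : ℝ)⁻¹ * ((∑ i ∈ t.1, g (z i)) *
      ∑ i ∈ t.1, h (z i)) - c) ?_ ?_ ?_ ?_ hm hk
  · intro t
    exact (((Finset.measurable_fun_sum _ fun i _ => hg.comp (measurable_pi_apply _)).mul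
      (Finset.measurable_fun_sum _ fun i _ => hh.comp (measurable_pi_apply _))).const_mul _).sub
      measurable_const
  · intro t
    exact ((hprod t.1).1.const_mul _).sub (memLp_const _)
  · intro t
    obtain ⟨h1, h2⟩ := hprod t.1
    rw [t.2] at h2
    have h3 := integrable_pow_of_memLp (q := 2) h1 le_rfl
    have h4 : ∫ ω, ((k : ℝ)⁻¹ * ((∑ i ∈ t.1, g (Z i ω)) * ∑ i ∈ t.1, h (Z i ω)) - c) ^ 2 ∂μ ≤
        ∫ ω, (2 * (k : ℝ)⁻¹ ^ 2 * ((∑ i ∈ t.1, g (Z i ω)) * ∑ i ∈ t.1, h (Z i ω)) ^ 2 +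
          2 * c ^ 2) ∂μ := by
      refine integral_mono (integrable_pow_of_memLp (q := 2)
        ((h1.const_mul _).sub (memLp_const _)) le_rfl)
        ((h3.const_mul _).add (integrable_const _)) fun ω => ?_
      simp only
      nlinarith [sq_nonneg ((k : ℝ)⁻¹ * ((∑ i ∈ t.1, g (Z i ω)) * ∑ i ∈ t.1, h (Z i ω)) + c)]
    refine h4.trans ?_
    rw [integral_add (h3.const_mul _) (integrable_const _), integral_const_mul]
    simp only [integral_const, probReal_univ, one_smul]
    refine add_le_add ?_ le_rfl
    calc 2 * (k : ℝ)⁻¹ ^ 2 * _ ≤ 2 * (k : ℝ)⁻¹ ^ 2 * (k ^ 2 * K) := by gcongr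
      _ = 2 * K := by field_simp
  -- After division by `k`, a diagonal pair has weight `1 / N` in the complete average and an
  -- off-diagonal pair has weight `β`. Adding and subtracting the diagonal leaves a centred mean,
  -- `β` times the product of the full sums, and `β` times the diagonal sum.
  · set β : ℝ := (k - 1) / (N * (N - 1)) with hβ
    have hN1 : (0 : ℝ) < N - 1 := by
      have : (1 : ℝ) < N := by exact_mod_cast (by omega : 1 < N)
      linarith
    have hk1 : (0 : ℝ) < k - 1 := by
      have : (1 : ℝ) < k := by exact_mod_cast hk0
      linarith
    have hβN : β * N ≤ k / N := by
      have hkN : (k : ℝ) ≤ N := by exact_mod_cast hk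
      rw [hβ, show ((k : ℝ) - 1) / (N * (N - 1)) * N = (k - 1) / (N - 1) by field_simp,
        div_le_div_iff₀ hN1 hN']
      nlinarith
    have hβ2 : β ^ 2 * N ^ 2 ≤ (k / N) ^ 2 := by
      rw [← mul_pow]
      exact pow_le_pow_left₀ (by positivity) hβN 2
    have havg : ∀ ω, (N.choose k : ℝ)⁻¹ * ∑ t : Subsample N k, ((k : ℝ)⁻¹ *
        ((∑ i ∈ t.1, g (Z i ω)) * ∑ i ∈ t.1, h (Z i ω)) - c) =
        (N : ℝ)⁻¹ * ∑ i : Fin N, (g (Z i ω) * h (Z i ω) - c) +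
          (β * ((∑ i : Fin N, g (Z i ω)) * ∑ i : Fin N, h (Z i ω)) -
            β * ∑ i : Fin N, g (Z i ω) * h (Z i ω)) := by
      intro ω
      have hb := average_bilinear hk hk0 fun i l => g (Z i ω) * h (Z l ω)
      simp only [← Finset.sum_mul_sum] at hb
      have hch : (N.choose k : ℝ) ≠ 0 := by exact_mod_cast (Nat.choose_pos hk).ne'
      rw [Finset.sum_sub_distrib, ← Finset.mul_sum, mul_sub, mul_left_comm, hb]
      simp only [Finset.sum_const, Finset.card_univ, card_subsample, nsmul_eq_mul,
        Finset.sum_sub_distrib, Fintype.card_fin, hβ]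
      field_simp
      ring
    obtain ⟨v1, v2⟩ := data_variance hZ hlaw hind hghL N
    obtain ⟨p1, p2⟩ := hprod Finset.univ
    rw [Finset.card_univ, Fintype.card_fin] at p2
    have p3 := integrable_pow_of_memLp (q := 2) p1 le_rfl
    have hsq : ∀ i : Fin N, Integrable (fun ω => (g (Z i ω) * h (Z i ω)) ^ 2) μ := fun i =>
      integrable_pow_of_memLp (q := 2) (memLp_comp_data hZ hlaw i hghL) le_rfl
    have hsqi : ∀ i : Fin N, ∫ ω, (g (Z i ω) * h (Z i ω)) ^ 2 ∂μ = ∫ x, (g x * h x) ^ 2 ∂P :=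
      fun i => integral_comp_data hZ hlaw i (f := fun x => (g x * h x) ^ 2)
        ((hg.mul hh).pow_const 2)
    have q3 : Integrable (fun ω => (N : ℝ) * ∑ i : Fin N, (g (Z i ω) * h (Z i ω)) ^ 2) μ :=
      (integrable_finsetSum _ fun i _ => hsq i).const_mul _
    have q2 : ∫ ω, (N : ℝ) * ∑ i : Fin N, (g (Z i ω) * h (Z i ω)) ^ 2 ∂μ ≤ N ^ 2 * K := by
      rw [integral_const_mul, integral_finsetSum _ fun i _ => hsq i]
      simp only [hsqi, Finset.sum_const, Finset.card_univ, Fintype.card_fin, nsmul_eq_mul]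
      rw [sq, mul_assoc]
      gcongr
    -- The square of three terms is at most three times the sum of squares, with Cauchy–Schwarz for
    -- the diagonal sum. The first term yields the order `1 / N`; the other two yield `β² N²`, at
    -- most `(k / N)²`.
    have hle : ∀ ω, ((N : ℝ)⁻¹ * ∑ i : Fin N, (g (Z i ω) * h (Z i ω) - c) +
          (β * ((∑ i : Fin N, g (Z i ω)) * ∑ i : Fin N, h (Z i ω)) -
            β * ∑ i : Fin N, g (Z i ω) * h (Z i ω))) ^ 2 ≤
        3 * (N : ℝ)⁻¹ ^ 2 * (∑ i : Fin N, (g (Z i ω) * h (Z i ω) - c)) ^ 2 +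
        3 * β ^ 2 * ((∑ i : Fin N, g (Z i ω)) * ∑ i : Fin N, h (Z i ω)) ^ 2 +
        3 * β ^ 2 * (N * ∑ i : Fin N, (g (Z i ω) * h (Z i ω)) ^ 2) := by
      intro ω
      have h1 := sq_sum_le_card_mul_sum_sq (s := (Finset.univ : Finset (Fin N)))
        (f := fun i => g (Z i ω) * h (Z i ω))
      rw [Finset.card_univ, Fintype.card_fin] at h1
      have h2 := mul_le_mul_of_nonneg_left h1 (by positivity : 0 ≤ 3 * β ^ 2)
      refine le_trans ?_ (add_le_add_right h2 _)
      generalize (∑ i : Fin N, (g (Z i ω) * h (Z i ω) - c)) = A1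
      generalize (∑ i : Fin N, g (Z i ω)) * ∑ i : Fin N, h (Z i ω) = A2
      generalize (∑ i : Fin N, g (Z i ω) * h (Z i ω)) = A3
      nlinarith [sq_nonneg ((N : ℝ)⁻¹ * A1 - β * A2), sq_nonneg ((N : ℝ)⁻¹ * A1 + β * A3),
        sq_nonneg (β * A2 + β * A3)]
    simp only [havg]
    have hI := ((v1.const_mul (3 * (N : ℝ)⁻¹ ^ 2)).add (p3.const_mul (3 * β ^ 2)))
    have hI' := hI.add (q3.const_mul (3 * β ^ 2))
    refine (integral_mono_of_nonneg (ae_of_all _ fun ω => by positivity) hI'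
      (ae_of_all _ hle)).trans ?_
    have e1 : ∫ ω, (3 * (N : ℝ)⁻¹ ^ 2 * (∑ i : Fin N, (g (Z i ω) * h (Z i ω) - c)) ^ 2 +
        3 * β ^ 2 * ((∑ i : Fin N, g (Z i ω)) * ∑ i : Fin N, h (Z i ω)) ^ 2 +
        3 * β ^ 2 * (N * ∑ i : Fin N, (g (Z i ω) * h (Z i ω)) ^ 2)) ∂μ =
        3 * (N : ℝ)⁻¹ ^ 2 * ∫ ω, (∑ i : Fin N, (g (Z i ω) * h (Z i ω) - c)) ^ 2 ∂μ +
        3 * β ^ 2 * ∫ ω, ((∑ i : Fin N, g (Z i ω)) * ∑ i : Fin N, h (Z i ω)) ^ 2 ∂μ +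
        3 * β ^ 2 * ∫ ω, N * ∑ i : Fin N, (g (Z i ω) * h (Z i ω)) ^ 2 ∂μ := by
      refine (integral_add hI (q3.const_mul _)).trans ?_
      rw [integral_const_mul]
      congr 1
      exact (integral_add (v1.const_mul _) (p3.const_mul _)).trans
        (congrArg₂ (· + ·) (integral_const_mul _ _) (integral_const_mul _ _))
    refine (le_of_eq e1).trans ?_
    have b1 : 3 * (N : ℝ)⁻¹ ^ 2 * ∫ ω, (∑ i : Fin N, (g (Z i ω) * h (Z i ω) - c)) ^ 2 ∂μ ≤
        3 * (N : ℝ)⁻¹ ^ 2 * (N * K) := by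
      refine mul_le_mul_of_nonneg_left (v2.trans ?_) (by positivity)
      exact mul_le_mul_of_nonneg_left hghK hN'.le
    have b2 := mul_le_mul_of_nonneg_left p2 (by positivity : 0 ≤ 3 * β ^ 2)
    have b3 := mul_le_mul_of_nonneg_left q2 (by positivity : 0 ≤ 3 * β ^ 2)
    have b4 : 3 * (N : ℝ)⁻¹ ^ 2 * (N * K) = 3 * K * (1 / N) := by field_simp
    have b5 : 0 ≤ K * (1 / (N : ℝ)) := by positivity
    nlinarith [mul_le_mul_of_nonneg_right hβ2 hK0]

end Statistics

/-! ### Asymptotically linear estimators -/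

section AsympLinear

variable {E : Type*} [MeasurableSpace E] {d : ℕ}

/-- The estimator `T` of `θ₀` is asymptotically linear in mean square, with influence function
`φ`. Since `T` need not be measurable, the error is bounded by a measurable function. -/
def AsympLinear (P : Measure E) (φ : E → Vec d) (θ₀ : Vec d)
    (T : (k : ℕ) → (Fin k → E) → Vec d) : Prop :=
  ∀ δ : ℝ, 0 < δ → ∀ᶠ k : ℕ in atTop, ∃ R : (Fin k → E) → ℝ≥0∞, Measurable R ∧
    (∀ z, ENNReal.ofReal (k * ‖T k z - θ₀ - (k : ℝ)⁻¹ • ∑ i, φ (z i)‖ ^ 2) ≤ R z) ∧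
    ∫⁻ z, R z ∂(Measure.pi fun _ : Fin k => P) ≤ ENNReal.ofReal δ

theorem norm_sq_le_sum {d : ℕ} (v : Vec d) : ‖v‖ ^ 4 ≤ d * ∑ a, v a ^ 4 := by
  have h := EuclideanSpace.real_norm_sq_eq v
  have h1 : ‖v‖ ^ 4 = (∑ a, v a ^ 2) ^ 2 := by rw [← h]; ring
  rw [h1]
  have h2 := sq_sum_le_card_mul_sum_sq (s := (Finset.univ : Finset (Fin d))) (f := fun a => v a ^ 2)
  simpa [← pow_mul] using h2

variable {P : Measure E} [IsProbabilityMeasure P]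

/-- Moments of the mean of a centered random vector. -/
theorem mean_moments {φ : E → Vec d} (hL : ∀ a, MemLp (fun x => φ x a) 4 P)
    (h0 : ∀ a, ∫ x, φ x a ∂P = 0) :
    ∃ C : ℝ, 0 ≤ C ∧ ∀ k : ℕ, 0 < k →
      Integrable (fun z : Fin k → E => ‖(k : ℝ)⁻¹ • ∑ i, φ (z i)‖ ^ 2)
        (Measure.pi fun _ : Fin k => P) ∧
      Integrable (fun z : Fin k → E => ‖(k : ℝ)⁻¹ • ∑ i, φ (z i)‖ ^ 4)
        (Measure.pi fun _ : Fin k => P) ∧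
      k * ∫ z : Fin k → E, ‖(k : ℝ)⁻¹ • ∑ i, φ (z i)‖ ^ 2 ∂(Measure.pi fun _ : Fin k => P) ≤ C ∧
      k ^ 2 * ∫ z : Fin k → E, ‖(k : ℝ)⁻¹ • ∑ i, φ (z i)‖ ^ 4 ∂(Measure.pi fun _ : Fin k => P)
        ≤ C := by
  set τ : Fin d → ℝ := fun a => ∫ x, φ x a ^ 4 ∂P
  set σ : Fin d → ℝ := fun a => ∫ x, φ x a ^ 2 ∂P
  have hτ : ∀ a, 0 ≤ τ a := fun a => integral_nonneg fun x => by positivity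
  have hσ : ∀ a, 0 ≤ σ a := fun a => integral_nonneg fun x => by positivity
  refine ⟨∑ a, σ a + d * ∑ a, (τ a + 3 * σ a ^ 2), add_nonneg (Finset.sum_nonneg fun a _ => hσ a)
    (mul_nonneg (by positivity) (Finset.sum_nonneg fun a _ => add_nonneg (hτ a) (by positivity))),
    fun k hk => ?_⟩
  have hk' : (1 : ℝ) ≤ k := by exact_mod_cast hk
  have hm := fun a => sample_moments (hL a) (h0 a) k
  have hcoord : ∀ (z : Fin k → E) a, ((k : ℝ)⁻¹ • ∑ i, φ (z i)) a = (k : ℝ)⁻¹ * ∑ i, φ (z i) a := by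
    intro z a; simp
  have i2 : ∀ a, Integrable (fun z : Fin k → E => ((k : ℝ)⁻¹ • ∑ i, φ (z i)) a ^ 2)
      (Measure.pi fun _ : Fin k => P) := fun a => by
    simp only [hcoord, mul_pow]
    exact (integrable_pow_of_memLp (q := 4) (hm a).1 (by norm_num)).const_mul _
  have i4 : ∀ a, Integrable (fun z : Fin k → E => ((k : ℝ)⁻¹ • ∑ i, φ (z i)) a ^ 4)
      (Measure.pi fun _ : Fin k => P) := fun a => by
    simp only [hcoord, mul_pow]
    exact (integrable_pow_of_memLp (q := 4) (hm a).1 le_rfl).const_mul _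
  have j2 : Integrable (fun z : Fin k → E => ‖(k : ℝ)⁻¹ • ∑ i, φ (z i)‖ ^ 2)
      (Measure.pi fun _ : Fin k => P) := by
    simp only [EuclideanSpace.real_norm_sq_eq]
    exact integrable_finsetSum _ fun a _ => i2 a
  have j4 : Integrable (fun z : Fin k → E => ‖(k : ℝ)⁻¹ • ∑ i, φ (z i)‖ ^ 4)
      (Measure.pi fun _ : Fin k => P) := by
    refine ((integrable_finsetSum Finset.univ fun a _ => i4 a).const_mul (d : ℝ)).mono' ?_
      (ae_of_all _ fun z => ?_)
    · have : (fun z : Fin k → E => ‖(k : ℝ)⁻¹ • ∑ i, φ (z i)‖ ^ 4) =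
          fun z : Fin k → E => (‖(k : ℝ)⁻¹ • ∑ i, φ (z i)‖ ^ 2) ^ 2 := by ext z; ring
      rw [this]
      exact j2.1.pow 2
    · rw [Real.norm_of_nonneg (by positivity)]
      exact norm_sq_le_sum _
  refine ⟨j2, j4, ?_, ?_⟩
  · simp only [EuclideanSpace.real_norm_sq_eq]
    rw [integral_finsetSum _ fun a _ => i2 a, Finset.mul_sum]
    refine le_trans (Finset.sum_le_sum (g := σ) fun a _ => ?_) (le_add_of_nonneg_right
      (mul_nonneg (by positivity) (Finset.sum_nonneg fun a _ => add_nonneg (hτ a) (by positivity))))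
    simp only [hcoord, mul_pow, integral_const_mul]
    calc (k : ℝ) * ((k : ℝ)⁻¹ ^ 2 * _) ≤ (k : ℝ) * ((k : ℝ)⁻¹ ^ 2 * (k * σ a)) := by
          gcongr; exact (hm a).2.1
      _ = σ a := by field_simp
  · have h1 : ∫ z : Fin k → E, ‖(k : ℝ)⁻¹ • ∑ i, φ (z i)‖ ^ 4 ∂(Measure.pi fun _ : Fin k => P) ≤
        d * ∑ a, ∫ z : Fin k → E, ((k : ℝ)⁻¹ • ∑ i, φ (z i)) a ^ 4
          ∂(Measure.pi fun _ : Fin k => P) := by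
      rw [← integral_finsetSum _ fun a _ => i4 a, ← integral_const_mul]
      exact integral_mono j4 ((integrable_finsetSum _ fun a _ => i4 a).const_mul _)
        fun z => norm_sq_le_sum _
    refine le_trans (mul_le_mul_of_nonneg_left h1 (by positivity)) ?_
    rw [mul_left_comm, Finset.mul_sum]
    refine le_trans ?_ (le_add_of_nonneg_left (Finset.sum_nonneg fun a _ => hσ a))
    refine mul_le_mul_of_nonneg_left (Finset.sum_le_sum fun a _ => ?_) (by positivity)
    simp only [hcoord, mul_pow, integral_const_mul]
    have h2 : (k : ℝ) * τ a + 3 * k ^ 2 * σ a ^ 2 ≤ k ^ 2 * (τ a + 3 * σ a ^ 2) := by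
      have := mul_le_mul_of_nonneg_right hk' (mul_nonneg (by positivity : (0 : ℝ) ≤ k) (hτ a))
      nlinarith
    calc (k : ℝ) ^ 2 * ((k : ℝ)⁻¹ ^ 4 * _)
        ≤ (k : ℝ) ^ 2 * ((k : ℝ)⁻¹ ^ 4 * (k ^ 2 * (τ a + 3 * σ a ^ 2))) := by
          gcongr; exact (hm a).2.2.trans h2
      _ = τ a + 3 * σ a ^ 2 := by field_simp

/-- A bounded estimator is asymptotically linear if its linearization error is small off a rare
event. -/
theorem asympLinear_of_bound {φ : E → Vec d} (hφ : Measurable φ)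
    (hL : ∀ a, MemLp (fun x => φ x a) 4 P) (h0 : ∀ a, ∫ x, φ x a ∂P = 0) {θ₀ : Vec d}
    {T : (k : ℕ) → (Fin k → E) → Vec d} {b : ℝ} (hb : ∀ᶠ k in atTop, ∀ z, ‖T k z - θ₀‖ ≤ b)
    (h : ∀ c > 0, ∃ A : (k : ℕ) → Set (Fin k → E), Negligible P A ∧ ∃ C : ℝ,
      ∀ᶠ k in atTop, ∀ᵐ z ∂(Measure.pi fun _ : Fin k => P), z ∉ A k →
        ‖T k z - θ₀ - (k : ℝ)⁻¹ • ∑ i, φ (z i)‖ ≤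
          c * ‖(k : ℝ)⁻¹ • ∑ i, φ (z i)‖ + C / k) :
    AsympLinear P φ θ₀ T := by
  intro δ hδ
  obtain ⟨M, hM0, hM⟩ := mean_moments hL h0
  -- The budget is `δ / 4` for the multiple of the linear term, `δ / 4` for the terms of order `1 /
  -- k`, and `δ / 4` for the rare event.
  obtain ⟨c, hc0, hc⟩ : ∃ c > 0, 2 * c ^ 2 * M ≤ δ / 4 := by
    refine ⟨√(δ / (8 * (M + 1))), by positivity, ?_⟩
    rw [Real.sq_sqrt (by positivity)]
    rw [show 2 * (δ / (8 * (M + 1))) * M = δ / 4 * (M / (M + 1)) by field_simp; ring]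
    exact mul_le_of_le_one_right (by positivity) ((div_le_one (by positivity)).2 (by linarith))
  obtain ⟨A, hA, C, hAC⟩ := h c hc0
  have l1 : Tendsto (fun k : ℕ => 2 * C ^ 2 * (k : ℝ)⁻¹ + 2 * M * (k : ℝ)⁻¹) atTop (𝓝 0) := by
    simpa using (tendsto_inv_atTop_nhds_zero_nat (𝕜 := ℝ)).const_mul (2 * C ^ 2) |>.add
      ((tendsto_inv_atTop_nhds_zero_nat (𝕜 := ℝ)).const_mul (2 * M))
  have l2 := ENNReal.Tendsto.const_mul (a := ENNReal.ofReal (2 * b ^ 2 + 2)) hA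
    (Or.inr ENNReal.ofReal_ne_top)
  rw [mul_zero] at l2
  filter_upwards [hb, hAC, eventually_gt_atTop 0, l1.eventually (gt_mem_nhds (by positivity : (0:ℝ) < δ / 4)),
    ENNReal.tendsto_nhds_zero.1 l2 (ENNReal.ofReal (δ / 4)) (by simpa using hδ)]
    with k hbk hAk hk0 hk1 hk2
  have hk' : (0 : ℝ) < k := by exact_mod_cast hk0
  obtain ⟨i2, i4, m2, m4⟩ := hM k hk0
  set ν := Measure.pi fun _ : Fin k => P
  set φb : (Fin k → E) → Vec d := fun z => (k : ℝ)⁻¹ • ∑ i, φ (z i) with hφb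
  have hφs : Measurable fun z : Fin k → E => ∑ i, φ (z i) :=
    Finset.measurable_fun_sum _ fun i _ => hφ.comp (measurable_pi_apply i)
  have hφbm : Measurable φb := hφs.const_smul (k : ℝ)⁻¹
  set B : Set (Fin k → E) := {z | ¬ (z ∉ A k → ‖T k z - θ₀ - φb z‖ ≤ c * ‖φb z‖ + C / k)}
  have hB : ν B = 0 := hAk
  -- Measurable hulls of the rare event and of the null exceptional set make the majorant
  -- measurable. On the second it may take the value `∞`.
  set U := toMeasurable ν (A k)
  set W := toMeasurable ν B
  -- The first two terms bound the error off the rare event. On it the squared error is at most `2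
  -- b² + 2 ‖φb‖²`, and replacing `2 ‖φb‖²` by `2 + 2 ‖φb‖⁴` leaves a constant, charged to the
  -- probability of the event, and a fourth moment of order `k⁻²`. The last term of `u` is that
  -- fourth power.
  set u : (Fin k → E) → ℝ := fun z =>
    2 * c ^ 2 * (k * ‖φb z‖ ^ 2) + 2 * C ^ 2 * (k : ℝ)⁻¹ + 2 * (k * ‖φb z‖ ^ 4)
  have hu0 : ∀ z, 0 ≤ u z := fun z => by positivity
  have hum : Measurable fun z => ENNReal.ofReal (u z) := by fun_prop
  refine ⟨fun z => ENNReal.ofReal (u z) +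
    (U.indicator (fun _ => ENNReal.ofReal (2 * b ^ 2 + 2) * k) z + W.indicator (fun _ => ∞) z),
    ?_, ?_, ?_⟩
  · refine hum.add ((measurable_const.indicator
      (measurableSet_toMeasurable _ _)).add (measurable_const.indicator
      (measurableSet_toMeasurable _ _)))
  · intro z
    beta_reduce
    by_cases hzW : z ∈ W
    · simp [hzW]
    by_cases hzU : z ∈ U
    · rw [Set.indicator_of_mem hzU, Set.indicator_of_notMem hzW, add_zero,
        ← ENNReal.ofReal_natCast k, ← ENNReal.ofReal_mul (by positivity),
        ← ENNReal.ofReal_add (hu0 z) (by positivity)]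
      refine ENNReal.ofReal_le_ofReal ?_
      have h1 : ‖T k z - θ₀ - φb z‖ ≤ b + ‖φb z‖ := (norm_sub_le _ _).trans (by gcongr; exact hbk z)
      have h2 : ‖T k z - θ₀ - φb z‖ ^ 2 ≤ 2 * b ^ 2 + 2 * ‖φb z‖ ^ 2 := by
        have := pow_le_pow_left₀ (norm_nonneg _) h1 2
        nlinarith [sq_nonneg (b - ‖φb z‖)]
      have h3 : ‖T k z - θ₀ - φb z‖ ^ 2 ≤ (2 * b ^ 2 + 2) + 2 * ‖φb z‖ ^ 4 := by
        nlinarith [sq_nonneg (‖φb z‖ ^ 2 - 1), sq_nonneg (‖φb z‖ ^ 2)]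
      have h4 := mul_le_mul_of_nonneg_left h3 hk'.le
      have h5 : 0 ≤ 2 * c ^ 2 * (k * ‖φb z‖ ^ 2) + 2 * C ^ 2 * (k : ℝ)⁻¹ := by positivity
      simp only [u]
      linarith
    · have hzA : z ∉ A k := fun h => hzU (subset_toMeasurable _ _ h)
      have hzB : z ∉ B := fun h => hzW (subset_toMeasurable _ _ h)
      have h1 : ‖T k z - θ₀ - φb z‖ ≤ c * ‖φb z‖ + C / k := by
        simp only [B, Set.mem_ofPred_eq, not_not] at hzB
        exact hzB hzA
      refine le_trans (ENNReal.ofReal_le_ofReal ?_) le_self_add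
      have h2 : ‖T k z - θ₀ - φb z‖ ^ 2 ≤ 2 * c ^ 2 * ‖φb z‖ ^ 2 + 2 * C ^ 2 / k ^ 2 := by
        have := pow_le_pow_left₀ (norm_nonneg _) h1 2
        have e : 2 * C ^ 2 / (k : ℝ) ^ 2 = 2 * (C / k) ^ 2 := by ring
        rw [e]
        nlinarith [sq_nonneg (c * ‖φb z‖ - C / k)]
      calc (k : ℝ) * ‖T k z - θ₀ - φb z‖ ^ 2
          ≤ k * (2 * c ^ 2 * ‖φb z‖ ^ 2 + 2 * C ^ 2 / k ^ 2) := by gcongr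
        _ = 2 * c ^ 2 * (k * ‖φb z‖ ^ 2) + 2 * C ^ 2 * (k : ℝ)⁻¹ := by field_simp
        _ ≤ u z := by
          simp only [u]
          have : 0 ≤ 2 * (k * ‖φb z‖ ^ 4) := by positivity
          linarith
  · have hui : Integrable u ν :=
      (((i2.const_mul _).const_mul _).add (integrable_const _)).add ((i4.const_mul _).const_mul _)
    beta_reduce
    rw [lintegral_add_left hum,
      lintegral_add_left (measurable_const.indicator (measurableSet_toMeasurable _ _)),
      lintegral_indicator_const (measurableSet_toMeasurable _ _),
      lintegral_indicator_const (measurableSet_toMeasurable _ _), measure_toMeasurable,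
      measure_toMeasurable, hB, mul_zero, add_zero,
      ← ofReal_integral_eq_lintegral_ofReal hui (ae_of_all _ hu0)]
    have e1 : ∫ z, u z ∂ν ≤ δ / 2 := by
      have e2 : ∫ z, u z ∂ν = 2 * c ^ 2 * (k * ∫ z, ‖φb z‖ ^ 2 ∂ν) + 2 * C ^ 2 * (k : ℝ)⁻¹ +
          2 * (k * ∫ z, ‖φb z‖ ^ 4 ∂ν) := by
        refine (integral_add (((i2.const_mul _).const_mul _).add (integrable_const _))
          ((i4.const_mul _).const_mul _)).trans ?_
        rw [integral_const_mul, integral_const_mul]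
        congr 1
        refine (integral_add ((i2.const_mul _).const_mul _) (integrable_const _)).trans ?_
        rw [integral_const_mul, integral_const_mul, integral_const, probReal_univ, one_smul]
      rw [e2]
      have e3 : (k : ℝ) * ∫ z, ‖φb z‖ ^ 4 ∂ν ≤ M * (k : ℝ)⁻¹ := by
        rw [← div_eq_mul_inv, le_div_iff₀ hk']
        linarith
      have e4 := mul_le_mul_of_nonneg_left m2 (by positivity : 0 ≤ 2 * c ^ 2)
      linarith
    calc ENNReal.ofReal (∫ z, u z ∂ν) + ENNReal.ofReal (2 * b ^ 2 + 2) * k * ν (A k)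
        ≤ ENNReal.ofReal (δ / 2) + ENNReal.ofReal (δ / 4) := by
          gcongr
          rw [mul_assoc]
          exact hk2
      _ ≤ ENNReal.ofReal δ := by
          rw [← ENNReal.ofReal_add (by positivity) (by positivity)]
          exact ENNReal.ofReal_le_ofReal (by linarith)

end AsympLinear

/-! ### Consistency of the subbagging variance estimator -/

section Consistency

/-- The Cauchy–Schwarz inequality for averages. -/
theorem abs_average_mul_le {m : ℕ} (u v : Fin m → ℝ) {K L : ℝ} (hK : 0 ≤ K) (hL : 0 ≤ L)
    (hu : (m : ℝ)⁻¹ * ∑ j, u j ^ 2 ≤ K ^ 2) (hv : (m : ℝ)⁻¹ * ∑ j, v j ^ 2 ≤ L ^ 2) :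
    |(m : ℝ)⁻¹ * ∑ j, u j * v j| ≤ K * L := by
  refine abs_le_of_sq_le_sq ?_ (by positivity)
  have h := Finset.sum_mul_sq_le_sq_mul_sq Finset.univ u v
  calc ((m : ℝ)⁻¹ * ∑ j, u j * v j) ^ 2 = (m : ℝ)⁻¹ ^ 2 * (∑ j, u j * v j) ^ 2 := by ring
    _ ≤ (m : ℝ)⁻¹ ^ 2 * ((∑ j, u j ^ 2) * ∑ j, v j ^ 2) := by gcongr
    _ = ((m : ℝ)⁻¹ * ∑ j, u j ^ 2) * ((m : ℝ)⁻¹ * ∑ j, v j ^ 2) := by ring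
    _ ≤ K ^ 2 * L ^ 2 := by
        refine mul_le_mul hu hv ?_ (by positivity)
        exact mul_nonneg (by positivity) (Finset.sum_nonneg fun j _ => sq_nonneg _)
    _ = (K * L) ^ 2 := by ring

theorem abs_average_le {m : ℕ} (hm : 0 < m) (u : Fin m → ℝ) {K : ℝ} (hK : 0 ≤ K)
    (hu : (m : ℝ)⁻¹ * ∑ j, u j ^ 2 ≤ K ^ 2) : |(m : ℝ)⁻¹ * ∑ j, u j| ≤ K := by
  have hm' : (0 : ℝ) < m := by exact_mod_cast hm
  simpa using abs_average_mul_le u (fun _ => 1) hK zero_le_one hu (by simp [hm'.ne'])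

/-- The empirical covariance of perturbed variables. -/
theorem abs_average_perturbed {m : ℕ} (hm : 0 < m) (u v p q : Fin m → ℝ) {ξ η K : ℝ}
    (hη : 0 ≤ η) (hη1 : η ≤ 1) (hK : 0 ≤ K)
    (huv : |(m : ℝ)⁻¹ * ∑ j, (u j * v j - ξ)| ≤ η)
    (hu : (m : ℝ)⁻¹ * ∑ j, u j ^ 2 ≤ K ^ 2) (hv : (m : ℝ)⁻¹ * ∑ j, v j ^ 2 ≤ K ^ 2)
    (hp : (m : ℝ)⁻¹ * ∑ j, p j ^ 2 ≤ η ^ 2) (hq : (m : ℝ)⁻¹ * ∑ j, q j ^ 2 ≤ η ^ 2)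
    (hu1 : |(m : ℝ)⁻¹ * ∑ j, u j| ≤ η) (hv1 : |(m : ℝ)⁻¹ * ∑ j, v j| ≤ η) :
    |(m : ℝ)⁻¹ * ∑ j, (u j + p j) * (v j + q j) -
      ((m : ℝ)⁻¹ * ∑ j, (u j + p j)) * ((m : ℝ)⁻¹ * ∑ j, (v j + q j)) - ξ| ≤
      η * (6 + 2 * K) := by
  have hm' : (0 : ℝ) < m := by exact_mod_cast hm
  have h1 := abs_average_mul_le u q hK hη hu hq
  have h2 := abs_average_mul_le p v hη hK hp hv
  have h3 := abs_average_mul_le p q hη hη hp hq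
  have h4 := abs_average_le hm p hη hp
  have h5 := abs_average_le hm q hη hq
  have h6 : |(m : ℝ)⁻¹ * ∑ j, (u j + p j)| ≤ 2 * η := by
    rw [Finset.sum_add_distrib, mul_add]
    exact (abs_add_le _ _).trans (by linarith)
  have h7 : |(m : ℝ)⁻¹ * ∑ j, (v j + q j)| ≤ 2 * η := by
    rw [Finset.sum_add_distrib, mul_add]
    exact (abs_add_le _ _).trans (by linarith)
  have h8 : |((m : ℝ)⁻¹ * ∑ j, (u j + p j)) * ((m : ℝ)⁻¹ * ∑ j, (v j + q j))| ≤
      2 * η * (2 * η) := by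
    rw [abs_mul]; exact mul_le_mul h6 h7 (abs_nonneg _) (by positivity)
  have e : (m : ℝ)⁻¹ * ∑ j, (u j + p j) * (v j + q j) - ξ =
      (m : ℝ)⁻¹ * ∑ j, (u j * v j - ξ) + (m : ℝ)⁻¹ * ∑ j, u j * q j +
        (m : ℝ)⁻¹ * ∑ j, p j * v j + (m : ℝ)⁻¹ * ∑ j, p j * q j := by
    have : ∑ j, (u j + p j) * (v j + q j) =
        ∑ j, u j * v j + ∑ j, u j * q j + ∑ j, p j * v j + ∑ j, p j * q j := by
      simp only [← Finset.sum_add_distrib]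
      exact Finset.sum_congr rfl fun j _ => by ring
    rw [this, Finset.sum_sub_distrib]
    simp
    field_simp
    ring
  -- The errors are `η` from the main average, `2 K η` from the mixed terms, `η²` from the
  -- remainders and `4 η²` from the product of means. With `η² ≤ η` they total `η (6 + 2 K)`.
  have h9 : η * η ≤ η := by nlinarith
  have := abs_le.1 huv
  have := abs_le.1 h1
  have := abs_le.1 h2
  have := abs_le.1 h3
  have := abs_le.1 h8
  rw [sub_right_comm, e, abs_le]
  constructor <;> nlinarith

/-- An entry of the empirical covariance matrix. -/
theorem omega_apply {d m : ℕ} (hm : 0 < m) (e : Fin m → Vec d) (θ₀ : Vec d) (k : ℕ) (a b : Fin d) :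
    (k : ℝ) * Omega e a b =
      (m : ℝ)⁻¹ * ∑ j, (√k * (e j - θ₀) a) * (√k * (e j - θ₀) b) -
      ((m : ℝ)⁻¹ * ∑ j, √k * (e j - θ₀) a) * ((m : ℝ)⁻¹ * ∑ j, √k * (e j - θ₀) b) := by
  have hm' : (m : ℝ) ≠ 0 := by exact_mod_cast hm.ne'
  have hs : ∀ c, (subbag e).ofLp c = (m : ℝ)⁻¹ * ∑ j, e j c := by
    intro c; simp [subbag]
  simp only [Omega, Matrix.smul_apply, Matrix.sum_apply, Matrix.vecMulVec_apply, WithLp.ofLp_sub,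
    Pi.sub_apply, smul_eq_mul, hs]
  have hk : √(k : ℝ) * √k = k := Real.mul_self_sqrt (by positivity)
  have e1 : ∀ j, √(k : ℝ) * (e j a - θ₀ a) * (√k * (e j b - θ₀ b)) =
      k * (e j a * e j b - e j a * θ₀ b - θ₀ a * e j b + θ₀ a * θ₀ b) := by
    intro j; rw [mul_mul_mul_comm, hk]; ring
  have e2 : ∀ A B : ℝ, ∀ j, (e j a - A) * (e j b - B) =
      e j a * e j b - e j a * B - A * e j b + A * B := by intro A B j; ring
  simp only [e1, e2, ← Finset.mul_sum, Finset.sum_add_distrib, Finset.sum_sub_distrib,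
    ← Finset.sum_mul, Finset.sum_const, Finset.card_univ, Fintype.card_fin, nsmul_eq_mul]
  generalize ∑ j, e j a * e j b = A
  generalize ∑ j, (e j).ofLp a = B
  generalize ∑ j, (e j).ofLp b = C
  field_simp
  rw [Real.sq_sqrt (by positivity)]
  ring

variable {Ω : Type*} [MeasurableSpace Ω] {μ : Measure Ω} [IsProbabilityMeasure μ]
  {E : Type*} [MeasurableSpace E] {P : Measure E} [IsProbabilityMeasure P] {Z : ℕ → Ω → E}

theorem tendsto_measure_abs_ge {X : ℕ → Ω → ℝ} {u : ℕ → ℝ}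
    (h : ∀ᶠ N in atTop, Integrable (fun ω => X N ω ^ 2) μ ∧ ∫ ω, X N ω ^ 2 ∂μ ≤ u N)
    (hu : Tendsto u atTop (𝓝 0)) {η : ℝ} (hη : 0 < η) :
    Tendsto (fun N => μ {ω | η ≤ |X N ω|}) atTop (𝓝 0) := by
  have h1 : Tendsto (fun N => ENNReal.ofReal (u N / η ^ 2)) atTop (𝓝 0) := by
    simpa using ENNReal.tendsto_ofReal (hu.div_const (η ^ 2))
  refine tendsto_of_tendsto_of_tendsto_of_le_of_le' tendsto_const_nhds h1
    (Eventually.of_forall fun _ => zero_le) ?_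
  filter_upwards [h] with N hN
  refine (measure_mono fun ω hω => ?_).trans (measure_ge_le_of_integral
    (fun ω => sq_nonneg (X N ω)) hN.1 (by positivity : 0 < η ^ 2) hN.2)
  simp only [Set.mem_ofPred_eq] at hω ⊢
  rw [← sq_abs (X N ω)]
  exact pow_le_pow_left₀ hη.le hω 2

/-! ### Limits in probability of the subsample averages -/

section Limits

variable {k m : ℕ → ℕ} {S : (N : ℕ) → Fin (m N) → Ω → Subsample N (k N)}

/-- Averages of linear statistics of the subsamples tend to `0`. -/
theorem tendsto_linear (hZ : ∀ i, Measurable (Z i)) (hlaw : ∀ i, μ.map (Z i) = P)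
    (hind : iIndepFun Z μ) (hk_le : ∀ N, k N ≤ N)
    (hS : ∀ N, IsSubsampling μ Z N (k N) (m N) (S N)) (hk : Tendsto k atTop atTop)
    (hkN : Tendsto (fun N => (k N : ℝ) / N) atTop (𝓝 0)) (hm : Tendsto m atTop atTop)
    {g : E → ℝ} (hg : Measurable g) (hL : MemLp g 4 P) (h0 : ∫ x, g x ∂P = 0) {η : ℝ}
    (hη : 0 < η) :
    Tendsto (fun N => μ {ω | η ≤ |(m N : ℝ)⁻¹ *
      ∑ j, (√(k N))⁻¹ * ∑ i ∈ (S N j ω).1, g (Z i ω)|}) atTop (𝓝 0) := by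
  have hminv : Tendsto (fun N => (m N : ℝ)⁻¹) atTop (𝓝 0) :=
    tendsto_inv_atTop_nhds_zero_nat.comp hm
  refine tendsto_measure_abs_ge (u := fun N => (∫ x, g x ^ 2 ∂P) / m N +
    (∫ x, g x ^ 2 ∂P) * (k N / N)) ?_ ?_ hη
  · filter_upwards [hk.eventually_gt_atTop 0, hm.eventually_gt_atTop 0] with N h1 h2
    exact (hS N).linear_moment (hk_le N) h1 h2 hZ hlaw hind hg hL h0
  · simpa [div_eq_mul_inv] using (hminv.const_mul (∫ x, g x ^ 2 ∂P)).add
      (hkN.const_mul (∫ x, g x ^ 2 ∂P))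

/-- Averages of bilinear statistics of the subsamples tend to their expectation. -/
theorem tendsto_bilinear (hZ : ∀ i, Measurable (Z i)) (hlaw : ∀ i, μ.map (Z i) = P)
    (hind : iIndepFun Z μ) (hk_le : ∀ N, k N ≤ N)
    (hS : ∀ N, IsSubsampling μ Z N (k N) (m N) (S N)) (hk : Tendsto k atTop atTop)
    (hkN : Tendsto (fun N => (k N : ℝ) / N) atTop (𝓝 0)) (hm : Tendsto m atTop atTop)
    {g h : E → ℝ} (hg : Measurable g) (hh : Measurable h) (hgL : MemLp g 4 P) (hhL : MemLp h 4 P)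
    (hg0 : ∫ x, g x ∂P = 0) (hh0 : ∫ x, h x ∂P = 0) {η : ℝ} (hη : 0 < η) :
    Tendsto (fun N => μ {ω | η ≤ |(m N : ℝ)⁻¹ *
      ∑ j, ((√(k N))⁻¹ * (∑ i ∈ (S N j ω).1, g (Z i ω)) *
        ((√(k N))⁻¹ * ∑ i ∈ (S N j ω).1, h (Z i ω)) - ∫ x, g x * h x ∂P)|}) atTop (𝓝 0) := by
  have hminv : Tendsto (fun N => (m N : ℝ)⁻¹) atTop (𝓝 0) :=
    tendsto_inv_atTop_nhds_zero_nat.comp hm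
  set K := max (∫ x, g x ^ 4 ∂P + 3 * (∫ x, g x ^ 2 ∂P) ^ 2)
    (∫ x, h x ^ 4 ∂P + 3 * (∫ x, h x ^ 2 ∂P) ^ 2)
  set ξ := ∫ x, g x * h x ∂P
  refine tendsto_measure_abs_ge (u := fun N => (2 * K + 2 * ξ ^ 2) / m N +
    6 * K * (1 / N + (k N / N) ^ 2)) ?_ ?_ hη
  · filter_upwards [hk.eventually_gt_atTop 1, hm.eventually_gt_atTop 0] with N h1 h2
    have hb := (hS N).bilinear_moment (hk_le N) h1 h2 hZ hlaw hind hg hh hgL hhL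
      hg0 hh0 (K := K) (le_max_left _ _) (le_max_right _ _)
    have h3 : (√(k N : ℝ))⁻¹ * (√(k N))⁻¹ = (k N : ℝ)⁻¹ := by
      rw [← mul_inv, Real.mul_self_sqrt (by positivity)]
    simp only [mul_mul_mul_comm, h3]
    exact hb
  · have h1 := (hminv.const_mul (2 * K + 2 * ξ ^ 2)).add
      ((tendsto_one_div_atTop_nhds_zero_nat.add (hkN.pow 2)).const_mul (6 * K))
    simpa [div_eq_mul_inv] using h1

variable {d : ℕ} {φ : E → Vec d} {θ₀ : Vec d} {T : (n : ℕ) → (Fin n → E) → Vec d}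

/-- The linearization error of the estimator in the `j`-th subsample. -/
def remainder {N k m : ℕ} (φ : E → Vec d) (θ₀ : Vec d) (T : (Fin k → E) → Vec d) (Z : ℕ → Ω → E)
    (S : Fin m → Ω → Subsample N k) (j : Fin m) (ω : Ω) : Vec d :=
  T (pick (fun i => Z i ω) (S j ω)) - θ₀ - (k : ℝ)⁻¹ • ∑ i, φ (pick (fun i => Z i ω) (S j ω) i)

/-- Each subsample, though drawn at random, has the law of a sample of size `k N`. The expected
average of the majorants is therefore the integral of `R`, whatever the dependence between
overlapping subsamples, and Markov's inequality applies. -/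
theorem tendsto_remainder (hZ : ∀ i, Measurable (Z i)) (hlaw : ∀ i, μ.map (Z i) = P)
    (hind : iIndepFun Z μ) (hk_le : ∀ N, k N ≤ N)
    (hS : ∀ N, IsSubsampling μ Z N (k N) (m N) (S N)) (hk : Tendsto k atTop atTop)
    (hm : Tendsto m atTop atTop) (hT : AsympLinear P φ θ₀ T) {η : ℝ} (hη : 0 < η) :
    Tendsto (fun N => μ {ω | η ≤ (m N : ℝ)⁻¹ *
      ∑ j, k N * ‖remainder φ θ₀ (T (k N)) Z (S N) j ω‖ ^ 2}) atTop (𝓝 0) := by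
  rw [ENNReal.tendsto_nhds_zero]
  intro δ hδ
  obtain ⟨δ', hδ'0, hδ'⟩ : ∃ δ' : ℝ, 0 < δ' ∧ ENNReal.ofReal (δ' / η) ≤ δ := by
    rcases eq_or_ne δ ∞ with rfl | hδ1
    · exact ⟨1, one_pos, le_top⟩
    · refine ⟨δ.toReal * η, mul_pos (ENNReal.toReal_pos hδ.ne' hδ1) hη, ?_⟩
      rw [mul_div_cancel_right₀ _ hη.ne', ENNReal.ofReal_toReal hδ1]
  filter_upwards [hk.eventually (hT δ' hδ'0), hm.eventually_gt_atTop 0] with N hN hm0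
  obtain ⟨R, hRm, hRle, hRint⟩ := hN
  refine le_trans ?_ hδ'
  have hmeas : ∀ j, Measurable fun ω => R (pick (fun i => Z i ω) (S N j ω)) := by
    intro j
    have h1 : Measurable fun x : Subsample N (k N) × (ℕ → E) => R (pick x.2 x.1) :=
      measurable_from_prod_countable_right fun t => hRm.comp (measurable_pick t)
    exact h1.comp (((hS N).measurable j).prodMk (measurable_pi_lambda _ hZ))
  have hM := mul_meas_ge_le_lintegral₀ (μ := μ)
    (f := fun ω => (m N : ℝ≥0∞)⁻¹ * ∑ j, R (pick (fun i => Z i ω) (S N j ω)))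
    ((Finset.measurable_fun_sum _ fun j _ => hmeas j).const_mul _).aemeasurable
    (ENNReal.ofReal η)
  rw [lintegral_const_mul _ (Finset.measurable_fun_sum _ fun j _ => hmeas j),
    lintegral_finsetSum _ fun j _ => hmeas j] at hM
  simp only [(hS N).lintegral_pick (hk_le N) hZ hlaw hind hRm, Finset.sum_const,
    Finset.card_univ, Fintype.card_fin, nsmul_eq_mul] at hM
  rw [← mul_assoc, ENNReal.inv_mul_cancel (by exact_mod_cast hm0.ne') (by simp), one_mul] at hM
  have hsub : {ω | η ≤ (m N : ℝ)⁻¹ * ∑ j, k N * ‖remainder φ θ₀ (T (k N)) Z (S N) j ω‖ ^ 2} ⊆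
      {ω | ENNReal.ofReal η ≤ (m N : ℝ≥0∞)⁻¹ * ∑ j, R (pick (fun i => Z i ω) (S N j ω))} := by
    intro ω hω
    simp only [Set.mem_ofPred_eq] at hω ⊢
    refine (ENNReal.ofReal_le_ofReal hω).trans ?_
    rw [ENNReal.ofReal_mul (by positivity), ENNReal.ofReal_inv_of_pos (by exact_mod_cast hm0),
      ENNReal.ofReal_natCast, ENNReal.ofReal_sum_of_nonneg fun j _ => by positivity]
    gcongr with j
    exact hRle _
  rw [ENNReal.ofReal_div_of_pos hη, ENNReal.le_div_iff_mul_le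
    (Or.inl (ENNReal.ofReal_pos.2 hη).ne') (Or.inl ENNReal.ofReal_ne_top), mul_comm]
  exact (mul_le_mul_right (measure_mono hsub) _).trans (hM.trans hRint)

/-- Linear statistics have vanishing average, their products average to the covariance of `φ`, and
the remainders vanish in mean square. `abs_average_perturbed` combines these facts deterministically
off the union of six unlikely events. -/
theorem tendstoInMeasure_omega (hZ : ∀ i, Measurable (Z i))
    (hlaw : ∀ i, μ.map (Z i) = P) (hind : iIndepFun Z μ) (hk_le : ∀ N, k N ≤ N)
    (hS : ∀ N, IsSubsampling μ Z N (k N) (m N) (S N)) (hk : Tendsto k atTop atTop)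
    (hkN : Tendsto (fun N => (k N : ℝ) / N) atTop (𝓝 0)) (hm : Tendsto m atTop atTop)
    (hφ : Measurable φ) (hL : ∀ a, MemLp (fun x => φ x a) 4 P)
    (h0 : ∀ a, ∫ x, φ x a ∂P = 0) (hT : AsympLinear P φ θ₀ T) (a b : Fin d) :
    TendstoInMeasure μ
      (fun N ω => (k N : ℝ) * Omega (fun j => T (k N) (pick (fun i => Z i ω) (S N j ω))) a b)
      atTop (fun _ => ∫ x, φ x a * φ x b ∂P) := by
  have hφc : ∀ c, Measurable fun x => φ x c := fun c => by fun_prop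
  rw [tendstoInMeasure_iff_norm]
  intro ε hε
  have hlin := fun c η (hη : (0 : ℝ) < η) =>
    tendsto_linear hZ hlaw hind hk_le hS hk hkN hm (hφc c) (hL c) (h0 c) hη
  have hquad := fun c e η (hη : (0 : ℝ) < η) => tendsto_bilinear hZ hlaw hind hk_le hS hk hkN hm
    (hφc c) (hφc e) (hL c) (hL e) (h0 c) (h0 e) hη
  have hrem := fun η (hη : (0 : ℝ) < η) =>
    tendsto_remainder (S := S) hZ hlaw hind hk_le hS hk hm hT hη
  set ξ : Fin d → Fin d → ℝ := fun c e => ∫ x, φ x c * φ x e ∂P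
  have hξ : ∀ c, 0 ≤ ξ c c := fun c => integral_nonneg fun x => mul_self_nonneg _
  -- On the good event the averaged squares of both coordinates are within `1` of their limits, so
  -- `K²` bounds them both.
  set K := √(ξ a a + ξ b b + 1)
  have hK2 : K ^ 2 = ξ a a + ξ b b + 1 :=
    Real.sq_sqrt (by have := hξ a; have := hξ b; linarith)
  obtain ⟨η, hη0, hη1, hηε⟩ : ∃ η : ℝ, 0 < η ∧ η ≤ 1 ∧ η * (6 + 2 * K) < ε := by
    refine ⟨min 1 (ε / (7 + 2 * K)), by positivity, min_le_left _ _, ?_⟩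
    have hKp : 0 ≤ K := Real.sqrt_nonneg _
    calc min 1 (ε / (7 + 2 * K)) * (6 + 2 * K) ≤ ε / (7 + 2 * K) * (6 + 2 * K) := by
          gcongr; exact min_le_right _ _
      _ < ε / (7 + 2 * K) * (7 + 2 * K) := by
          refine mul_lt_mul_of_pos_left (by linarith) (by positivity)
      _ = ε := by field_simp
  have hsum := (((((hquad a b η hη0).add (hquad a a 1 one_pos)).add (hquad b b 1 one_pos)).add
    (hlin a η hη0)).add (hlin b η hη0)).add (hrem (η ^ 2) (by positivity))
  simp only [add_zero] at hsum
  refine tendsto_of_tendsto_of_tendsto_of_le_of_le' tendsto_const_nhds hsum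
    (Eventually.of_forall fun _ => zero_le) ?_
  filter_upwards [hk.eventually_gt_atTop 0, hm.eventually_gt_atTop 0] with N hk0 hm0
  set A : Fin (m N) → Fin d → Ω → ℝ := fun j c ω =>
    (√(k N))⁻¹ * ∑ i ∈ (S N j ω).1, φ (Z i ω) c with hA
  set r := remainder φ θ₀ (T (k N)) Z (S N) with hr
  have hk' : (0 : ℝ) < k N := by exact_mod_cast hk0
  have hm' : (0 : ℝ) < m N := by exact_mod_cast hm0
  refine le_trans (measure_mono (t := ((((
    {ω | η ≤ |(m N : ℝ)⁻¹ * ∑ j, (A j a ω * A j b ω - ξ a b)|} ∪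
    {ω | 1 ≤ |(m N : ℝ)⁻¹ * ∑ j, (A j a ω * A j a ω - ξ a a)|}) ∪
    {ω | 1 ≤ |(m N : ℝ)⁻¹ * ∑ j, (A j b ω * A j b ω - ξ b b)|}) ∪
    {ω | η ≤ |(m N : ℝ)⁻¹ * ∑ j, A j a ω|}) ∪
    {ω | η ≤ |(m N : ℝ)⁻¹ * ∑ j, A j b ω|}) ∪
    {ω | η ^ 2 ≤ (m N : ℝ)⁻¹ * ∑ j, k N * ‖r j ω‖ ^ 2}) ?_) ?_
  · intro ω hω
    by_contra hno
    simp only [Set.mem_union, Set.mem_ofPred_eq, not_or, not_le] at hno hω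
    obtain ⟨⟨⟨⟨⟨n1, n2⟩, n3⟩, n4⟩, n5⟩, n6⟩ := hno
    have hdec : ∀ c j, √(k N) * (T (k N) (pick (fun i => Z i ω) (S N j ω)) - θ₀) c =
        A j c ω + √(k N) * r j ω c := by
      intro c j
      have h1 : ((k N : ℝ)⁻¹ • ∑ i, φ (pick (fun i => Z i ω) (S N j ω) i)) c =
          (k N : ℝ)⁻¹ * ∑ i ∈ (S N j ω).1, φ (Z i ω) c := by
        rw [sum_pick (fun i => Z i ω) (S N j ω) φ]
        simp
      have h2 : (√(k N : ℝ))⁻¹ = √(k N) * (k N : ℝ)⁻¹ := by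
        have := Real.sq_sqrt hk'.le
        have h3 : √(k N : ℝ) ≠ 0 := by positivity
        field_simp
        exact this.symm
      simp only [hr, remainder, hA, PiLp.sub_apply, h1, h2]
      ring
    have hsq : ∀ c, (m N : ℝ)⁻¹ * ∑ j, A j c ω ^ 2 =
        (m N : ℝ)⁻¹ * ∑ j, (A j c ω * A j c ω - ξ c c) + ξ c c := by
      intro c
      rw [Finset.sum_sub_distrib, mul_sub]
      simp [← sq, hm'.ne']
    have hrr : ∀ c, (m N : ℝ)⁻¹ * ∑ j, (√(k N) * r j ω c) ^ 2 ≤ η ^ 2 := by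
      intro c
      refine le_trans ?_ n6.le
      gcongr with j
      rw [mul_pow, Real.sq_sqrt hk'.le]
      refine mul_le_mul_of_nonneg_left ?_ hk'.le
      rw [EuclideanSpace.real_norm_sq_eq]
      exact Finset.single_le_sum (f := fun c => (r j ω) c ^ 2) (fun c _ => sq_nonneg _)
        (Finset.mem_univ c)
    have hfin := abs_average_perturbed hm0 (fun j => A j a ω) (fun j => A j b ω)
      (fun j => √(k N) * r j ω a) (fun j => √(k N) * r j ω b) hη0.le hη1
      (Real.sqrt_nonneg _) n1.le (K := K) (by
        rw [hsq, hK2]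
        linarith [hξ b, (abs_lt.1 n2).2]) (by
        rw [hsq, hK2]
        linarith [hξ a, (abs_lt.1 n3).2]) (hrr a) (hrr b) n4.le n5.le
    rw [omega_apply hm0 _ θ₀] at hω
    simp only [hdec] at hω
    rw [Real.norm_eq_abs] at hω
    linarith
  · refine (measure_union_le _ _).trans (add_le_add ?_ le_rfl)
    refine (measure_union_le _ _).trans (add_le_add ?_ le_rfl)
    refine (measure_union_le _ _).trans (add_le_add ?_ le_rfl)
    refine (measure_union_le _ _).trans (add_le_add ?_ le_rfl)
    exact measure_union_le _ _

end Limits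

end Consistency

/-! ### Roots of perturbed linear maps -/

section Roots

variable {F : Type*} [NormedAddCommGroup F] [NormedSpace ℝ F]

/-- `G` is approximated by the linear map `A` on `s`, up to the factor `c`. -/
def NearlyLinear (G : F → F) (A : F →L[ℝ] F) (s : Set F) (c : ℝ) : Prop :=
  ∀ x ∈ s, ∀ y ∈ s, ‖G x - G y - A (x - y)‖ ≤ c * ‖x - y‖

theorem NearlyLinear.add_lipschitz {G H : F → F} {A : F →L[ℝ] F} {s : Set F} {c c' : ℝ}
    (hG : NearlyLinear G A s c) (hH : ∀ x ∈ s, ∀ y ∈ s, ‖H x - H y‖ ≤ c' * ‖x - y‖) :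
    NearlyLinear (fun x => G x + H x) A s (c + c') := by
  intro x hx y hy
  have : G x + H x - (G y + H y) - A (x - y) = (G x - G y - A (x - y)) + (H x - H y) := by abel
  rw [this, add_mul]
  exact (norm_add_le _ _).trans (add_le_add (hG x hx y hy) (hH x hx y hy))

/-- A map within `c` of an invertible linear map covers a ball of radius `(a⁻¹ - c) ρ` around `G
x₀`, and `a c ≤ 1 / 2` makes this at least `ρ / (2 a)`. The ball then contains `0`. -/
theorem NearlyLinear.exists_root [CompleteSpace F] {G : F → F} {A : F ≃L[ℝ] F} {x₀ : F} {ρ c a : ℝ}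
    (hG : NearlyLinear G (A : F →L[ℝ] F) (Metric.closedBall x₀ ρ) c) (hρ : 0 ≤ ρ) (hc : 0 ≤ c)
    (ha : 0 < a) (hA : ‖(A.symm : F →L[ℝ] F)‖ ≤ a) (hac : a * c ≤ 1 / 2)
    (h0 : ‖G x₀‖ ≤ ρ / (2 * a)) : ∃ x ∈ Metric.closedBall x₀ ρ, G x = 0 := by
  have happ : ApproximatesLinearOn G (A : F →L[ℝ] F) (Metric.closedBall x₀ ρ) c.toNNReal := by
    intro x hx y hy
    rw [Real.coe_toNNReal c hc]
    exact hG x hx y hy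
  let R : (A : F →L[ℝ] F).NonlinearRightInverse :=
    { toFun := A.symm
      nnnorm := a.toNNReal
      bound' := fun y => by
        rw [Real.coe_toNNReal a ha.le]
        exact ((A.symm : F →L[ℝ] F).le_opNorm y).trans (by gcongr)
      right_inv' := fun y => A.apply_symm_apply y }
  obtain ⟨x, hx, hx0⟩ := happ.surjOn_closedBall_of_nonlinearRightInverse R hρ le_rfl
    (show (0 : F) ∈ Metric.closedBall (G x₀) _ by
      rw [Metric.mem_closedBall, dist_comm, dist_zero_right]
      refine h0.trans ?_
      have e : (((R.nnnorm : ℝ)⁻¹ - (c.toNNReal : ℝ)) * ρ) = (a⁻¹ - c) * ρ := by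
        rw [Real.coe_toNNReal c hc]
        simp only [R, Real.coe_toNNReal a ha.le]
      rw [e, div_eq_mul_inv, mul_comm]
      refine mul_le_mul_of_nonneg_right ?_ hρ
      rw [mul_inv, le_sub_iff_add_le]
      have h1 : c ≤ 2⁻¹ * a⁻¹ := by
        rw [← div_eq_mul_inv, le_div_iff₀ ha]; linarith
      linarith)
  exact ⟨x, hx, hx0⟩

/-- One Newton step from `x₀`, with the fixed linear map `A`. The value at `x` is kept because it is
not zero for the solutions of the bias-corrected equations. -/
theorem NearlyLinear.linearization {G : F → F} {A : F ≃L[ℝ] F} {s : Set F} {c : ℝ}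
    (hG : NearlyLinear G (A : F →L[ℝ] F) s c) {x x₀ : F} (hx : x ∈ s) (hx₀ : x₀ ∈ s) :
    ‖x - x₀ + A.symm (G x₀) - A.symm (G x)‖ ≤ ‖(A.symm : F →L[ℝ] F)‖ * (c * ‖x - x₀‖) := by
  have e : x - x₀ + A.symm (G x₀) - A.symm (G x) = -(A.symm : F →L[ℝ] F) (G x - G x₀ - A (x - x₀)) := by
    have : A.symm (A (x - x₀)) = x - x₀ := A.symm_apply_apply _
    simp only [ContinuousLinearEquiv.coe_coe, map_sub] at this ⊢
    rw [this]
    abel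
  rw [e, norm_neg]
  exact ((A.symm : F →L[ℝ] F).le_opNorm _).trans (by gcongr; exact hG x hx x₀ hx₀)

end Roots

/-! ### Derivatives of the estimating function -/

section Derivatives

variable {d : ℕ} {E : Type*} [MeasurableSpace E] {P : Measure E}

/-- The derivative in the parameter, within the parameter space. -/
def grad {F : Type*} [NormedAddCommGroup F] [NormedSpace ℝ F] (Θ : Set (Vec d)) (g : Vec d → E → F)
    (θ : Vec d) (z : E) : Vec d →L[ℝ] F :=
  fderivWithin ℝ (fun t => g t z) Θ θ

variable {F : Type*} [NormedAddCommGroup F] [NormedSpace ℝ F] {Θ : Set (Vec d)} {g : Vec d → E → F}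

theorem contDiffOn_grad (hΘ : UniqueDiffOn ℝ Θ) {n : ℕ} {z : E}
    (h : ContDiffOn ℝ (n + 1 : ℕ) (fun t => g t z) Θ) :
    ContDiffOn ℝ n (fun t => grad Θ g t z) Θ :=
  h.fderivWithin hΘ (by exact_mod_cast le_rfl)

theorem hasFDerivWithinAt_grad {n : ℕ} {z : E}
    (h : ContDiffOn ℝ (n + 1 : ℕ) (fun t => g t z) Θ) {θ : Vec d} (hθ : θ ∈ Θ) :
    HasFDerivWithinAt (fun t => g t z) (grad Θ g θ z) Θ θ :=
  (h.differentiableOn (by simp) θ hθ).hasFDerivWithinAt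

theorem squareEnveloped_grad (hΘ : UniqueDiffOn ℝ Θ) {n : ℕ}
    (hs : ∀ᵐ z ∂P, ContDiffOn ℝ (n + 1 : ℕ) (fun t => g t z) Θ)
    (hm : ∀ θ ∈ Θ, AEStronglyMeasurable (g θ) P)
    (hb : ∫⁻ z, ⨆ θ ∈ Θ, ‖grad Θ g θ z‖ₑ ^ 2 ∂P < ∞) : SquareEnveloped P Θ (grad Θ g) where
  continuous := by
    filter_upwards [hs] with z hz
    exact (contDiffOn_grad hΘ hz).continuousOn
  measurable := fun θ hθ => by
    refine aestronglyMeasurable_fderivWithin hθ (hΘ θ hθ) hm ?_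
    filter_upwards [hs] with z hz
    exact (hasFDerivWithinAt_grad hz hθ).differentiableWithinAt
  bound := hb

theorem norm_sub_le_of_grad {n : ℕ} {z : E} (h : ContDiffOn ℝ (n + 1 : ℕ) (fun t => g t z) Θ)
    {s : Set (Vec d)} (hs : Convex ℝ s) (hsΘ : s ⊆ Θ) {C : ℝ}
    (hC : ∀ θ ∈ s, ‖grad Θ g θ z‖ ≤ C) {x y : Vec d} (hx : x ∈ s) (hy : y ∈ s) :
    ‖g x z - g y z‖ ≤ C * ‖x - y‖ :=
  hs.norm_image_sub_le_of_norm_hasFDerivWithin_le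
    (fun _ hθ => (hasFDerivWithinAt_grad h (hsΘ hθ)).mono hsΘ) hC hy hx

end Derivatives

/-! ### Regularity of the estimating function and local behaviour of its roots -/

section Regularity

variable {d p : ℕ} {P : Measure (Vec p)} {ψ : Vec d → Vec p → Vec d} {Θ : Set (Vec d)}

theorem norm_gradPow_zero (θ : Vec d) (z : Vec p) : ‖gradPow ψ Θ 0 θ z‖ = ‖ψ θ z‖ :=
  norm_iteratedFDerivWithin_zero

theorem norm_gradPow_one (hΘ : UniqueDiffOn ℝ Θ) {θ : Vec d} (hθ : θ ∈ Θ) (z : Vec p) :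
    ‖gradPow ψ Θ 1 θ z‖ = ‖grad Θ ψ θ z‖ :=
  norm_iteratedFDerivWithin_one _ (hΘ θ hθ)

theorem norm_gradPow_two (hΘ : UniqueDiffOn ℝ Θ) {θ : Vec d} (hθ : θ ∈ Θ) (z : Vec p) :
    ‖gradPow ψ Θ 2 θ z‖ = ‖grad Θ (grad Θ ψ) θ z‖ := by
  have h1 := norm_iteratedFDerivWithin_fderivWithin (𝕜 := ℝ) (f := fun t => ψ t z) (n := 1) hΘ hθ
  have h2 := norm_iteratedFDerivWithin_one (fun t => grad Θ ψ t z) (hΘ θ hθ)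
  exact h1.symm.trans h2

theorem norm_gradPow_three (hΘ : UniqueDiffOn ℝ Θ) {θ : Vec d} (hθ : θ ∈ Θ) (z : Vec p) :
    ‖gradPow ψ Θ 3 θ z‖ = ‖grad Θ (grad Θ (grad Θ ψ)) θ z‖ := by
  have h1 := norm_iteratedFDerivWithin_fderivWithin (𝕜 := ℝ) (f := fun t => ψ t z) (n := 2) hΘ hθ
  have h2 := norm_iteratedFDerivWithin_fderivWithin (𝕜 := ℝ) (f := fun t => grad Θ ψ t z)
    (n := 1) hΘ hθ
  have h3 := norm_iteratedFDerivWithin_one (fun t => grad Θ (grad Θ ψ) t z) (hΘ θ hθ)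
  exact h1.symm.trans (h2.symm.trans h3)

theorem CondEnvelope.lintegral_lt_top {κ : ℕ} (h : CondEnvelope P ψ Θ κ) {F : Type*}
    [NormedAddCommGroup F] {g : Vec d → Vec p → F}
    (hg : ∀ θ ∈ Θ, ∀ z, ‖gradPow ψ Θ κ θ z‖ = ‖g θ z‖) :
    ∫⁻ z, ⨆ θ ∈ Θ, ‖g θ z‖ₑ ^ 2 ∂P < ∞ := by
  refine lt_of_le_of_lt (lintegral_mono fun z => ?_) h
  refine iSup₂_mono fun θ hθ => ?_
  rw [← ofReal_norm, ← ofReal_norm, hg θ hθ z]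

/-- The regularity conditions on the estimating function. -/
structure Regular (P : Measure (Vec p)) (ψ : Vec d → Vec p → Vec d) (Θ : Set (Vec d))
    (θ₀ : Vec d) : Prop where
  uniqueDiff : UniqueDiffOn ℝ Θ
  cond : CondC1 P ψ Θ θ₀
  measurable : CondMeasurable ψ Θ
  smooth : CondSmooth P ψ Θ 3
  envelope : ∀ κ ≤ 3, CondEnvelope P ψ Θ κ

variable {θ₀ : Vec d}

theorem Regular.mem (h : Regular P ψ Θ θ₀) : θ₀ ∈ Θ := interior_subset h.cond.interior

theorem Regular.enveloped_zero (h : Regular P ψ Θ θ₀) : SquareEnveloped P Θ ψ where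
  continuous := by
    filter_upwards [h.smooth] with z hz using hz.continuousOn
  measurable := fun θ hθ => (h.measurable θ hθ).aestronglyMeasurable
  bound := (h.envelope 0 (by norm_num)).lintegral_lt_top fun θ _ z => norm_gradPow_zero θ z

theorem Regular.enveloped_one (h : Regular P ψ Θ θ₀) : SquareEnveloped P Θ (grad Θ ψ) :=
  squareEnveloped_grad h.uniqueDiff (n := 2) h.smooth h.enveloped_zero.measurable
    ((h.envelope 1 (by norm_num)).lintegral_lt_top fun _ hθ z => norm_gradPow_one h.uniqueDiff hθ z)

theorem Regular.enveloped_two (h : Regular P ψ Θ θ₀) :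
    SquareEnveloped P Θ (grad Θ (grad Θ ψ)) := by
  refine squareEnveloped_grad h.uniqueDiff (n := 1) ?_ h.enveloped_one.measurable
    ((h.envelope 2 (by norm_num)).lintegral_lt_top fun _ hθ z => norm_gradPow_two h.uniqueDiff hθ z)
  filter_upwards [h.smooth] with z hz using contDiffOn_grad h.uniqueDiff hz

theorem Regular.enveloped_three (h : Regular P ψ Θ θ₀) :
    SquareEnveloped P Θ (grad Θ (grad Θ (grad Θ ψ))) := by
  refine squareEnveloped_grad h.uniqueDiff (n := 0) ?_ h.enveloped_two.measurable
    ((h.envelope 3 le_rfl).lintegral_lt_top fun _ hθ z => norm_gradPow_three h.uniqueDiff hθ z)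
  filter_upwards [h.smooth] with z hz
  exact contDiffOn_grad h.uniqueDiff (n := 1) (contDiffOn_grad h.uniqueDiff hz)

/-- The estimating function is smooth at `z` and bounded by `e`, with its derivatives. -/
structure SmoothPoint (ψ : Vec d → Vec p → Vec d) (Θ : Set (Vec d)) (e : ℝ) (z : Vec p) : Prop where
  smooth : ContDiffOn ℝ 3 (fun t => ψ t z) Θ
  zero : ∀ θ ∈ Θ, ‖ψ θ z‖ ≤ e
  one : ∀ θ ∈ Θ, ‖grad Θ ψ θ z‖ ≤ e
  two : ∀ θ ∈ Θ, ‖grad Θ (grad Θ ψ) θ z‖ ≤ e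
  three : ∀ θ ∈ Θ, ‖grad Θ (grad Θ (grad Θ ψ)) θ z‖ ≤ e

theorem Regular.exists_envelope (h : Regular P ψ Θ θ₀) :
    ∃ e : Vec p → ℝ, MemLp e 2 P ∧ (∀ z, 0 ≤ e z) ∧ ∀ᵐ z ∂P, SmoothPoint ψ Θ (e z) z := by
  obtain ⟨e0, m0, n0, b0⟩ := h.enveloped_zero.exists_envelope h.cond.compact
  obtain ⟨e1, m1, n1, b1⟩ := h.enveloped_one.exists_envelope h.cond.compact
  obtain ⟨e2, m2, n2, b2⟩ := h.enveloped_two.exists_envelope h.cond.compact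
  obtain ⟨e3, m3, n3, b3⟩ := h.enveloped_three.exists_envelope h.cond.compact
  refine ⟨fun z => e0 z + e1 z + e2 z + e3 z, ((m0.add m1).add m2).add m3, fun z => ?_, ?_⟩
  · linarith [n0 z, n1 z, n2 z, n3 z]
  · filter_upwards [h.smooth, b0, b1, b2, b3] with z hz c0 c1 c2 c3
    refine ⟨hz, fun θ hθ => ?_, fun θ hθ => ?_, fun θ hθ => ?_, fun θ hθ => ?_⟩
    · linarith [n0 z, n1 z, n2 z, n3 z, c0 θ hθ]
    · linarith [n0 z, n1 z, n2 z, n3 z, c1 θ hθ]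
    · linarith [n0 z, n1 z, n2 z, n3 z, c2 θ hθ]
    · linarith [n0 z, n1 z, n2 z, n3 z, c3 θ hθ]

/-- The sample mean of a random function. -/
def smean {F : Type*} [NormedAddCommGroup F] [NormedSpace ℝ F] (g : Vec d → Vec p → F) {k : ℕ}
    (z : Fin k → Vec p) (θ : Vec d) : F :=
  (k : ℝ)⁻¹ • ∑ i, g θ (z i)

variable [IsProbabilityMeasure P]

/-- Near `θ₀`, the estimating equations are nearly linear off a rare event. -/
theorem Regular.exists_nearlyLinear (h : Regular P ψ Θ θ₀) {c ρ₀ : ℝ} (hc : 0 < c) (hρ₀ : 0 < ρ₀) :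
    ∃ ρ, 0 < ρ ∧ ρ ≤ ρ₀ ∧ Metric.closedBall θ₀ ρ ⊆ Θ ∧
      (∀ θ ∈ Metric.closedBall θ₀ ρ, ‖∫ x, grad Θ ψ θ x ∂P - ∫ x, grad Θ ψ θ₀ x ∂P‖ ≤ c) ∧
      Negligible P fun k => {z : Fin k → Vec p |
        ¬ NearlyLinear (smean ψ z) (∫ x, grad Θ ψ θ₀ x ∂P) (Metric.closedBall θ₀ ρ) c} := by
  have hcont : ContinuousAt (fun θ => ∫ x, grad Θ ψ θ x ∂P) θ₀ :=
    (h.enveloped_one.continuousOn_integral h.cond.compact).continuousAt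
      (mem_interior_iff_mem_nhds.1 h.cond.interior)
  have h1 : ∀ᶠ θ in 𝓝 θ₀, ‖∫ x, grad Θ ψ θ x ∂P - ∫ x, grad Θ ψ θ₀ x ∂P‖ < c / 2 := by
    have := Metric.tendsto_nhds.1 hcont (c / 2) (by positivity)
    simpa only [dist_eq_norm] using this
  have h2 : ∀ᶠ θ in 𝓝 θ₀, θ ∈ Θ := mem_interior_iff_mem_nhds.1 h.cond.interior
  obtain ⟨r, hr, hrb⟩ := Metric.nhds_basis_closedBall.mem_iff.1 (h1.and h2)
  refine ⟨min r ρ₀, by positivity, min_le_right _ _, ?_, ?_, ?_⟩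
  · exact fun θ hθ => (hrb (Metric.closedBall_subset_closedBall (min_le_left _ _) hθ)).2
  · intro θ hθ
    have h3 : ‖∫ x, grad Θ ψ θ x ∂P - ∫ x, grad Θ ψ θ₀ x ∂P‖ < c / 2 :=
      (hrb (Metric.closedBall_subset_closedBall (min_le_left _ _) hθ)).1
    linarith
  refine (h.enveloped_one.negligible h.cond.compact (ε := c / 2) (by positivity)).mono
    (Eventually.of_forall fun k => ?_)
  filter_upwards [ae_pi_forall h.smooth k] with z hz hn
  by_contra hno
  simp only [not_exists, not_and, not_le] at hno
  refine hn fun x hx y hy => ?_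
  have hsub : Metric.closedBall θ₀ (min r ρ₀) ⊆ Θ := fun θ hθ =>
    (hrb (Metric.closedBall_subset_closedBall (min_le_left _ _) hθ)).2
  -- Mean value inequality: on the ball the averaged derivative is within `c` of the limit, half of
  -- `c` from the uniform law of large numbers and half from continuity of the expected derivative.
  refine (convex_closedBall θ₀ (min r ρ₀)).norm_image_sub_le_of_norm_hasFDerivWithin_le'
    (f := smean ψ z) (f' := smean (grad Θ ψ) z) (fun θ hθ => ?_) (fun θ hθ => ?_) hy hx
  · have := HasFDerivWithinAt.fun_sum (u := Finset.univ) fun i _ =>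
      (hasFDerivWithinAt_grad (n := 2) (hz i) (hsub hθ)).mono hsub
    exact this.const_smul ((k : ℝ)⁻¹)
  · have h3 := (hrb (Metric.closedBall_subset_closedBall (min_le_left _ _) hθ)).1
    have h4 := hno θ (hsub hθ)
    calc ‖smean (grad Θ ψ) z θ - ∫ x, grad Θ ψ θ₀ x ∂P‖
        ≤ ‖smean (grad Θ ψ) z θ - ∫ x, grad Θ ψ θ x ∂P‖ +
          ‖∫ x, grad Θ ψ θ x ∂P - ∫ x, grad Θ ψ θ₀ x ∂P‖ := norm_sub_le_norm_sub_add_norm_sub _ _ _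
      _ ≤ c / 2 + c / 2 := add_le_add h4.le (le_of_lt h3)
      _ = c := by ring

/-- The expected estimating function is bounded away from `0` off neighborhoods of `θ₀`. -/
theorem Regular.exists_separation (h : Regular P ψ Θ θ₀) {ρ : ℝ} (hρ : 0 < ρ) :
    ∃ ν > 0, ∀ θ ∈ Θ, ‖∫ x, ψ θ x ∂P‖ < ν → θ ∈ Metric.closedBall θ₀ ρ := by
  set s := Θ \ Metric.ball θ₀ ρ with hs
  have hsc : IsCompact s := h.cond.compact.diff Metric.isOpen_ball
  rcases s.eq_empty_or_nonempty with he | hne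
  · refine ⟨1, one_pos, fun θ hθ _ => ?_⟩
    by_contra hn
    have : θ ∈ s := ⟨hθ, fun hb => hn (Metric.ball_subset_closedBall hb)⟩
    simp [he] at this
  · obtain ⟨θ₁, h1, hmin⟩ := hsc.exists_isMinOn hne
      ((h.enveloped_zero.continuousOn_integral h.cond.compact).norm.mono Set.sdiff_subset)
    refine ⟨‖∫ x, ψ θ₁ x ∂P‖, norm_pos_iff.2 fun h0 => h1.2 ?_, fun θ hθ hlt => ?_⟩
    · rw [(h.cond.root θ₁ h1.1).1 h0]
      exact Metric.mem_ball_self hρ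
    · by_contra hn
      exact absurd (hmin ⟨hθ, fun hb => hn (Metric.ball_subset_closedBall hb)⟩) (not_le.2 hlt)

/-- The estimator is consistent and nearly linear off a rare event. -/
theorem Regular.zEstimator_local (h : Regular P ψ Θ θ₀) {A : Vec d ≃L[ℝ] Vec d}
    (hA : (A : Vec d →L[ℝ] Vec d) = ∫ x, grad Θ ψ θ₀ x ∂P)
    {T : (k : ℕ) → (Fin k → Vec p) → Vec d} (hT : IsZEstimator P ψ Θ T) {c ρ₀ : ℝ} (hc : 0 < c)
    (hρ₀ : 0 < ρ₀) :
    Negligible P fun k => {z | ¬ (‖T k z - θ₀‖ ≤ ρ₀ ∧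
      ‖T k z - θ₀ + A.symm (smean ψ z θ₀)‖ ≤ c * ‖T k z - θ₀‖)} := by
  set a := ‖(A.symm : Vec d →L[ℝ] Vec d)‖ + 1
  have ha : 0 < a := by positivity
  have haA : ‖(A.symm : Vec d →L[ℝ] Vec d)‖ ≤ a := le_add_of_nonneg_right zero_le_one
  -- The second bound gives a root near `θ₀`, the first the required precision of the linearization.
  set c₁ := min (c / a) (1 / (2 * a))
  have hc₁ : 0 < c₁ := by positivity
  have hac : a * c₁ ≤ c := by
    calc a * c₁ ≤ a * (c / a) := by gcongr; exact min_le_left _ _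
      _ = c := by field_simp
  have hac' : a * c₁ ≤ 1 / 2 := by
    calc a * c₁ ≤ a * (1 / (2 * a)) := by gcongr; exact min_le_right _ _
      _ = 1 / 2 := by field_simp
  obtain ⟨ρ, hρ, hρρ, hsub, -, hN⟩ := h.exists_nearlyLinear hc₁ hρ₀
  obtain ⟨ν, hν, hsep⟩ := h.exists_separation hρ
  have hU := h.enveloped_zero.negligible h.cond.compact (ε := min ν (ρ / (2 * a))) (by positivity)
  refine (hN.union hU).mono (by
    filter_upwards [eventually_gt_atTop 0] with k hk
    filter_upwards [hT.solves k] with z hz hbad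
    by_contra hno
    simp only [Set.mem_union, Set.mem_ofPred_eq, not_or, not_not, not_exists, not_and, not_le] at hno
    obtain ⟨hlin, hunif⟩ := hno
    rw [← hA] at hlin
    have hθ₀ : ∫ x, ψ θ₀ x ∂P = 0 := (h.cond.root θ₀ h.mem).2 rfl
    have h0 : ‖smean ψ z θ₀‖ ≤ ρ / (2 * a) := by
      have := hunif θ₀ h.mem
      rw [hθ₀, sub_zero] at this
      exact this.le.trans (min_le_right _ _)
    have hk' : (k : ℝ)⁻¹ ≠ 0 := by positivity
    -- The root found here serves only to show that the equations are solvable, so that the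
    -- estimator solves them. Its value may be another root, which the separation of the expected
    -- function then places in the ball.
    obtain ⟨θ, hθ, hroot⟩ := hlin.exists_root hρ.le hc₁.le ha haA hac' h0
    have hTroot : smean ψ z (T k z) = 0 := by
      have := hz ⟨θ, hsub hθ, (smul_eq_zero.1 hroot).resolve_left hk'⟩
      rw [smean, this, smul_zero]
    have hTball : T k z ∈ Metric.closedBall θ₀ ρ := by
      refine hsep _ (hT.mem k z) ?_
      have := hunif _ (hT.mem k z)
      change ‖smean ψ z (T k z) - _‖ < _ at this
      rw [hTroot, zero_sub, norm_neg] at this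
      exact this.trans_le (min_le_left _ _)
    refine hbad ⟨?_, ?_⟩
    · rw [← dist_eq_norm]
      exact (Metric.mem_closedBall.1 hTball).trans hρρ
    · have := hlin.linearization hTball (Metric.mem_closedBall_self hρ.le)
      rw [hTroot, map_zero, sub_zero] at this
      refine this.trans ?_
      rw [← mul_assoc]
      gcongr
      exact (mul_le_mul_of_nonneg_right haA hc₁.le).trans hac)

end Regularity

/-! ### Matrices and linear maps -/

section Matrices

variable {d p : ℕ}

/-- The matrix of a linear map. -/
def toMat (A : Vec d →L[ℝ] Vec d) : Matrix (Fin d) (Fin d) ℝ :=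
  (Matrix.toEuclideanCLM (n := Fin d) (𝕜 := ℝ)).symm A

theorem toMat_mulVec (A : Vec d →L[ℝ] Vec d) (v : Vec d) : toMat A *ᵥ v.ofLp = (A v).ofLp := by
  rw [toMat, ← Matrix.ofLp_toEuclideanCLM, StarAlgEquiv.apply_symm_apply]

theorem toMat_apply (A : Vec d →L[ℝ] Vec d) (i j : Fin d) :
    toMat A i j = A (EuclideanSpace.single j 1) i := by
  rw [← toMat_mulVec, PiLp.ofLp_single, Matrix.mulVec_single_one, Matrix.col_apply]

theorem abs_toMat_le (A : Vec d →L[ℝ] Vec d) (i j : Fin d) : |toMat A i j| ≤ ‖A‖ := by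
  rw [toMat_apply]
  refine (PiLp.norm_apply_le (A (EuclideanSpace.single j 1)) i).trans ?_
  simpa using A.le_opNorm (EuclideanSpace.single j 1)

theorem det_toMat_ne_zero {A : Vec d →L[ℝ] Vec d} : (toMat A).det ≠ 0 ↔ IsUnit A := by
  rw [← isUnit_iff_ne_zero, ← Matrix.isUnit_iff_isUnit_det, toMat]
  exact MulEquiv.isUnit_map (Matrix.toEuclideanCLM (n := Fin d) (𝕜 := ℝ)).symm

theorem toMat_inv {A : Vec d →L[ℝ] Vec d} (hA : IsUnit A) :
    (toMat A)⁻¹ = toMat (Ring.inverse A) := by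
  refine Matrix.inv_eq_right_inv ?_
  rw [toMat, toMat, ← map_mul, Ring.mul_inverse_cancel A hA, map_one]

theorem jac_eq_toMat (ψ : Vec d → Vec p → Vec d) (Θ : Set (Vec d)) (θ : Vec d) (z : Vec p) :
    jac ψ Θ θ z = toMat (grad Θ ψ θ z) := by
  ext i j
  rw [toMat_apply]
  rfl

theorem Vhat_eq_toMat {k : ℕ} (ψ : Vec d → Vec p → Vec d) (Θ : Set (Vec d)) (z : Fin k → Vec p)
    (θ : Vec d) : Vhat ψ Θ z θ = toMat (smean (grad Θ ψ) z θ) := by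
  simp only [Vhat, smean, jac_eq_toMat, toMat, map_smul, map_sum]

theorem V_eq_toMat {P : Measure (Vec p)} {ψ : Vec d → Vec p → Vec d} {Θ : Set (Vec d)} {θ : Vec d}
    (h : Integrable (grad Θ ψ θ) P) : V P ψ Θ θ = toMat (∫ x, grad Θ ψ θ x ∂P) := by
  ext i j
  have := ((EuclideanSpace.proj i : Vec d →L[ℝ] ℝ) ∘L
    ContinuousLinearMap.apply ℝ (Vec d) (EuclideanSpace.single j (1 : ℝ))).integral_comp_comm h
  rw [toMat_apply]
  exact this

/-- A linear equivalence from an invertible linear map. -/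
theorem exists_equiv_of_isUnit {A : Vec d →L[ℝ] Vec d} (hA : IsUnit A) :
    ∃ L : Vec d ≃L[ℝ] Vec d, (L : Vec d →L[ℝ] Vec d) = A ∧
      (L.symm : Vec d →L[ℝ] Vec d) = Ring.inverse A := by
  obtain ⟨u, rfl⟩ := hA
  refine ⟨ContinuousLinearEquiv.unitsEquiv ℝ (Vec d) u, rfl, ?_⟩
  rw [Ring.inverse_unit]
  rfl

end Matrices

/-! ### The influence function -/

section Influence

variable {d p : ℕ} {P : Measure (Vec p)} [IsProbabilityMeasure P] {ψ : Vec d → Vec p → Vec d}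
  {Θ : Set (Vec d)} {θ₀ : Vec d}

theorem Regular.exists_equiv (h : Regular P ψ Θ θ₀) (hV : (V P ψ Θ θ₀).det ≠ 0) :
    ∃ L : Vec d ≃L[ℝ] Vec d, (L : Vec d →L[ℝ] Vec d) = ∫ x, grad Θ ψ θ₀ x ∂P ∧
      ∀ v, (L.symm v).ofLp = (V P ψ Θ θ₀)⁻¹ *ᵥ v.ofLp := by
  have hi := h.enveloped_one.integrable h.cond.compact h.mem
  rw [V_eq_toMat hi, det_toMat_ne_zero] at hV
  obtain ⟨L, hL, hL'⟩ := exists_equiv_of_isUnit hV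
  refine ⟨L, hL, fun v => ?_⟩
  rw [V_eq_toMat hi, toMat_inv hV, ← hL', toMat_mulVec]
  rfl

/-- The influence function. -/
def influence (L : Vec d ≃L[ℝ] Vec d) (ψ : Vec d → Vec p → Vec d) (θ₀ : Vec d) (x : Vec p) : Vec d :=
  -L.symm (ψ θ₀ x)

theorem mean_influence (L : Vec d ≃L[ℝ] Vec d) {k : ℕ} (z : Fin k → Vec p) :
    (k : ℝ)⁻¹ • ∑ i, influence L ψ θ₀ (z i) = -L.symm (smean ψ z θ₀) := by
  simp only [influence, smean, Finset.sum_neg_distrib, map_smul, map_sum, smul_neg]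

theorem Regular.measurable_influence (h : Regular P ψ Θ θ₀) (L : Vec d ≃L[ℝ] Vec d) :
    Measurable (influence L ψ θ₀) :=
  (L.symm.continuous.measurable.comp (h.measurable θ₀ h.mem)).neg

theorem Regular.memLp_of_condFourth (h : Regular P ψ Θ θ₀) (h4 : CondFourth P ψ Θ θ₀ 0) :
    MemLp (ψ θ₀) 4 P := by
  refine ⟨(h.measurable θ₀ h.mem).aestronglyMeasurable, ?_⟩
  rw [eLpNorm_lt_top_iff_lintegral_rpow_enorm_lt_top (by norm_num) (by norm_num)]
  refine lt_of_le_of_lt (lintegral_mono fun z => le_of_eq ?_) h4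
  have : ‖gradPow ψ Θ 0 θ₀ z‖ₑ = ‖ψ θ₀ z‖ₑ := by
    rw [← ofReal_norm, ← ofReal_norm, norm_gradPow_zero]
  rw [this]
  norm_num

theorem Regular.memLp_influence (h : Regular P ψ Θ θ₀) (h4 : CondFourth P ψ Θ θ₀ 0)
    (L : Vec d ≃L[ℝ] Vec d) (a : Fin d) : MemLp (fun x => influence L ψ θ₀ x a) 4 P :=
  ((EuclideanSpace.proj a : Vec d →L[ℝ] ℝ) ∘L (-(L.symm : Vec d →L[ℝ] Vec d))).comp_memLp'
    (h.memLp_of_condFourth h4)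

theorem Regular.integral_influence (h : Regular P ψ Θ θ₀) (L : Vec d ≃L[ℝ] Vec d) (a : Fin d) :
    ∫ x, influence L ψ θ₀ x a ∂P = 0 := by
  have := ((EuclideanSpace.proj a : Vec d →L[ℝ] ℝ) ∘L
    (-(L.symm : Vec d →L[ℝ] Vec d))).integral_comp_comm
    (h.enveloped_zero.integrable h.cond.compact h.mem)
  rw [(h.cond.root θ₀ h.mem).2 rfl, map_zero] at this
  exact this

/-- At `θ₀` the estimating function is centred, so its covariance is the plain second moment and the
sandwich form appears by expanding `V⁻¹` in coordinates. -/
theorem Regular.integral_influence_mul (h : Regular P ψ Θ θ₀) {L : Vec d ≃L[ℝ] Vec d}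
    (hL : ∀ v, (L.symm v).ofLp = (V P ψ Θ θ₀)⁻¹ *ᵥ v.ofLp) (a b : Fin d) :
    ∫ x, influence L ψ θ₀ x a * influence L ψ θ₀ x b ∂P = Xi P ψ Θ θ₀ a b := by
  have hm : ∀ j, MemLp (fun x => ψ θ₀ x j) 2 P := fun j =>
    (EuclideanSpace.proj j : Vec d →L[ℝ] ℝ).comp_memLp' (h.enveloped_zero.memLp h.cond.compact h.mem)
  have hz : ∀ j, ∫ x, ψ θ₀ x j ∂P = 0 := fun j => by
    have := (EuclideanSpace.proj j : Vec d →L[ℝ] ℝ).integral_comp_comm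
      (h.enveloped_zero.integrable h.cond.compact h.mem)
    rw [(h.cond.root θ₀ h.mem).2 rfl, map_zero] at this
    exact this
  have hS : ∀ i j, ∫ x, ψ θ₀ x i * ψ θ₀ x j ∂P = Sig P ψ θ₀ i j := fun i j => by
    simp only [Sig, Matrix.of_apply, covariance, hz, sub_zero]
  set W := (V P ψ Θ θ₀)⁻¹
  have he : ∀ x, influence L ψ θ₀ x a * influence L ψ θ₀ x b =
      ∑ j, ∑ i, W a i * W b j * (ψ θ₀ x i * ψ θ₀ x j) := fun x => by
    have : ∀ a, influence L ψ θ₀ x a = -∑ i, W a i * ψ θ₀ x i := fun a => by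
      have := congrFun (hL (ψ θ₀ x)) a
      exact congrArg Neg.neg this
    rw [this, this, neg_mul_neg, Finset.sum_mul_sum, Finset.sum_comm]
    exact Finset.sum_congr rfl fun j _ => Finset.sum_congr rfl fun i _ => by ring
  simp_rw [he]
  have hi : ∀ i j, Integrable (fun x => W a i * W b j * (ψ θ₀ x i * ψ θ₀ x j)) P := fun i j =>
    ((hm i).integrable_mul (hm j)).const_mul _
  rw [integral_finsetSum _ fun j _ => integrable_finsetSum _ fun i _ => hi i j]
  simp only [Xi, Matrix.mul_apply, Matrix.transpose_apply, Finset.sum_mul]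
  refine Finset.sum_congr rfl fun j _ => ?_
  rw [integral_finsetSum _ fun i _ => hi i j]
  refine Finset.sum_congr rfl fun i _ => ?_
  rw [integral_const_mul, hS]
  ring

end Influence

/-! ### The settings -/

/-- If `m` stayed below a bound infinitely often, then `k m / N` would come arbitrarily close to `0`
because `k / N → 0`, against a positive limit. -/
theorem PosRatio.tendsto {k m : ℕ → ℕ} (h : PosRatio k m)
    (hkN : Tendsto (fun N => (k N : ℝ) / N) atTop (𝓝 0)) : Tendsto m atTop atTop := by
  obtain ⟨α, hα, h⟩ := h
  obtain ⟨c, hc, hcα⟩ := ENNReal.lt_iff_exists_nnreal_btwn.1 hα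
  have hc' : (0 : ℝ) < c := by exact_mod_cast hc
  refine tendsto_atTop.2 fun n => ?_
  filter_upwards [h.eventually_const_lt hcα, eventually_gt_atTop 0,
    hkN.eventually_lt_const (show (0 : ℝ) < c / (n + 1) by positivity)] with N h1 h2 h3
  by_contra hlt
  have hm : (m N : ℝ) ≤ n + 1 := by
    have : m N ≤ n + 1 := by omega
    exact_mod_cast this
  have hN : (0 : ℝ) < N := by exact_mod_cast h2
  have h4 : ((k N * m N : ℕ) : ℝ) / N ≤ c := by
    rw [lt_div_iff₀ (by positivity)] at h3
    calc ((k N * m N : ℕ) : ℝ) / N = (k N : ℝ) / N * m N := by push_cast; ring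
      _ ≤ (k N : ℝ) / N * (n + 1) := by gcongr
      _ ≤ c := h3.le
  have h5 : ((k N * m N : ℕ) : ℝ≥0∞) / N = ENNReal.ofReal (((k N * m N : ℕ) : ℝ) / N) := by
    rw [ENNReal.ofReal_div_of_pos hN, ENNReal.ofReal_natCast, ENNReal.ofReal_natCast]
  rw [h5, ← ENNReal.ofReal_coe_nnreal] at h1
  exact absurd (ENNReal.ofReal_le_ofReal h4) (not_le.2 h1)

theorem Setting.tendsto {k m : ℕ → ℕ} (h : Setting k m)
    (hkN : Tendsto (fun N => (k N : ℝ) / N) atTop (𝓝 0)) : Tendsto m atTop atTop :=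
  h.elim (fun h => h.1.tendsto hkN) fun h => h.2.1

theorem SettingBC.tendsto {k m : ℕ → ℕ} (h : SettingBC k m)
    (hkN : Tendsto (fun N => (k N : ℝ) / N) atTop (𝓝 0)) : Tendsto m atTop atTop :=
  h.elim (fun h => h.1.tendsto hkN) fun h => h.2.1

/-! ### Asymptotic linearity from a local expansion -/

section Local

variable {d p : ℕ} {P : Measure (Vec p)} [IsProbabilityMeasure P] {ψ : Vec d → Vec p → Vec d}
  {Θ : Set (Vec d)} {θ₀ : Vec d}

/-- The error is first known relative to `‖T - θ₀‖`. With a factor at most `1 / 2`, that distance is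
at most twice the linear term plus `O(1 / k)`, so the error becomes relative to the linear term. -/
theorem Regular.asympLinear (h : Regular P ψ Θ θ₀) (h4 : CondFourth P ψ Θ θ₀ 0)
    (L : Vec d ≃L[ℝ] Vec d) {T : (k : ℕ) → (Fin k → Vec p) → Vec d} {b : ℝ}
    (hb : ∀ᶠ k in atTop, ∀ z, ‖T k z - θ₀‖ ≤ b)
    (hT : ∀ c > 0, ∃ C : ℝ, Negligible P fun k => {z |
      ¬ ‖T k z - θ₀ + L.symm (smean ψ z θ₀)‖ ≤ c * ‖T k z - θ₀‖ + C / k}) :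
    AsympLinear P (influence L ψ θ₀) θ₀ T := by
  refine asympLinear_of_bound (h.measurable_influence L) (h.memLp_influence h4 L)
    (h.integral_influence L) hb fun c hc => ?_
  obtain ⟨C, hC⟩ := hT (min (1 / 2) (c / 2)) (by positivity)
  refine ⟨_, hC, C + (1 + c) * |C|, Eventually.of_forall fun k =>
    Eventually.of_forall fun z hz => ?_⟩
  simp only [Set.mem_ofPred_eq, not_not] at hz
  rw [mean_influence, sub_neg_eq_add, norm_neg]
  set u := ‖T k z - θ₀‖
  set w := ‖L.symm (smean ψ z θ₀)‖
  have h1 : u ≤ ‖T k z - θ₀ + L.symm (smean ψ z θ₀)‖ + w := by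
    have := norm_sub_le (T k z - θ₀ + L.symm (smean ψ z θ₀)) (L.symm (smean ψ z θ₀))
    rwa [add_sub_cancel_right] at this
  have hu : 0 ≤ u := norm_nonneg _
  have h2 : min (1 / 2) (c / 2) * u ≤ 1 / 2 * u := by gcongr; exact min_le_left _ _
  have h3 : min (1 / 2) (c / 2) * u ≤ c / 2 * u := by gcongr; exact min_le_right _ _
  have h5 : C / k ≤ |C| / k := by gcongr; exact le_abs_self _
  have h6 : u ≤ 2 * w + 2 * (|C| / k) := by linarith
  have h7 : c / 2 * u ≤ c / 2 * (2 * w + 2 * (|C| / k)) := by gcongr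
  have h8 : 0 ≤ |C| / k := by positivity
  have h9 : (C + (1 + c) * |C|) / k = C / k + |C| / k + c * (|C| / k) := by ring
  rw [h9]
  linarith

theorem Regular.exists_dist_le (h : Regular P ψ Θ θ₀) : ∃ b, ∀ θ ∈ Θ, ‖θ - θ₀‖ ≤ b := by
  obtain ⟨b, hb⟩ := h.cond.compact.isBounded.exists_norm_le
  exact ⟨b + ‖θ₀‖, fun θ hθ => (norm_sub_le _ _).trans (by gcongr; exact hb θ hθ)⟩

theorem Regular.asympLinear_zEstimator (h : Regular P ψ Θ θ₀) (h4 : CondFourth P ψ Θ θ₀ 0)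
    {L : Vec d ≃L[ℝ] Vec d} (hL : (L : Vec d →L[ℝ] Vec d) = ∫ x, grad Θ ψ θ₀ x ∂P)
    {T : (k : ℕ) → (Fin k → Vec p) → Vec d} (hT : IsZEstimator P ψ Θ T) :
    AsympLinear P (influence L ψ θ₀) θ₀ T := by
  obtain ⟨b, hb⟩ := h.exists_dist_le
  refine h.asympLinear h4 L (Eventually.of_forall fun k z => hb _ (hT.mem k z)) fun c hc => ⟨0, ?_⟩
  refine (h.zEstimator_local hL hT hc one_pos).mono (Eventually.of_forall fun k =>
    Eventually.of_forall fun z hz => ?_)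
  simp only [Set.mem_ofPred_eq, zero_div, add_zero] at hz ⊢
  exact fun hn => hz hn.2

end Local

/-! ### Bounded Lipschitz functions -/

section BddLip

variable {X F F' : Type*} [NormedAddCommGroup X] [NormedAddCommGroup F] [NormedSpace ℝ F]
  [NormedAddCommGroup F'] [NormedSpace ℝ F']

/-- `f` is bounded by `b` and Lipschitz with constant `b` on `s`. -/
structure BddLip (f : X → F) (s : Set X) (b : ℝ) : Prop where
  bdd : ∀ x ∈ s, ‖f x‖ ≤ b
  lip : ∀ x ∈ s, ∀ y ∈ s, ‖f x - f y‖ ≤ b * ‖x - y‖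

theorem BddLip.mono {f : X → F} {s : Set X} {b c : ℝ} (h : BddLip f s b) (hbc : b ≤ c) :
    BddLip f s c :=
  ⟨fun x hx => (h.bdd x hx).trans hbc, fun x hx y hy => (h.lip x hx y hy).trans (by gcongr)⟩

theorem BddLip.sub {f g : X → F} {s : Set X} {b c : ℝ} (hf : BddLip f s b) (hg : BddLip g s c) :
    BddLip (fun x => f x - g x) s (b + c) := by
  refine ⟨fun x hx => (norm_sub_le _ _).trans (add_le_add (hf.bdd x hx) (hg.bdd x hx)),
    fun x hx y hy => ?_⟩
  have : f x - g x - (f y - g y) = (f x - f y) - (g x - g y) := by abel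
  rw [this, add_mul]
  exact (norm_sub_le _ _).trans (add_le_add (hf.lip x hx y hy) (hg.lip x hx y hy))

theorem BddLip.smul {f : X → F} {s : Set X} {b : ℝ} (hf : BddLip f s b) {c : ℝ} (hc : 0 ≤ c) :
    BddLip (fun x => c • f x) s (c * b) := by
  refine ⟨fun x hx => ?_, fun x hx y hy => ?_⟩
  · rw [norm_smul, Real.norm_of_nonneg hc]
    exact mul_le_mul_of_nonneg_left (hf.bdd x hx) hc
  · rw [← smul_sub, norm_smul, Real.norm_of_nonneg hc, mul_assoc]
    exact mul_le_mul_of_nonneg_left (hf.lip x hx y hy) hc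

theorem BddLip.sum {ι : Type*} (t : Finset ι) {f : ι → X → F} {s : Set X} {b : ι → ℝ}
    (hf : ∀ i, BddLip (f i) s (b i)) : BddLip (fun x => ∑ i ∈ t, f i x) s (∑ i ∈ t, b i) := by
  refine ⟨fun x hx => norm_sum_le_of_le _ fun i _ => (hf i).bdd x hx, fun x hx y hy => ?_⟩
  rw [← Finset.sum_sub_distrib, Finset.sum_mul]
  exact norm_sum_le_of_le _ fun i _ => (hf i).lip x hx y hy

theorem BddLip.clm_apply {f : X → F →L[ℝ] F'} {g : X → F} {s : Set X} {b c : ℝ}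
    (hf : BddLip f s b) (hg : BddLip g s c) (hb : 0 ≤ b) (hc : 0 ≤ c) :
    BddLip (fun x => f x (g x)) s (2 * b * c) := by
  have hbc : 0 ≤ b * c := mul_nonneg hb hc
  refine ⟨fun x hx => ?_, fun x hx y hy => ?_⟩
  · calc ‖f x (g x)‖ ≤ ‖f x‖ * ‖g x‖ := (f x).le_opNorm _
      _ ≤ b * c := mul_le_mul (hf.bdd x hx) (hg.bdd x hx) (norm_nonneg _) hb
      _ ≤ 2 * b * c := by linarith
  · have : f x (g x) - f y (g y) = (f x - f y) (g x) + f y (g x - g y) := by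
      simp only [sub_apply, map_sub]; abel
    rw [this]
    calc ‖(f x - f y) (g x) + f y (g x - g y)‖
        ≤ ‖f x - f y‖ * ‖g x‖ + ‖f y‖ * ‖g x - g y‖ :=
          (norm_add_le _ _).trans (add_le_add ((f x - f y).le_opNorm _) ((f y).le_opNorm _))
      _ ≤ b * ‖x - y‖ * c + b * (c * ‖x - y‖) := by
          gcongr
          · exact hf.lip x hx y hy
          · exact hg.bdd x hx
          · exact hf.bdd y hy
          · exact hg.lip x hx y hy
      _ = 2 * b * c * ‖x - y‖ := by ring

/-- The resolvent identity `A⁻¹ - B⁻¹ = A⁻¹ (B - A) B⁻¹` gives the Lipschitz constant. -/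
theorem BddLip.ringInverse {f : X → F →L[ℝ] F} {s : Set X} {b r : ℝ} (hf : BddLip f s b)
    (hb : 0 ≤ b) (hu : ∀ x ∈ s, IsUnit (f x)) (hr : ∀ x ∈ s, ‖Ring.inverse (f x)‖ ≤ r) :
    BddLip (fun x => Ring.inverse (f x)) s (r + r * b * r) := by
  refine ⟨fun x hx => ?_, fun x hx y hy => ?_⟩
  · have hr0 : 0 ≤ r := (norm_nonneg _).trans (hr x hx)
    have : 0 ≤ r * b * r := by positivity
    linarith [hr x hx]
  · have hr0 : 0 ≤ r := (norm_nonneg _).trans (hr x hx)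
    have e : Ring.inverse (f x) - Ring.inverse (f y) =
        Ring.inverse (f x) * (f y - f x) * Ring.inverse (f y) :=
      Ring.inverse_sub_inverse ⟨fun _ => hu y hy, fun _ => hu x hx⟩
    rw [e]
    calc ‖Ring.inverse (f x) * (f y - f x) * Ring.inverse (f y)‖
        ≤ ‖Ring.inverse (f x)‖ * ‖f y - f x‖ * ‖Ring.inverse (f y)‖ :=
          (norm_mul_le _ _).trans (mul_le_mul_of_nonneg_right (norm_mul_le _ _) (norm_nonneg _))
      _ ≤ r * (b * ‖x - y‖) * r := by
          gcongr
          · exact hr x hx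
          · rw [norm_sub_rev]; exact hf.lip x hx y hy
          · exact hr y hy
      _ ≤ (r + r * b * r) * ‖x - y‖ := by
          have : 0 ≤ r * ‖x - y‖ := by positivity
          linarith

end BddLip

/-- The perturbation costs at most half of the lower bound, so `‖v‖ ≤ 2 a ‖D v‖`. This gives
injectivity, hence invertibility in finite dimension, and the bound on the inverse. -/
theorem isUnit_of_norm_sub_le {F : Type*} [NormedAddCommGroup F] [NormedSpace ℝ F]
    [FiniteDimensional ℝ F] {A D : F →L[ℝ] F} (hA : IsUnit A) {a ε : ℝ}
    (ha : ‖Ring.inverse A‖ ≤ a) (hD : ‖D - A‖ ≤ ε) (hε : a * ε ≤ 1 / 2) :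
    IsUnit D ∧ ‖Ring.inverse D‖ ≤ 2 * a := by
  have ha0 : 0 ≤ a := (norm_nonneg _).trans ha
  have hlow : ∀ v, ‖v‖ ≤ 2 * a * ‖D v‖ := fun v => by
    have e : v = Ring.inverse A (D v) - Ring.inverse A ((D - A) v) := by
      rw [← map_sub, sub_apply, sub_sub_cancel]
      exact (DFunLike.congr_fun (Ring.inverse_mul_cancel A hA) v).symm
    have h1 : ‖Ring.inverse A (D v)‖ ≤ a * ‖D v‖ :=
      ((Ring.inverse A).le_opNorm _).trans (by gcongr)
    have h2 : ‖Ring.inverse A ((D - A) v)‖ ≤ 1 / 2 * ‖v‖ := by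
      calc ‖Ring.inverse A ((D - A) v)‖ ≤ a * (ε * ‖v‖) :=
            ((Ring.inverse A).le_opNorm _).trans
              (mul_le_mul ha (((D - A).le_opNorm v).trans (by gcongr)) (norm_nonneg _) ha0)
        _ = a * ε * ‖v‖ := by ring
        _ ≤ 1 / 2 * ‖v‖ := by gcongr
    have h3 : ‖v‖ ≤ ‖Ring.inverse A (D v)‖ + ‖Ring.inverse A ((D - A) v)‖ := by
      conv_lhs => rw [e]
      exact norm_sub_le _ _
    linarith
  have hinj : Function.Injective D := by
    refine (injective_iff_map_eq_zero D).2 fun v hv => ?_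
    have := hlow v
    rw [hv, norm_zero, mul_zero] at this
    exact norm_le_zero_iff.1 this
  let e : F ≃L[ℝ] F :=
    (LinearEquiv.ofInjectiveEndo (D : F →ₗ[ℝ] F) hinj).toContinuousLinearEquiv
  have hu : IsUnit D := ⟨(ContinuousLinearEquiv.unitsEquiv ℝ F).symm e, by ext; rfl⟩
  refine ⟨hu, ContinuousLinearMap.opNorm_le_bound _ (by positivity) fun v => ?_⟩
  have := hlow (Ring.inverse D v)
  rwa [show D (Ring.inverse D v) = v from DFunLike.congr_fun (Ring.mul_inverse_cancel D hu) v] at this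

/-! ### The correction of the estimating equations -/

section Correction

variable {d p k : ℕ} {ψ : Vec d → Vec p → Vec d} {Θ : Set (Vec d)} {z : Fin k → Vec p} {θ : Vec d}

/-- The sample mean of the derivatives of the estimating function, inverted, and applied to
`ψ_θ(x)`. -/
def newtonStep (ψ : Vec d → Vec p → Vec d) (Θ : Set (Vec d)) (z : Fin k → Vec p) (x : Vec p)
    (θ : Vec d) : Vec d :=
  Ring.inverse (smean (grad Θ ψ) z θ) (ψ θ x)

/-- The correction `V̂(θ) B̂(θ)` of the estimating equations. -/
def correction (ψ : Vec d → Vec p → Vec d) (Θ : Set (Vec d)) (z : Fin k → Vec p) (θ : Vec d) :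
    Vec d :=
  (k : ℝ)⁻¹ • ∑ i, (grad Θ ψ θ (z i) - smean (grad Θ ψ) z θ) (newtonStep ψ Θ z (z i) θ) -
    (1 / 2 : ℝ) • (k : ℝ)⁻¹ • ∑ i, smean (grad Θ (grad Θ ψ)) z θ (newtonStep ψ Θ z (z i) θ)
      (newtonStep ψ Θ z (z i) θ)

/-- The index `l` belongs to the outer derivative, which is the first argument of the iterated
derivative; `j` is the column of the Jacobian and goes second. -/
theorem hess_apply {x : Vec p} (hΘ : UniqueDiffOn ℝ Θ)
    (h : ContDiffOn ℝ 3 (fun t => ψ t x) Θ) (hθ : θ ∈ Θ) (i j l : Fin d) :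
    hess ψ Θ θ x i (j, l) =
      (grad Θ (grad Θ ψ) θ x (EuclideanSpace.single l 1) (EuclideanSpace.single j 1)) i := by
  have h1 := hasFDerivWithinAt_grad (n := 1) (contDiffOn_grad hΘ (n := 2) h) hθ
  have h2 := (((EuclideanSpace.proj i : Vec d →L[ℝ] ℝ) ∘L
    ContinuousLinearMap.apply ℝ (Vec d) (EuclideanSpace.single j (1 : ℝ))).hasFDerivAt
      (x := grad Θ ψ θ x)).comp_hasFDerivWithinAt θ h1
  have h3 := h2.fderivWithin (hΘ θ hθ)
  exact DFunLike.congr_fun h3 (EuclideanSpace.single l 1)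

theorem eq_sum_single (w : Vec d) : w = ∑ l, w l • EuclideanSpace.single l (1 : ℝ) := by
  simpa using ((EuclideanSpace.basisFun (Fin d) ℝ).sum_repr w).symm

theorem norm_le_sum_abs (w : Vec d) : ‖w‖ ≤ ∑ l, |w l| := by
  conv_lhs => rw [eq_sum_single w]
  refine norm_sum_le_of_le _ fun l _ => ?_
  simp [norm_smul]

theorem bilin_apply (D : Vec d →L[ℝ] Vec d →L[ℝ] Vec d) (u v : Vec d) (i : Fin d) :
    (D u v) i = ∑ j, ∑ l,
      (D (EuclideanSpace.single l 1) (EuclideanSpace.single j 1)) i * (v j * u l) := by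
  conv_lhs => rw [eq_sum_single u, eq_sum_single v]
  simp only [map_sum, map_smul, sum_apply, smul_apply, WithLp.ofLp_sum,
    WithLp.ofLp_smul, Finset.sum_apply, Pi.smul_apply, smul_eq_mul, Finset.smul_sum]
  refine Finset.sum_congr rfl fun j _ => Finset.sum_congr rfl fun l _ => by ring

theorem V2hat_mulVec (hΘ : UniqueDiffOn ℝ Θ) (h : ∀ i, ContDiffOn ℝ 3 (fun t => ψ t (z i)) Θ)
    (hθ : θ ∈ Θ) (u : Vec d) :
    V2hat ψ Θ z θ *ᵥ kronVec u.ofLp u.ofLp = (smean (grad Θ (grad Θ ψ)) z θ u u).ofLp := by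
  ext i
  rw [bilin_apply]
  simp only [Matrix.mulVec, dotProduct, Fintype.sum_prod_type, kronVec]
  refine Finset.sum_congr rfl fun j _ => Finset.sum_congr rfl fun l _ => ?_
  congr 1
  simp only [V2hat, smean, Matrix.smul_apply, Matrix.sum_apply, hess_apply hΘ (h _) hθ, sum_apply,
    smul_apply, WithLp.ofLp_sum, WithLp.ofLp_smul, Finset.sum_apply,
    Pi.smul_apply]

/-- This translates the matrix formula into linear maps. Invertibility matters because the matrix
inverse and `Ring.inverse` are matched through it. -/
theorem toLp_Bhat (hΘ : UniqueDiffOn ℝ Θ) (h : ∀ i, ContDiffOn ℝ 3 (fun t => ψ t (z i)) Θ)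
    (hθ : θ ∈ Θ) (hu : IsUnit (smean (grad Θ ψ) z θ)) :
    WithLp.toLp 2 (Bhat ψ Θ z θ) = Ring.inverse (smean (grad Θ ψ) z θ) (correction ψ Θ z θ) := by
  have hw : ∀ i, (Vhat ψ Θ z θ)⁻¹ *ᵥ (ψ θ (z i)).ofLp = (newtonStep ψ Θ z (z i) θ).ofLp := fun i => by
    rw [Vhat_eq_toMat, toMat_inv hu, toMat_mulVec]; rfl
  have hx : ∀ i, (jac ψ Θ θ (z i) - Vhat ψ Θ z θ) *ᵥ (newtonStep ψ Θ z (z i) θ).ofLp =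
      ((grad Θ ψ θ (z i) - smean (grad Θ ψ) z θ) (newtonStep ψ Θ z (z i) θ)).ofLp := fun i => by
    rw [Vhat_eq_toMat, jac_eq_toMat, Matrix.sub_mulVec, toMat_mulVec, toMat_mulVec]; rfl
  have key : Bhat ψ Θ z θ = (Vhat ψ Θ z θ)⁻¹ *ᵥ (correction ψ Θ z θ).ofLp := by
    rw [Bhat, ← Matrix.mulVec_neg]
    congr 1
    simp only [hw, hx, Matrix.mulVec_smul, Matrix.mulVec_sum, V2hat_mulVec hΘ h hθ, correction,
      WithLp.ofLp_sub, WithLp.ofLp_sum, WithLp.ofLp_smul]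
    abel
  rw [key, Vhat_eq_toMat, toMat_inv hu, toMat_mulVec, WithLp.toLp_ofLp]

/-- Multiplying `B̂` by `V̂` cancels the inverse, so after division by `k` the corrected equations
are the averaged equations with a perturbation of size `1 / k` times the correction. -/
theorem solvesBC3_iff (hΘ : UniqueDiffOn ℝ Θ) (h : ∀ i, ContDiffOn ℝ 3 (fun t => ψ t (z i)) Θ)
    (hθ : θ ∈ Θ) (hk : 0 < k) :
    SolvesBC3 ψ Θ z θ ↔ IsUnit (smean (grad Θ ψ) z θ) ∧
      smean ψ z θ + (k : ℝ)⁻¹ • correction ψ Θ z θ = 0 := by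
  rw [SolvesBC3, Vhat_eq_toMat, det_toMat_ne_zero]
  refine and_congr_right fun hu => ?_
  have e : WithLp.toLp 2 (toMat (smean (grad Θ ψ) z θ) *ᵥ Bhat ψ Θ z θ) = correction ψ Θ z θ := by
    have := toLp_Bhat hΘ h hθ hu
    have h2 : Bhat ψ Θ z θ =
        (Ring.inverse (smean (grad Θ ψ) z θ) (correction ψ Θ z θ)).ofLp := by rw [← this]
    rw [h2, toMat_mulVec, WithLp.toLp_ofLp]
    exact DFunLike.congr_fun (Ring.mul_inverse_cancel _ hu) _
  have hk' : (k : ℝ)⁻¹ ≠ 0 := by positivity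
  rw [e, smean, ← smul_add, smul_eq_zero, or_iff_right hk']

/-- Every summand is a product of at most two sample quantities, so a mean of squares controls them
all; the linear terms are absorbed by `q ≤ 1 + q²`. Keeping that mean explicit allows different
bounds near `θ₀` and on all of `Θ`. -/
theorem correction_le {r M : ℝ} (hr : ‖Ring.inverse (smean (grad Θ ψ) z θ)‖ ≤ r)
    (h1 : ‖smean (grad Θ ψ) z θ‖ ≤ M) (h2 : ‖smean (grad Θ (grad Θ ψ)) z θ‖ ≤ M) :
    ‖correction ψ Θ z θ‖ ≤ (r * (1 + M) + M * r ^ 2) *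
      (1 + (k : ℝ)⁻¹ * ∑ i, (‖grad Θ ψ θ (z i)‖ + ‖ψ θ (z i)‖) ^ 2) := by
  have hr0 : 0 ≤ r := (norm_nonneg _).trans hr
  have hM0 : 0 ≤ M := (norm_nonneg _).trans h1
  have hstep : ∀ i, ‖newtonStep ψ Θ z (z i) θ‖ ≤ r * ‖ψ θ (z i)‖ := fun i =>
    (ContinuousLinearMap.le_opNorm _ _).trans (by gcongr)
  set q : Fin k → ℝ := fun i => ‖grad Θ ψ θ (z i)‖ + ‖ψ θ (z i)‖
  set Q := (k : ℝ)⁻¹ * ∑ i, q i ^ 2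
  have hQ : 0 ≤ Q := by positivity
  have hk1 : (k : ℝ)⁻¹ * ∑ _i : Fin k, M ≤ M := by
    rw [Finset.sum_const, Finset.card_univ, Fintype.card_fin, nsmul_eq_mul, ← mul_assoc]
    rcases Nat.eq_zero_or_pos k with hk | hk
    · simp [hk, hM0]
    · rw [inv_mul_cancel₀ (by positivity), one_mul]
  have hx : ‖(k : ℝ)⁻¹ • ∑ i, (grad Θ ψ θ (z i) - smean (grad Θ ψ) z θ)
      (newtonStep ψ Θ z (z i) θ)‖ ≤ r * ((1 + M) * Q + M) := by
    rw [norm_smul, Real.norm_of_nonneg (by positivity)]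
    calc (k : ℝ)⁻¹ * ‖∑ i, (grad Θ ψ θ (z i) - smean (grad Θ ψ) z θ) (newtonStep ψ Θ z (z i) θ)‖
        ≤ (k : ℝ)⁻¹ * ∑ i, r * ((1 + M) * q i ^ 2 + M) := by
          gcongr
          refine norm_sum_le_of_le _ fun i _ => ?_
          calc ‖(grad Θ ψ θ (z i) - smean (grad Θ ψ) z θ) (newtonStep ψ Θ z (z i) θ)‖
              ≤ (‖grad Θ ψ θ (z i)‖ + M) * (r * ‖ψ θ (z i)‖) :=
                (ContinuousLinearMap.le_opNorm _ _).trans (mul_le_mul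
                  ((norm_sub_le _ _).trans (by gcongr)) (hstep i) (norm_nonneg _) (by positivity))
            _ ≤ (q i + M) * (r * q i) := by
                gcongr
                · exact le_add_of_nonneg_right (norm_nonneg _)
                · exact le_add_of_nonneg_left (norm_nonneg _)
            _ = r * (q i ^ 2 + M * q i) := by ring
            _ ≤ r * ((1 + M) * q i ^ 2 + M) := by
                refine mul_le_mul_of_nonneg_left ?_ hr0
                have : q i ≤ 1 + q i ^ 2 := by nlinarith [sq_nonneg (q i - 1), sq_nonneg (q i)]
                linarith [mul_le_mul_of_nonneg_left this hM0]
      _ = r * ((1 + M) * Q + (k : ℝ)⁻¹ * ∑ _i : Fin k, M) := by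
          rw [← Finset.mul_sum, Finset.sum_add_distrib, ← Finset.mul_sum]; ring
      _ ≤ r * ((1 + M) * Q + M) := by gcongr
  have hy : ‖(k : ℝ)⁻¹ • ∑ i, smean (grad Θ (grad Θ ψ)) z θ (newtonStep ψ Θ z (z i) θ)
      (newtonStep ψ Θ z (z i) θ)‖ ≤ M * r ^ 2 * Q := by
    rw [norm_smul, Real.norm_of_nonneg (by positivity)]
    calc (k : ℝ)⁻¹ * ‖∑ i, smean (grad Θ (grad Θ ψ)) z θ (newtonStep ψ Θ z (z i) θ)
          (newtonStep ψ Θ z (z i) θ)‖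
        ≤ (k : ℝ)⁻¹ * ∑ i, M * r ^ 2 * q i ^ 2 := by
          gcongr
          refine norm_sum_le_of_le _ fun i _ => ?_
          calc ‖smean (grad Θ (grad Θ ψ)) z θ (newtonStep ψ Θ z (z i) θ)
                (newtonStep ψ Θ z (z i) θ)‖
              ≤ M * (r * ‖ψ θ (z i)‖) * (r * ‖ψ θ (z i)‖) :=
                (ContinuousLinearMap.le_opNorm₂ _ _ _).trans (by gcongr <;> exact hstep i)
            _ ≤ M * (r * q i) * (r * q i) := by
                gcongr <;> exact le_add_of_nonneg_left (norm_nonneg _)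
            _ = M * r ^ 2 * q i ^ 2 := by ring
      _ = M * r ^ 2 * Q := by rw [← Finset.mul_sum]; ring
  have hy' : ‖(1 / 2 : ℝ) • (k : ℝ)⁻¹ • ∑ i, smean (grad Θ (grad Θ ψ)) z θ
      (newtonStep ψ Θ z (z i) θ) (newtonStep ψ Θ z (z i) θ)‖ ≤ 1 / 2 * (M * r ^ 2 * Q) := by
    rw [norm_smul, Real.norm_of_nonneg (by norm_num)]
    gcongr
  have h3 : 0 ≤ M * r ^ 2 * Q := by positivity
  have h4 : 0 ≤ r + M * r ^ 2 := by positivity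
  calc ‖correction ψ Θ z θ‖ ≤ r * ((1 + M) * Q + M) + 1 / 2 * (M * r ^ 2 * Q) :=
        (norm_sub_le _ _).trans (add_le_add hx hy')
    _ ≤ (r * (1 + M) + M * r ^ 2) * (1 + Q) := by linarith

/-- Bounded Lipschitz functions are stable under sums, evaluation and inversion. Constants of
individual summands are quadratic in `e i`, and only their sample mean enters the result. -/
theorem bddLip_correction {s : Set (Vec d)} {e : Fin k → ℝ} {r M : ℝ} (he : ∀ i, 0 ≤ e i)
    (hr0 : 0 ≤ r) (hM0 : 0 ≤ M) (hM : (k : ℝ)⁻¹ * ∑ i, e i ≤ M)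
    (h0 : ∀ i, BddLip (fun t => ψ t (z i)) s (e i))
    (h1 : ∀ i, BddLip (fun t => grad Θ ψ t (z i)) s (e i))
    (h2 : ∀ i, BddLip (fun t => grad Θ (grad Θ ψ) t (z i)) s (e i))
    (hu : ∀ θ ∈ s, IsUnit (smean (grad Θ ψ) z θ))
    (hr : ∀ θ ∈ s, ‖Ring.inverse (smean (grad Θ ψ) z θ)‖ ≤ r) :
    BddLip (correction ψ Θ z) s
      (4 * (r + r * M * r) * ((k : ℝ)⁻¹ * ∑ i, e i ^ 2 + M ^ 2) +
        8 * M * (r + r * M * r) ^ 2 * ((k : ℝ)⁻¹ * ∑ i, e i ^ 2)) := by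
  have hkinv : (0 : ℝ) ≤ (k : ℝ)⁻¹ := by positivity
  have hD : BddLip (smean (grad Θ ψ) z) s M := ((BddLip.sum Finset.univ h1).smul hkinv).mono hM
  have hD2 : BddLip (smean (grad Θ (grad Θ ψ)) z) s M :=
    ((BddLip.sum Finset.univ h2).smul hkinv).mono hM
  have hR := hD.ringInverse hM0 hu hr
  set r' := r + r * M * r
  have hr' : 0 ≤ r' := by positivity
  have hw : ∀ i, BddLip (newtonStep ψ Θ z (z i)) s (2 * r' * e i) := fun i =>
    hR.clm_apply (h0 i) hr' (he i)
  have hw0 : ∀ i, 0 ≤ 2 * r' * e i := fun i => by have := he i; positivity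
  have hx : ∀ i, BddLip (fun θ => (grad Θ ψ θ (z i) - smean (grad Θ ψ) z θ)
      (newtonStep ψ Θ z (z i) θ)) s (4 * r' * (e i ^ 2 + M * e i)) := fun i =>
    (((h1 i).sub hD).clm_apply (hw i) (by have := he i; positivity) (hw0 i)).mono (by
      apply le_of_eq; ring)
  have hy : ∀ i, BddLip (fun θ => smean (grad Θ (grad Θ ψ)) z θ (newtonStep ψ Θ z (z i) θ)
      (newtonStep ψ Θ z (z i) θ)) s (16 * M * r' ^ 2 * e i ^ 2) := fun i =>
    (((hD2.clm_apply (hw i) hM0 (hw0 i))).clm_apply (hw i) (by have := hw0 i; positivity)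
      (hw0 i)).mono (by apply le_of_eq; ring)
  refine (((BddLip.sum Finset.univ hx).smul hkinv).sub
    (((BddLip.sum Finset.univ hy).smul hkinv).smul (by norm_num : (0 : ℝ) ≤ 1 / 2))).mono ?_
  rw [← Finset.mul_sum, ← Finset.mul_sum, Finset.sum_add_distrib, ← Finset.mul_sum]
  have : 4 * r' * (M * ((k : ℝ)⁻¹ * ∑ i, e i)) ≤ 4 * r' * (M * M) := by gcongr
  linarith

end Correction

/-! ### Good samples -/

section Good

variable {d p : ℕ} {P : Measure (Vec p)} {ψ : Vec d → Vec p → Vec d} {Θ : Set (Vec d)}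
  {θ₀ : Vec d} {e : Vec p → ℝ}

/-- The samples for which the estimating equations and their corrections are under control. -/
structure GoodSample (P : Measure (Vec p)) (ψ : Vec d → Vec p → Vec d) (Θ : Set (Vec d))
    (θ₀ : Vec d) (e : Vec p → ℝ) (M ρ c ε η : ℝ) {k : ℕ} (z : Fin k → Vec p) : Prop where
  smooth : ∀ i, SmoothPoint ψ Θ (e (z i)) (z i)
  linear : NearlyLinear (smean ψ z) (∫ x, grad Θ ψ θ₀ x ∂P) (Metric.closedBall θ₀ ρ) c
  zero : ∀ θ ∈ Θ, ‖smean ψ z θ - ∫ x, ψ θ x ∂P‖ ≤ ε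
  one : ∀ θ ∈ Θ, ‖smean (grad Θ ψ) z θ - ∫ x, grad Θ ψ θ x ∂P‖ ≤ ε
  mean : (k : ℝ)⁻¹ * ∑ i, e (z i) ≤ M
  second : (k : ℝ)⁻¹ * ∑ i, (‖grad Θ ψ θ₀ (z i)‖ + ‖ψ θ₀ (z i)‖) ^ 2 ≤ M
  max : ∀ i, e (z i) ≤ η * k

variable {k : ℕ} {z : Fin k → Vec p} {M ρ c ε η : ℝ}

theorem SmoothPoint.bddLip {x : Vec p} {b : ℝ} (h : SmoothPoint ψ Θ b x) (hΘ : UniqueDiffOn ℝ Θ)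
    {s : Set (Vec d)} (hs : Convex ℝ s) (hsΘ : s ⊆ Θ) :
    BddLip (fun t => ψ t x) s b ∧ BddLip (fun t => grad Θ ψ t x) s b ∧
      BddLip (fun t => grad Θ (grad Θ ψ) t x) s b := by
  have c1 := contDiffOn_grad hΘ (n := 2) h.smooth
  have c2 := contDiffOn_grad hΘ (n := 1) c1
  exact ⟨⟨fun θ hθ => h.zero θ (hsΘ hθ), fun _ hx _ hy =>
      norm_sub_le_of_grad (n := 2) h.smooth hs hsΘ (fun θ hθ => h.one θ (hsΘ hθ)) hx hy⟩,
    ⟨fun θ hθ => h.one θ (hsΘ hθ), fun _ hx _ hy =>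
      norm_sub_le_of_grad (n := 1) c1 hs hsΘ (fun θ hθ => h.two θ (hsΘ hθ)) hx hy⟩,
    ⟨fun θ hθ => h.two θ (hsΘ hθ), fun _ hx _ hy =>
      norm_sub_le_of_grad (n := 0) c2 hs hsΘ (fun θ hθ => h.three θ (hsΘ hθ)) hx hy⟩⟩

theorem norm_smean_le {F : Type*} [NormedAddCommGroup F] [NormedSpace ℝ F] {g : Vec d → Vec p → F}
    {θ : Vec d} {b : Fin k → ℝ} (h : ∀ i, ‖g θ (z i)‖ ≤ b i) :
    ‖smean g z θ‖ ≤ (k : ℝ)⁻¹ * ∑ i, b i := by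
  rw [smean, norm_smul, Real.norm_of_nonneg (by positivity)]
  gcongr
  exact norm_sum_le_of_le _ fun i _ => h i

/-- With only second moments of `e`, the mean of `e²` need not be bounded with probability `1 - o(1
/ k)`. Trading one factor `e` for its maximum `η k` is enough, since this mean is always divided by
`k` later. -/
theorem GoodSample.sq_mean_le (h : GoodSample P ψ Θ θ₀ e M ρ c ε η z) (he : ∀ x, 0 ≤ e x)
    (hη : 0 ≤ η) : (k : ℝ)⁻¹ * ∑ i, e (z i) ^ 2 ≤ η * k * M := by
  calc (k : ℝ)⁻¹ * ∑ i, e (z i) ^ 2 ≤ (k : ℝ)⁻¹ * ∑ i, η * k * e (z i) := by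
        gcongr with i
        rw [sq]
        exact mul_le_mul_of_nonneg_right (h.max i) (he _)
    _ = η * k * ((k : ℝ)⁻¹ * ∑ i, e (z i)) := by rw [← Finset.mul_sum]; ring
    _ ≤ η * k * M := by gcongr; exact h.mean

/-- The factor in the bounds of the correction. -/
def correctionFactor (r M : ℝ) : ℝ := r * (1 + M) + M * r ^ 2

theorem GoodSample.correction_le_of (h : GoodSample P ψ Θ θ₀ e M ρ c ε η z) {θ : Vec d}
    (hθ : θ ∈ Θ) {r Q : ℝ} (hr : ‖Ring.inverse (smean (grad Θ ψ) z θ)‖ ≤ r) (hM : 0 ≤ M)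
    (hQ : (k : ℝ)⁻¹ * ∑ i, (‖grad Θ ψ θ (z i)‖ + ‖ψ θ (z i)‖) ^ 2 ≤ Q) :
    ‖correction ψ Θ z θ‖ ≤ correctionFactor r M * (1 + Q) := by
  have hr0 : 0 ≤ r := (norm_nonneg _).trans hr
  refine (correction_le hr ((norm_smean_le fun i => (h.smooth i).one θ hθ).trans h.mean)
    ((norm_smean_le fun i => (h.smooth i).two θ hθ).trans h.mean)).trans ?_
  rw [correctionFactor]
  gcongr

/-- The bound of the correction on the whole parameter space. -/
theorem GoodSample.correction_le (h : GoodSample P ψ Θ θ₀ e M ρ c ε η z) (he : ∀ x, 0 ≤ e x)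
    (hη : 0 ≤ η) (hM : 0 ≤ M) {θ : Vec d} (hθ : θ ∈ Θ) {r : ℝ}
    (hr : ‖Ring.inverse (smean (grad Θ ψ) z θ)‖ ≤ r) :
    ‖correction ψ Θ z θ‖ ≤ correctionFactor r M * (1 + 4 * (η * k * M)) := by
  refine h.correction_le_of hθ hr hM ?_
  calc (k : ℝ)⁻¹ * ∑ i, (‖grad Θ ψ θ (z i)‖ + ‖ψ θ (z i)‖) ^ 2
      ≤ (k : ℝ)⁻¹ * ∑ i, 4 * e (z i) ^ 2 := by
        gcongr with i
        calc (‖grad Θ ψ θ (z i)‖ + ‖ψ θ (z i)‖) ^ 2 ≤ (e (z i) + e (z i)) ^ 2 := by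
              gcongr
              · exact (h.smooth i).one θ hθ
              · exact (h.smooth i).zero θ hθ
          _ = 4 * e (z i) ^ 2 := by ring
    _ = 4 * ((k : ℝ)⁻¹ * ∑ i, e (z i) ^ 2) := by rw [← Finset.mul_sum]; ring
    _ ≤ 4 * (η * k * M) := mul_le_mul_of_nonneg_left (h.sq_mean_le he hη) (by norm_num)

/-- The bound of the correction near the true parameter. -/
theorem GoodSample.correction_le_near (h : GoodSample P ψ Θ θ₀ e M ρ c ε η z)
    (hΘ : UniqueDiffOn ℝ Θ) (he : ∀ x, 0 ≤ e x) (hη : 0 ≤ η) (hM : 0 ≤ M) (hρ : 0 ≤ ρ)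
    (hρ1 : ρ ≤ 1) (hball : Metric.closedBall θ₀ ρ ⊆ Θ) {θ : Vec d}
    (hθ : θ ∈ Metric.closedBall θ₀ ρ) {r : ℝ}
    (hr : ‖Ring.inverse (smean (grad Θ ψ) z θ)‖ ≤ r) :
    ‖correction ψ Θ z θ‖ ≤
      correctionFactor r M * (1 + 2 * M + 8 * M * η * k * ‖θ - θ₀‖) := by
  rw [add_assoc]
  refine h.correction_le_of (hball hθ) hr hM ?_
  have hu : ‖θ - θ₀‖ ≤ 1 := by
    rw [← dist_eq_norm]; exact (Metric.mem_closedBall.1 hθ).trans hρ1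
  have hθ₀ : θ₀ ∈ Metric.closedBall θ₀ ρ := Metric.mem_closedBall_self hρ
  calc (k : ℝ)⁻¹ * ∑ i, (‖grad Θ ψ θ (z i)‖ + ‖ψ θ (z i)‖) ^ 2
      ≤ (k : ℝ)⁻¹ * ∑ i, (2 * (‖grad Θ ψ θ₀ (z i)‖ + ‖ψ θ₀ (z i)‖) ^ 2 +
          8 * ‖θ - θ₀‖ * e (z i) ^ 2) := by
        gcongr with i
        obtain ⟨b0, b1, -⟩ := (h.smooth i).bddLip hΘ (convex_closedBall θ₀ ρ) hball
        have h1 : ‖grad Θ ψ θ (z i)‖ + ‖ψ θ (z i)‖ ≤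
            (‖grad Θ ψ θ₀ (z i)‖ + ‖ψ θ₀ (z i)‖) + 2 * (e (z i) * ‖θ - θ₀‖) := by
          have a0 := norm_le_norm_add_norm_sub' (ψ θ (z i)) (ψ θ₀ (z i))
          have a1 := norm_le_norm_add_norm_sub' (grad Θ ψ θ (z i)) (grad Θ ψ θ₀ (z i))
          have c0 := b0.lip θ hθ θ₀ hθ₀
          have c1 := b1.lip θ hθ θ₀ hθ₀
          linarith
        -- Because `ρ ≤ 1`, the square is weakened to a linear term, the form that can be absorbed
        -- into the distance of the estimator from `θ₀`.
        have h2 : ‖θ - θ₀‖ ^ 2 ≤ ‖θ - θ₀‖ := by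
          rw [sq]; exact mul_le_of_le_one_left (norm_nonneg _) hu
        calc (‖grad Θ ψ θ (z i)‖ + ‖ψ θ (z i)‖) ^ 2
            ≤ ((‖grad Θ ψ θ₀ (z i)‖ + ‖ψ θ₀ (z i)‖) + 2 * (e (z i) * ‖θ - θ₀‖)) ^ 2 := by gcongr
          _ ≤ 2 * (‖grad Θ ψ θ₀ (z i)‖ + ‖ψ θ₀ (z i)‖) ^ 2 +
              2 * (2 * (e (z i) * ‖θ - θ₀‖)) ^ 2 := by
                rw [← mul_add]; exact add_sq_le
          _ = 2 * (‖grad Θ ψ θ₀ (z i)‖ + ‖ψ θ₀ (z i)‖) ^ 2 +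
              8 * ‖θ - θ₀‖ ^ 2 * e (z i) ^ 2 := by ring
          _ ≤ _ := by gcongr
    _ = 2 * ((k : ℝ)⁻¹ * ∑ i, (‖grad Θ ψ θ₀ (z i)‖ + ‖ψ θ₀ (z i)‖) ^ 2) +
          8 * ‖θ - θ₀‖ * ((k : ℝ)⁻¹ * ∑ i, e (z i) ^ 2) := by
        rw [Finset.sum_add_distrib, ← Finset.mul_sum, ← Finset.mul_sum]; ring
    _ ≤ 2 * M + 8 * ‖θ - θ₀‖ * (η * k * M) :=
        add_le_add (mul_le_mul_of_nonneg_left h.second (by norm_num))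
          (mul_le_mul_of_nonneg_left (h.sq_mean_le he hη) (by positivity))
    _ = 2 * M + 8 * M * η * k * ‖θ - θ₀‖ := by ring

/-- The Lipschitz bound of the correction near the true parameter. -/
theorem GoodSample.correction_lip (h : GoodSample P ψ Θ θ₀ e M ρ c ε η z)
    (hΘ : UniqueDiffOn ℝ Θ) (he : ∀ x, 0 ≤ e x) (hη : 0 ≤ η) (hM : 0 ≤ M)
    (hball : Metric.closedBall θ₀ ρ ⊆ Θ) {r : ℝ} (hr0 : 0 ≤ r)
    (hu : ∀ θ ∈ Metric.closedBall θ₀ ρ, IsUnit (smean (grad Θ ψ) z θ))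
    (hr : ∀ θ ∈ Metric.closedBall θ₀ ρ, ‖Ring.inverse (smean (grad Θ ψ) z θ)‖ ≤ r) :
    BddLip (correction ψ Θ z) (Metric.closedBall θ₀ ρ)
      (4 * (r + r * M * r) * (η * k * M + M ^ 2) + 8 * M * (r + r * M * r) ^ 2 * (η * k * M)) := by
  have hb := fun i => (h.smooth i).bddLip hΘ (convex_closedBall θ₀ ρ) hball
  have := h.sq_mean_le he hη
  refine (bddLip_correction (fun i => he (z i)) hr0 hM h.mean (fun i => (hb i).1)
    (fun i => (hb i).2.1) (fun i => (hb i).2.2) hu hr).mono ?_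
  gcongr

variable [IsProbabilityMeasure P]

/-- Fourth moments at `θ₀` make this square integrable, so its sample mean is bounded off a rare
event. Without this, the correction at `θ₀` would not be of order one. -/
theorem Regular.memLp_second (h : Regular P ψ Θ θ₀) (h0 : CondFourth P ψ Θ θ₀ 0)
    (h1 : CondFourth P ψ Θ θ₀ 1) :
    MemLp (fun x => (‖grad Θ ψ θ₀ x‖ + ‖ψ θ₀ x‖) ^ 2) 2 P := by
  have m1 : MemLp (grad Θ ψ θ₀) 4 P := by
    refine ⟨h.enveloped_one.measurable θ₀ h.mem, ?_⟩
    rw [eLpNorm_lt_top_iff_lintegral_rpow_enorm_lt_top (by norm_num) (by norm_num)]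
    refine lt_of_le_of_lt (lintegral_mono fun z => le_of_eq ?_) h1
    have : ‖gradPow ψ Θ 1 θ₀ z‖ₑ = ‖grad Θ ψ θ₀ z‖ₑ := by
      rw [← ofReal_norm, ← ofReal_norm, norm_gradPow_one h.uniqueDiff h.mem]
    rw [this]
    norm_num
  have m : MemLp (fun x => ‖grad Θ ψ θ₀ x‖ + ‖ψ θ₀ x‖) 4 P :=
    m1.norm.add (h.memLp_of_condFourth h0).norm
  have : ENNReal.HolderTriple 4 4 2 := ⟨by
    rw [← ENNReal.toReal_eq_toReal_iff' (by simp) (by simp)]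
    rw [ENNReal.toReal_add (by simp) (by simp)]
    norm_num⟩
  simp_rw [sq]
  exact MemLp.mul (p := 4) (q := 4) (r := 2) m m

/-- Samples are good, off a rare event. -/
theorem Regular.negligible_not_good (h : Regular P ψ Θ θ₀) (h0 : CondFourth P ψ Θ θ₀ 0)
    (h1 : CondFourth P ψ Θ θ₀ 1) :
    ∃ e : Vec p → ℝ, (∀ x, 0 ≤ e x) ∧ ∃ M, 0 ≤ M ∧ ∀ c > 0, ∀ ρ₀ > 0, ∃ ρ, 0 < ρ ∧ ρ ≤ ρ₀ ∧
      Metric.closedBall θ₀ ρ ⊆ Θ ∧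
      (∀ θ ∈ Metric.closedBall θ₀ ρ, ‖∫ x, grad Θ ψ θ x ∂P - ∫ x, grad Θ ψ θ₀ x ∂P‖ ≤ c) ∧
      ∀ ε > 0, ∀ η > 0, Negligible P fun k => {z : Fin k → Vec p |
        ¬ GoodSample P ψ Θ θ₀ e M ρ c ε η z} := by
  obtain ⟨e, he, he0, hsm⟩ := h.exists_envelope
  have hq := h.memLp_second h0 h1
  set q : Vec p → ℝ := fun x => (‖grad Θ ψ θ₀ x‖ + ‖ψ θ₀ x‖) ^ 2
  -- `M` is fixed before `c` and `ρ`, and these before `ε` and `η`, so `η` can later be chosen small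
  -- against constants built from all of them.
  refine ⟨e, he0, max (∫ x, e x ∂P + 1) (∫ x, q x ∂P + 1), ?_, fun c hc ρ₀ hρ₀ => ?_⟩
  · exact le_max_of_le_left (add_nonneg (integral_nonneg he0) zero_le_one)
  obtain ⟨ρ, hρ, hρρ, hball, hgrad, hN⟩ := h.exists_nearlyLinear hc hρ₀
  refine ⟨ρ, hρ, hρρ, hball, hgrad, fun ε hε η hη => ?_⟩
  refine (((((hN.union (h.enveloped_zero.negligible h.cond.compact hε)).union
    (h.enveloped_one.negligible h.cond.compact hε)).union (negligible_mean_large he)).union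
    (negligible_mean_large hq)).union (negligible_max_large he hη)).mono
    (Eventually.of_forall fun k => ?_)
  filter_upwards [ae_pi_forall hsm k] with z hz hbad
  by_contra hno
  simp only [Set.mem_union, Set.mem_ofPred_eq, not_or, not_not, not_exists, not_and, not_le,
    not_lt] at hno
  obtain ⟨⟨⟨⟨⟨a1, a2⟩, a3⟩, a4⟩, a5⟩, a6⟩ := hno
  exact hbad ⟨hz, a1, fun θ hθ => (a2 θ hθ).le, fun θ hθ => (a3 θ hθ).le,
    a4.le.trans (le_max_left _ _), a5.le.trans (le_max_right _ _),
    fun i => (le_abs_self _).trans (a6 i)⟩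

end Good

/-! ### Corrections applied to the estimator -/

section Corrected

variable {d p : ℕ} {P : Measure (Vec p)} [IsProbabilityMeasure P] {ψ : Vec d → Vec p → Vec d}
  {Θ : Set (Vec d)} {θ₀ : Vec d}

/-- Corrections of smaller order preserve asymptotic linearity. -/
theorem Regular.asympLinear_of_correction (h : Regular P ψ Θ θ₀) (h4 : CondFourth P ψ Θ θ₀ 0)
    {L : Vec d ≃L[ℝ] Vec d} (hL : (L : Vec d →L[ℝ] Vec d) = ∫ x, grad Θ ψ θ₀ x ∂P)
    {U T : (k : ℕ) → (Fin k → Vec p) → Vec d} (hU : IsZEstimator P ψ Θ U) {b : ℝ}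
    (hb : ∀ᶠ k in atTop, ∀ z, ‖T k z - θ₀‖ ≤ b)
    (hT : ∀ c > 0, ∃ C : ℝ, Negligible P fun k => {z |
      ¬ ‖T k z - U k z‖ ≤ c * ‖U k z - θ₀‖ + C / k}) :
    AsympLinear P (influence L ψ θ₀) θ₀ T := by
  refine h.asympLinear h4 L hb fun c hc => ?_
  -- The `1 / 2` bounds the distance of `U` from `θ₀` by twice that of `T`, up to `O(1 / k)`. The
  -- two errors, each with factor `c / 4`, then add up to `c` times the distance of `T`.
  obtain ⟨C, hC⟩ := hT (min (1 / 2) (c / 4)) (by positivity)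
  refine ⟨(1 + c) * |C|, (hC.union (h.zEstimator_local hL hU (c := c / 4) (by positivity)
    one_pos)).mono (Eventually.of_forall fun k => Eventually.of_forall fun z hz => ?_)⟩
  by_contra hno
  simp only [Set.mem_union, Set.mem_ofPred_eq, not_or, not_not] at hno
  refine hz ?_
  obtain ⟨h1, -, h2⟩ := hno
  set u := ‖U k z - θ₀‖
  set t := ‖T k z - θ₀‖
  have hu : 0 ≤ u := norm_nonneg _
  have h3 : min (1 / 2) (c / 4) * u ≤ 1 / 2 * u := by gcongr; exact min_le_left _ _
  have h5 : min (1 / 2) (c / 4) * u ≤ c / 4 * u := by gcongr; exact min_le_right _ _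
  have h6 : C / k ≤ |C| / k := by gcongr; exact le_abs_self _
  have h7 : u ≤ t + ‖T k z - U k z‖ := by
    have := norm_sub_le (T k z - θ₀) (T k z - U k z)
    rwa [sub_sub_sub_cancel_left] at this
  have h8 : u ≤ 2 * t + 2 * (|C| / k) := by linarith
  have h9 : c / 2 * u ≤ c / 2 * (2 * t + 2 * (|C| / k)) := by gcongr
  have h10 : ‖T k z - θ₀ + L.symm (smean ψ z θ₀)‖ ≤
      ‖T k z - U k z‖ + ‖U k z - θ₀ + L.symm (smean ψ z θ₀)‖ := by
    have := norm_add_le (T k z - U k z) (U k z - θ₀ + L.symm (smean ψ z θ₀))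
    rwa [← add_assoc, sub_add_sub_cancel] at this
  have h11 : (1 + c) * |C| / k = |C| / k + c * (|C| / k) := by ring
  rw [h11]
  linarith

/-! ### The population correction -/

/-- Real functions that are bounded on a set. -/
def BddFunOn (f : Vec d → ℝ) (Θ : Set (Vec d)) : Prop := ∃ C, ∀ θ ∈ Θ, |f θ| ≤ C

theorem BddFunOn.mul {f g : Vec d → ℝ} (hf : BddFunOn f Θ) (hg : BddFunOn g Θ) :
    BddFunOn (fun θ => f θ * g θ) Θ := by
  obtain ⟨C, hC⟩ := hf
  obtain ⟨C', hC'⟩ := hg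
  refine ⟨C * C', fun θ hθ => ?_⟩
  rw [abs_mul]
  exact mul_le_mul (hC θ hθ) (hC' θ hθ) (abs_nonneg _) ((abs_nonneg _).trans (hC θ hθ))

theorem BddFunOn.add {f g : Vec d → ℝ} (hf : BddFunOn f Θ) (hg : BddFunOn g Θ) :
    BddFunOn (fun θ => f θ + g θ) Θ := by
  obtain ⟨C, hC⟩ := hf
  obtain ⟨C', hC'⟩ := hg
  exact ⟨C + C', fun θ hθ => (abs_add_le _ _).trans (add_le_add (hC θ hθ) (hC' θ hθ))⟩

theorem BddFunOn.neg {f : Vec d → ℝ} (hf : BddFunOn f Θ) : BddFunOn (fun θ => -f θ) Θ := by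
  obtain ⟨C, hC⟩ := hf
  exact ⟨C, fun θ hθ => by rw [abs_neg]; exact hC θ hθ⟩

theorem BddFunOn.const (c : ℝ) : BddFunOn (fun _ => c) Θ := ⟨|c|, fun _ _ => le_rfl⟩

theorem BddFunOn.sum {ι : Type*} [Fintype ι] {f : ι → Vec d → ℝ} (hf : ∀ i, BddFunOn (f i) Θ) :
    BddFunOn (fun θ => ∑ i, f i θ) Θ := by
  choose C hC using hf
  exact ⟨∑ i, C i, fun θ hθ => (Finset.abs_sum_le_sum_abs _ _).trans
    (Finset.sum_le_sum fun i _ => hC i θ hθ)⟩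

theorem BddFunOn.mulVec {ι κ : Type*} [Fintype κ] {M : Vec d → Matrix ι κ ℝ} {v : Vec d → κ → ℝ}
    (hM : ∀ i j, BddFunOn (fun θ => M θ i j) Θ) (hv : ∀ j, BddFunOn (fun θ => v θ j) Θ) (i : ι) :
    BddFunOn (fun θ => (M θ *ᵥ v θ) i) Θ :=
  BddFunOn.sum fun j => (hM i j).mul (hv j)

theorem BddFunOn.integral {f : Vec d → Vec p → ℝ} {e : Vec p → ℝ} (he : Integrable e P)
    (h : ∀ᵐ x ∂P, ∀ θ ∈ Θ, |f θ x| ≤ e x) : BddFunOn (fun θ => ∫ x, f θ x ∂P) Θ :=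
  ⟨∫ x, e x ∂P, fun θ hθ => norm_integral_le_of_norm_le (f := f θ) he
    (h.mono fun _ hx => hx θ hθ)⟩

/-- The inverse of the expected derivative is bounded on the parameter space. -/
theorem Regular.exists_inverse_bound (h : Regular P ψ Θ θ₀)
    (hV : ∀ θ ∈ Θ, (V P ψ Θ θ).det ≠ 0) :
    ∃ a, ∀ θ ∈ Θ, IsUnit (∫ x, grad Θ ψ θ x ∂P) ∧ ‖Ring.inverse (∫ x, grad Θ ψ θ x ∂P)‖ ≤ a := by
  have hu : ∀ θ ∈ Θ, IsUnit (∫ x, grad Θ ψ θ x ∂P) := fun θ hθ => by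
    rw [← det_toMat_ne_zero, ← V_eq_toMat (h.enveloped_one.integrable h.cond.compact hθ)]
    exact hV θ hθ
  have hc : ContinuousOn (fun θ => Ring.inverse (∫ x, grad Θ ψ θ x ∂P)) Θ := fun θ hθ => by
    obtain ⟨w, hw⟩ := hu θ hθ
    have := NormedRing.inverse_continuousAt w
    rw [hw] at this
    exact this.comp_continuousWithinAt (f := fun θ => ∫ x, grad Θ ψ θ x ∂P)
      (h.enveloped_one.continuousOn_integral h.cond.compact θ hθ)
  obtain ⟨a, ha⟩ := h.cond.compact.exists_bound_of_continuousOn hc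
  exact ⟨a, fun θ hθ => ⟨hu θ hθ, ha θ hθ⟩⟩

/-- `B` is polynomial in entries of `V⁻¹`, bounded by compactness, and in integrals dominated by an
integrable `e` or `e²`. Boundedness is all that is needed, so continuity of `B` is not studied. -/
theorem Regular.exists_B_bound (h : Regular P ψ Θ θ₀) (hV : ∀ θ ∈ Θ, (V P ψ Θ θ).det ≠ 0) :
    ∃ b, ∀ θ ∈ Θ, ‖WithLp.toLp 2 (B P ψ Θ θ)‖ ≤ b := by
  obtain ⟨a, ha⟩ := h.exists_inverse_bound hV
  obtain ⟨e, he, he0, hsm⟩ := h.exists_envelope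
  have hei : Integrable e P := he.integrable (by norm_num)
  have hee : Integrable (fun x => e x * e x) P := he.integrable_mul he
  have hcoord : ∀ (v : Vec d) i, |v i| ≤ ‖v‖ := fun v i => PiLp.norm_apply_le v i
  have bVi : ∀ i j, BddFunOn (fun θ => (V P ψ Θ θ)⁻¹ i j) Θ := fun i j => ⟨a, fun θ hθ => by
    beta_reduce
    rw [V_eq_toMat (h.enveloped_one.integrable h.cond.compact hθ), toMat_inv (ha θ hθ).1]
    exact (abs_toMat_le _ i j).trans (ha θ hθ).2⟩
  have bH : ∀ i j, BddFunOn (fun θ => H P ψ Θ θ i j) Θ := fun i j => by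
    refine BddFunOn.integral hee (hsm.mono fun x hx θ hθ => ?_)
    rw [abs_mul]
    refine mul_le_mul ((hcoord _ _).trans (hx.zero θ hθ)) ?_ (abs_nonneg _) (he0 x)
    rw [jac_eq_toMat]
    exact (abs_toMat_le _ _ _).trans (hx.one θ hθ)
  have bV2 : ∀ i j, BddFunOn (fun θ => V2 P ψ Θ θ i j) Θ := fun i j => by
    refine BddFunOn.integral hei (hsm.mono fun x hx θ hθ => ?_)
    obtain ⟨j, l⟩ := j
    rw [hess_apply h.uniqueDiff hx.smooth hθ]
    refine (hcoord _ _).trans ((ContinuousLinearMap.le_opNorm₂ _ _ _).trans ?_)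
    simpa using hx.two θ hθ
  have bmean : ∀ i, BddFunOn (fun θ => ∫ x, ψ θ x i ∂P) Θ := fun i =>
    BddFunOn.integral hei (hsm.mono fun x hx θ hθ => (hcoord _ _).trans (hx.zero θ hθ))
  have bS : ∀ i j, BddFunOn (fun θ => Sig P ψ θ i j) Θ := fun i j => by
    have hc : ∀ i, ∀ θ ∈ Θ, MemLp (fun x => ψ θ x i) 2 P := fun i θ hθ =>
      (EuclideanSpace.proj i : Vec d →L[ℝ] ℝ).comp_memLp' (h.enveloped_zero.memLp h.cond.compact hθ)
    have hm : BddFunOn (fun θ => ∫ x, ψ θ x i * ψ θ x j ∂P) Θ :=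
      BddFunOn.integral hee (hsm.mono fun x hx θ hθ => by
        rw [abs_mul]
        exact mul_le_mul ((hcoord _ _).trans (hx.zero θ hθ)) ((hcoord _ _).trans (hx.zero θ hθ))
          (abs_nonneg _) (he0 x))
    obtain ⟨C, hC⟩ := hm.add ((bmean i).mul (bmean j)).neg
    refine ⟨C, fun θ hθ => ?_⟩
    have := hC θ hθ
    beta_reduce at this ⊢
    rw [← sub_eq_add_neg] at this
    simp only [Sig, Matrix.of_apply]
    rwa [covariance_eq_sub (hc i θ hθ) (hc j θ hθ)]
  have bSv : ∀ j, BddFunOn (fun θ => (Sig P ψ θ).vec j) Θ := fun j => bS j.2 j.1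
  have bVv : ∀ j, BddFunOn (fun θ => ((V P ψ Θ θ)⁻¹).vec j) Θ := fun j => bVi j.2 j.1
  have bK : ∀ i j, BddFunOn (fun θ => ((V P ψ Θ θ)⁻¹ ⊗ₖ (V P ψ Θ θ)⁻¹) i j) Θ := fun i j =>
    (bVi i.1 j.1).mul (bVi i.2 j.2)
  have bKS := BddFunOn.mulVec bK bSv
  have b2 := BddFunOn.mulVec bV2 bKS
  have b1 := BddFunOn.mulVec bH bVv
  have bB : ∀ i, BddFunOn (fun θ => B P ψ Θ θ i) Θ := fun i =>
    (BddFunOn.mulVec bVi (fun j => (b1 j).neg.add ((BddFunOn.const (1 / 2)).mul (b2 j))) i).neg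
  choose C hC using bB
  refine ⟨∑ i, C i, fun θ hθ => ?_⟩
  refine (norm_le_sum_abs _).trans (Finset.sum_le_sum fun i _ => hC i θ hθ)

/-- The shift is `O(1 / k)` uniformly in the sample, with no exceptional event. -/
theorem Regular.asympLinear_bc1 (h : Regular P ψ Θ θ₀) (h4 : CondFourth P ψ Θ θ₀ 0)
    {L : Vec d ≃L[ℝ] Vec d} (hL : (L : Vec d →L[ℝ] Vec d) = ∫ x, grad Θ ψ θ₀ x ∂P)
    (hV : ∀ θ ∈ Θ, (V P ψ Θ θ).det ≠ 0)
    {U T : (k : ℕ) → (Fin k → Vec p) → Vec d} (hU : IsZEstimator P ψ Θ U)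
    (hT : IsBC1 P ψ Θ U T) : AsympLinear P (influence L ψ θ₀) θ₀ T := by
  obtain ⟨b, hb⟩ := h.exists_dist_le
  obtain ⟨b', hb'⟩ := h.exists_B_bound hV
  have hdiff : ∀ k z, ‖T k z - U k z‖ ≤ b' / k := fun k z => by
    rw [hT k z, sub_sub_cancel_left, norm_neg, norm_smul, Real.norm_of_nonneg (by positivity),
      div_eq_inv_mul]
    exact mul_le_mul_of_nonneg_left (hb' _ (hU.mem k z)) (by positivity)
  refine h.asympLinear_of_correction h4 hL hU (b := |b'| + b) ?_ fun c hc => ⟨b', ?_⟩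
  · filter_upwards [eventually_ge_atTop 1] with k hk z
    have h1 : b' / k ≤ |b'| := (div_le_div_of_nonneg_right (le_abs_self _) (by positivity)).trans
      (div_le_self (abs_nonneg _) (by exact_mod_cast hk))
    have := norm_add_le (T k z - U k z) (U k z - θ₀)
    rw [sub_add_sub_cancel] at this
    linarith [hdiff k z, hb _ (hU.mem k z)]
  · refine negligible_of_subset_empty fun k z hz => hz ((hdiff k z).trans ?_)
    have : 0 ≤ c * ‖U k z - θ₀‖ := by positivity
    linarith

/-! ### The sample correction -/

theorem GoodSample.isUnit_of_norm_sub_le {e : Vec p → ℝ} {k : ℕ} {z : Fin k → Vec p}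
    {M ρ c ε η a c' : ℝ} (h : GoodSample P ψ Θ θ₀ e M ρ c ε η z) {θ : Vec d} (hθ : θ ∈ Θ)
    {A : Vec d →L[ℝ] Vec d} (hA : IsUnit A) (ha : ‖Ring.inverse A‖ ≤ a)
    (hc : ‖∫ x, grad Θ ψ θ x ∂P - A‖ ≤ c') (hac : a * (ε + c') ≤ 1 / 2) :
    IsUnit (smean (grad Θ ψ) z θ) ∧ ‖Ring.inverse (smean (grad Θ ψ) z θ)‖ ≤ 2 * a := by
  refine Subbagging.isUnit_of_norm_sub_le hA ha ?_ hac
  have := norm_add_le (smean (grad Θ ψ) z θ - ∫ x, grad Θ ψ θ x ∂P) (∫ x, grad Θ ψ θ x ∂P - A)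
  rw [sub_add_sub_cancel] at this
  exact this.trans (add_le_add (h.one θ hθ) hc)

theorem correctionFactor_nonneg {r M : ℝ} (hr : 0 ≤ r) (hM : 0 ≤ M) : 0 ≤ correctionFactor r M := by
  unfold correctionFactor; positivity

/-- Off a rare event the estimator is near `θ₀`, where the derivative matrix is invertible and `k⁻¹
B̂` is at most `C / k` plus a small multiple of the distance to `θ₀`. The corrected point then lies
in a ball inside `Θ ⊆ K`, so the formula applies. -/
theorem Regular.asympLinear_bc2 (h : Regular P ψ Θ θ₀) (h0 : CondFourth P ψ Θ θ₀ 0)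
    (h1 : CondFourth P ψ Θ θ₀ 1)
    {L : Vec d ≃L[ℝ] Vec d} (hL : (L : Vec d →L[ℝ] Vec d) = ∫ x, grad Θ ψ θ₀ x ∂P)
    {K : Set (Vec d)} (hK : Bornology.IsBounded K) (hΘK : Θ ⊆ K)
    {U T : (k : ℕ) → (Fin k → Vec p) → Vec d} (hU : IsZEstimator P ψ Θ U)
    (hT : IsBC2 P ψ Θ K U T) : AsympLinear P (influence L ψ θ₀) θ₀ T := by
  obtain ⟨b, hb⟩ := hK.exists_norm_le
  refine h.asympLinear_of_correction h0 hL hU (b := b + ‖θ₀‖) (Eventually.of_forall fun k z =>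
    (norm_sub_le _ _).trans (by gcongr; exact hb _ (hT.mem k z))) fun c hc => ?_
  obtain ⟨e, he, M, hM, hgood⟩ := h.negligible_not_good h0 h1
  have hA : IsUnit (∫ x, grad Θ ψ θ₀ x ∂P) :=
    ⟨(ContinuousLinearEquiv.unitsEquiv ℝ (Vec d)).symm L, by rw [← hL]; rfl⟩
  set a := ‖Ring.inverse (∫ x, grad Θ ψ θ₀ x ∂P)‖ + 1
  have ha : 0 < a := by positivity
  obtain ⟨ρ, hρ, hρ1, hball, hgrad, hgood⟩ := hgood (1 / (4 * a)) (by positivity) 1 one_pos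
  have hac : a * (1 / (4 * a) + 1 / (4 * a)) ≤ 1 / 2 := by
    apply le_of_eq; field_simp; norm_num
  set C₀ := 2 * a * correctionFactor (2 * a) M
  have hC₀ : 0 ≤ C₀ := mul_nonneg (by positivity) (correctionFactor_nonneg (by positivity) hM)
  -- The bound by `c` is the required precision. The bound by `1` keeps the corrected point in the
  -- ball of radius `ρ`: `ρ / 4` from the estimator, another `ρ / 4` from the multiple of its
  -- distance, `ρ / 2` from `C / k`.
  set c₁ := min c 1
  have hc₁ : 0 < c₁ := by positivity
  set η := c₁ / (8 * C₀ * M + 1)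
  have hη : 0 < η := by positivity
  have hηc : C₀ * (8 * M * η) ≤ c₁ := by
    have : (8 * C₀ * M) * η ≤ (8 * C₀ * M + 1) * η := by gcongr; linarith
    have h2 : (8 * C₀ * M + 1) * η = c₁ := by simp only [η]; field_simp
    linarith
  set C := C₀ * (1 + 2 * M)
  have hCk : ∀ᶠ k : ℕ in atTop, C / k ≤ ρ / 2 :=
    (tendsto_const_div_atTop_nhds_zero_nat C).eventually_le_const (by positivity)
  refine ⟨C, ((hgood _ (by positivity : (0 : ℝ) < 1 / (4 * a)) η hη).union
    (h.zEstimator_local hL hU one_pos (ρ₀ := ρ / 4) (by positivity))).mono ?_⟩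
  filter_upwards [hCk, eventually_gt_atTop 0] with k hk hk0
  filter_upwards [hT.formula k] with z hz hbad
  by_contra hno
  simp only [Set.mem_union, Set.mem_ofPred_eq, not_or, not_not] at hno
  obtain ⟨g, hu, -⟩ := hno
  refine hbad ?_
  set u := ‖U k z - θ₀‖
  have hmem : U k z ∈ Metric.closedBall θ₀ ρ := by
    rw [Metric.mem_closedBall, dist_eq_norm]; linarith
  obtain ⟨hunit, hinv⟩ := g.isUnit_of_norm_sub_le (hball hmem) hA
    (le_add_of_nonneg_right zero_le_one) (hgrad _ hmem) hac
  have hcorr := g.correction_le_near h.uniqueDiff he hη.le hM hρ.le hρ1 hball hmem hinv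
  have hkpos : (0 : ℝ) < k := by exact_mod_cast hk0
  have hB : ‖(k : ℝ)⁻¹ • WithLp.toLp 2 (Bhat ψ Θ z (U k z))‖ ≤ c₁ * u + C / k := by
    rw [toLp_Bhat h.uniqueDiff (fun i => (g.smooth i).smooth) (hball hmem) hunit, norm_smul,
      Real.norm_of_nonneg (by positivity)]
    calc (k : ℝ)⁻¹ * ‖Ring.inverse (smean (grad Θ ψ) z (U k z)) (correction ψ Θ z (U k z))‖
        ≤ (k : ℝ)⁻¹ * (2 * a *
          (correctionFactor (2 * a) M * (1 + 2 * M + 8 * M * η * k * u))) := by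
          gcongr
          exact (ContinuousLinearMap.le_opNorm _ _).trans (by gcongr)
      _ = C₀ * (8 * M * η) * u + C / k := by
          simp only [C, C₀]; field_simp; ring
      _ ≤ c₁ * u + C / k := by gcongr
  have hform := hz (by rw [Vhat_eq_toMat]; exact det_toMat_ne_zero.2 hunit) (hΘK (hball ?_))
  · rw [hform, sub_sub_cancel_left, norm_neg]
    refine hB.trans ?_
    gcongr
    exact min_le_left _ _
  · rw [Metric.mem_closedBall, dist_eq_norm, sub_right_comm]
    refine (norm_sub_le _ _).trans ?_
    have : c₁ * u ≤ 1 * u := by gcongr; exact min_le_right _ _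
    linarith

end Corrected

/-! ### Corrected estimating equations -/

section CorrectedEquations

variable {d p : ℕ} {P : Measure (Vec p)} [IsProbabilityMeasure P] {ψ : Vec d → Vec p → Vec d}
  {Θ : Set (Vec d)} {θ₀ : Vec d}

/-- For good samples, the solutions of the corrected estimating equations are near the true
parameter, and there are some. -/
theorem GoodSample.solvesBC3 {e : Vec p → ℝ} {k : ℕ} {z : Fin k → Vec p} {M ρ c ε η a ν : ℝ}
    (h : Regular P ψ Θ θ₀) (g : GoodSample P ψ Θ θ₀ e M ρ c ε η z)
    {L : Vec d ≃L[ℝ] Vec d} (hL : (L : Vec d →L[ℝ] Vec d) = ∫ x, grad Θ ψ θ₀ x ∂P)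
    (hLa : ‖(L.symm : Vec d →L[ℝ] Vec d)‖ ≤ a) (ha : 0 < a)
    (hk : 0 < k) (he : ∀ x, 0 ≤ e x) (hη : 0 ≤ η) (hM : 0 ≤ M) (hρ : 0 ≤ ρ) (hc : 0 ≤ c)
    (hball : Metric.closedBall θ₀ ρ ⊆ Θ)
    (hunit : ∀ θ ∈ Θ, IsUnit (smean (grad Θ ψ) z θ) ∧
      ‖Ring.inverse (smean (grad Θ ψ) z θ)‖ ≤ 2 * a)
    (hsep : ∀ θ ∈ Θ, ‖∫ x, ψ θ x ∂P‖ < ν → θ ∈ Metric.closedBall θ₀ ρ)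
    {δ : ℝ} (hcorr : ∀ θ ∈ Θ, (k : ℝ)⁻¹ * ‖correction ψ Θ z θ‖ ≤ δ) (hδν : ε + δ < ν)
    (hδρ : ε + δ ≤ ρ / (2 * a)) {l : ℝ}
    (hl : (k : ℝ)⁻¹ * (4 * (2 * a + 2 * a * M * (2 * a)) * (η * k * M + M ^ 2) +
      8 * M * (2 * a + 2 * a * M * (2 * a)) ^ 2 * (η * k * M)) ≤ l) (hcl : a * (c + l) ≤ 1 / 2) :
    (∃ θ ∈ Θ, SolvesBC3 ψ Θ z θ) ∧
      ∀ θ ∈ Θ, SolvesBC3 ψ Θ z θ → θ ∈ Metric.closedBall θ₀ ρ := by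
  have hkpos : (0 : ℝ) < k := by exact_mod_cast hk
  have hθ₀ : θ₀ ∈ Metric.closedBall θ₀ ρ := Metric.mem_closedBall_self hρ
  have hiff := fun θ (hθ : θ ∈ Θ) => solvesBC3_iff h.uniqueDiff (fun i => (g.smooth i).smooth) hθ hk
  have hcorr' : ∀ θ ∈ Θ, ‖(k : ℝ)⁻¹ • correction ψ Θ z θ‖ ≤ δ := fun θ hθ => by
    rw [norm_smul, Real.norm_of_nonneg (by positivity)]
    exact hcorr θ hθ
  constructor
  -- The perturbation `k⁻¹` times the correction has a small Lipschitz constant near `θ₀`, so the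
  -- corrected equations remain nearly linear and the same root argument applies.
  · have hlip := ((g.correction_lip h.uniqueDiff he hη hM hball (r := 2 * a) (by positivity)
      (fun θ hθ => (hunit θ (hball hθ)).1) (fun θ hθ => (hunit θ (hball hθ)).2)).smul
        (c := (k : ℝ)⁻¹) (by positivity)).mono hl
    have hl0 : 0 ≤ l := (norm_nonneg _).trans (hlip.bdd θ₀ hθ₀)
    have hlin := g.linear
    rw [← hL] at hlin
    obtain ⟨θ, hθ, hroot⟩ := (hlin.add_lipschitz hlip.lip).exists_root hρ (add_nonneg hc hl0) ha
      hLa hcl (by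
        refine (norm_add_le _ _).trans ((add_le_add ?_ (hcorr' θ₀ h.mem)).trans hδρ)
        have := g.zero θ₀ h.mem
        rwa [(h.cond.root θ₀ h.mem).2 rfl, sub_zero] at this)
    exact ⟨θ, hball hθ, (hiff θ (hball hθ)).2 ⟨(hunit θ (hball hθ)).1, hroot⟩⟩
  · intro θ hθ hs
    have hroot := ((hiff θ hθ).1 hs).2
    have hψ : ‖smean ψ z θ‖ ≤ δ := by
      rw [eq_neg_of_add_eq_zero_left hroot, norm_neg]
      exact hcorr' θ hθ
    refine hsep θ hθ (lt_of_le_of_lt ?_ hδν)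
    have h1 := norm_sub_le (smean ψ z θ) (smean ψ z θ - ∫ x, ψ θ x ∂P)
    rw [sub_sub_cancel] at h1
    linarith [g.zero θ hθ]

/-- The corrected equations are a small perturbation of the original ones on all of `Θ`.
Nonsingularity of `V` on the whole compact set bounds the correction uniformly there, which excludes
solutions far from `θ₀`; near `θ₀` the sharper bound of the correction gives the linearization. -/
theorem Regular.asympLinear_bc3 (h : Regular P ψ Θ θ₀) (h0 : CondFourth P ψ Θ θ₀ 0)
    (h1 : CondFourth P ψ Θ θ₀ 1)
    {L : Vec d ≃L[ℝ] Vec d} (hL : (L : Vec d →L[ℝ] Vec d) = ∫ x, grad Θ ψ θ₀ x ∂P)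
    (hV : ∀ θ ∈ Θ, (V P ψ Θ θ).det ≠ 0) {T : (k : ℕ) → (Fin k → Vec p) → Vec d}
    (hT : IsBC3 P ψ Θ T) : AsympLinear P (influence L ψ θ₀) θ₀ T := by
  obtain ⟨b, hb⟩ := h.exists_dist_le
  refine h.asympLinear h0 L (Eventually.of_forall fun k z => hb _ (hT.mem k z)) fun c hc => ?_
  obtain ⟨e, he, M, hM, hgood⟩ := h.negligible_not_good h0 h1
  obtain ⟨a₀, ha₀⟩ := h.exists_inverse_bound hV
  set a := ‖(L.symm : Vec d →L[ℝ] Vec d)‖ + |a₀| + 1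
  have ha : 0 < a := by positivity
  have hLa : ‖(L.symm : Vec d →L[ℝ] Vec d)‖ ≤ a := by
    have := abs_nonneg a₀; simp only [a]; linarith
  have haa : a₀ ≤ a := by
    have := le_abs_self a₀; have := norm_nonneg (L.symm : Vec d →L[ℝ] Vec d)
    simp only [a]; linarith
  -- The first bound spends half of `c` on the linearization. The second leaves room for a Lipschitz
  -- constant `1 / (4 a)` of the perturbation within the threshold `1 / 2` for roots.
  set c₁ := min (c / (2 * a)) (1 / (4 * a))
  have hc₁ : 0 < c₁ := by positivity
  obtain ⟨ρ, hρ, hρ1, hball, -, hgood⟩ := hgood c₁ hc₁ 1 one_pos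
  obtain ⟨ν, hν, hsep⟩ := h.exists_separation hρ
  -- `δ` bounds both the sampling error and the perturbation. Twice `δ` must stay below the
  -- separation `ν` and within the radius `ρ / (2 a)` covered by the nearly linear map.
  set δ := min (ν / 3) (ρ / (4 * a))
  have hδ : 0 < δ := by positivity
  set ε := min (1 / (2 * a)) δ
  have hε : 0 < ε := by positivity
  have hεδ : ε ≤ δ := min_le_right _ _
  have hδν : ε + δ < ν := by have : δ ≤ ν / 3 := min_le_left _ _; linarith
  have hδρ : ε + δ ≤ ρ / (2 * a) := by
    have h2 : δ ≤ ρ / (4 * a) := min_le_right _ _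
    have h3 : ρ / (2 * a) = ρ / (4 * a) + ρ / (4 * a) := by field_simp; norm_num
    linarith
  have haε : a * (ε + 0) ≤ 1 / 2 := by
    rw [add_zero]
    calc a * ε ≤ a * (1 / (2 * a)) := by gcongr; exact min_le_left _ _
      _ = 1 / 2 := by field_simp
  have hac₁ : a * c₁ ≤ c / 2 := by
    calc a * c₁ ≤ a * (c / (2 * a)) := by gcongr; exact min_le_left _ _
      _ = c / 2 := by field_simp
  have hcl : a * (c₁ + 1 / (4 * a)) ≤ 1 / 2 := by
    calc a * (c₁ + 1 / (4 * a)) ≤ a * (1 / (4 * a) + 1 / (4 * a)) := by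
          gcongr; exact min_le_right _ _
      _ = 1 / 2 := by field_simp; norm_num
  set C₀ := correctionFactor (2 * a) M
  have hC₀ : 0 ≤ C₀ := correctionFactor_nonneg (by positivity) hM
  set r := 2 * a + 2 * a * M * (2 * a)
  have hr : 0 ≤ r := by positivity
  -- The three constants are the coefficients of `η` in, respectively, the size of the perturbation
  -- on `Θ`, its relative size near `θ₀`, and its Lipschitz constant. `τ` collects the three
  -- tolerances.
  set K₁ := 4 * C₀ * M
  set K₂ := a * (8 * C₀ * M)
  set K₃ := 4 * r * M + 8 * M ^ 2 * r ^ 2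
  have hK₁ : 0 ≤ K₁ := by positivity
  have hK₂ : 0 ≤ K₂ := by positivity
  have hK₃ : 0 ≤ K₃ := by positivity
  set τ := min (δ / 2) (min (c / 2) (1 / (8 * a)))
  have hτ : 0 < τ := by positivity
  set η := τ / (K₁ + K₂ + K₃ + 1)
  have hη : 0 < η := by positivity
  have hKη : ∀ K, K ≤ K₁ + K₂ + K₃ → K * η ≤ τ := fun K hK => by
    calc K * η ≤ (K₁ + K₂ + K₃ + 1) * η := by gcongr; linarith
      _ = τ := by simp only [η]; field_simp
  have hη₁ : K₁ * η ≤ δ / 2 := (hKη K₁ (by linarith)).trans (min_le_left _ _)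
  have hη₂ : K₂ * η ≤ c / 2 :=
    (hKη K₂ (by linarith)).trans ((min_le_right _ _).trans (min_le_left _ _))
  have hη₃ : K₃ * η ≤ 1 / (8 * a) :=
    (hKη K₃ (by linarith)).trans ((min_le_right _ _).trans (min_le_right _ _))
  have hk₁ : ∀ᶠ k : ℕ in atTop, C₀ / k ≤ δ / 2 :=
    (tendsto_const_div_atTop_nhds_zero_nat C₀).eventually_le_const (by positivity)
  have hk₃ : ∀ᶠ k : ℕ in atTop, 4 * r * M ^ 2 / k ≤ 1 / (8 * a) :=
    (tendsto_const_div_atTop_nhds_zero_nat _).eventually_le_const (by positivity)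
  refine ⟨a * (C₀ * (1 + 2 * M)), (hgood ε hε η hη).mono ?_⟩
  filter_upwards [hk₁, hk₃, eventually_gt_atTop 0] with k hk₁ hk₃ hk
  filter_upwards [hT.solves k] with z hz hbad
  by_contra hno
  refine hbad ?_
  have hkpos : (0 : ℝ) < k := by exact_mod_cast hk
  have hunit : ∀ θ ∈ Θ, IsUnit (smean (grad Θ ψ) z θ) ∧
      ‖Ring.inverse (smean (grad Θ ψ) z θ)‖ ≤ 2 * a := fun θ hθ =>
    hno.isUnit_of_norm_sub_le hθ (ha₀ θ hθ).1 ((ha₀ θ hθ).2.trans haa) (c' := 0) (by simp) haε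
  have hcorr : ∀ θ ∈ Θ, (k : ℝ)⁻¹ * ‖correction ψ Θ z θ‖ ≤ δ := fun θ hθ => by
    calc (k : ℝ)⁻¹ * ‖correction ψ Θ z θ‖ ≤ (k : ℝ)⁻¹ * (C₀ * (1 + 4 * (η * k * M))) := by
          gcongr
          exact hno.correction_le he hη.le hM hθ (hunit θ hθ).2
      _ = C₀ / k + K₁ * η := by simp only [K₁]; field_simp
      _ ≤ δ := by linarith
  have hl : (k : ℝ)⁻¹ * (4 * r * (η * k * M + M ^ 2) + 8 * M * r ^ 2 * (η * k * M)) ≤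
      1 / (4 * a) := by
    calc (k : ℝ)⁻¹ * (4 * r * (η * k * M + M ^ 2) + 8 * M * r ^ 2 * (η * k * M))
        = 4 * r * M ^ 2 / k + K₃ * η := by simp only [K₃]; field_simp; ring
      _ ≤ 1 / (8 * a) + 1 / (8 * a) := add_le_add hk₃ hη₃
      _ = 1 / (4 * a) := by field_simp; norm_num
  obtain ⟨hex, hnear⟩ := hno.solvesBC3 h hL hLa ha hk he hη.le hM hρ.le hc₁.le hball hunit hsep
    hcorr hδν hδρ hl hcl
  have hsol := hz hex
  have hTΘ := hT.mem k z
  have hTball := hnear _ hTΘ hsol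
  have hroot := ((solvesBC3_iff h.uniqueDiff (fun i => (hno.smooth i).smooth) hTΘ hk).1 hsol).2
  have hc := hno.correction_le_near h.uniqueDiff he hη.le hM hρ.le hρ1 hball hTball
    (hunit _ hTΘ).2
  set u := ‖T k z - θ₀‖
  have hψ : ‖L.symm (smean ψ z (T k z))‖ ≤ K₂ * η * u + a * (C₀ * (1 + 2 * M)) / k := by
    rw [eq_neg_of_add_eq_zero_left hroot, map_neg, norm_neg]
    calc ‖L.symm ((k : ℝ)⁻¹ • correction ψ Θ z (T k z))‖
        ≤ a * ((k : ℝ)⁻¹ * (C₀ * (1 + 2 * M + 8 * M * η * k * u))) := by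
          refine ((L.symm : Vec d →L[ℝ] Vec d).le_opNorm _).trans ?_
          rw [norm_smul, Real.norm_of_nonneg (by positivity)]
          gcongr
      _ = K₂ * η * u + a * (C₀ * (1 + 2 * M)) / k := by
          simp only [K₂]; field_simp; ring
  have hlin := hno.linear
  rw [← hL] at hlin
  have h2 := hlin.linearization hTball (Metric.mem_closedBall_self hρ.le)
  have h3 : ‖(L.symm : Vec d →L[ℝ] Vec d)‖ * (c₁ * u) ≤ c / 2 * u := by
    rw [← mul_assoc]
    exact mul_le_mul_of_nonneg_right ((mul_le_mul_of_nonneg_right hLa hc₁.le).trans hac₁)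
      (norm_nonneg _)
  have h4 := norm_add_le (T k z - θ₀ + L.symm (smean ψ z θ₀) - L.symm (smean ψ z (T k z)))
    (L.symm (smean ψ z (T k z)))
  rw [sub_add_cancel] at h4
  have h5 : K₂ * η * u ≤ c / 2 * u := mul_le_mul_of_nonneg_right hη₂ (norm_nonneg _)
  linarith

end CorrectedEquations

end Subbagging

end

/-! ### Consistency of the subbagging variance estimators -/

theorem theorem5 {Ω : Type*} [MeasurableSpace Ω] (μ : Measure Ω) [IsProbabilityMeasure μ]
    {d p : ℕ} (P : Measure (Subbagging.Vec p)) [IsProbabilityMeasure P]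
    (ψ : Subbagging.Vec d → Subbagging.Vec p → Subbagging.Vec d)
    (Θ : Set (Subbagging.Vec d)) (θ₀ : Subbagging.Vec d)
    -- the data: independent, with law `P`
    (Z : ℕ → Ω → Subbagging.Vec p) (hZ_meas : ∀ i, Measurable (Z i))
    (hZ_law : ∀ i, μ.map (Z i) = P) (hZ_indep : iIndepFun Z μ)
    -- the subsample sizes, the numbers of subsamples, and the random subsamples
    (k m : ℕ → ℕ) (hk_le : ∀ N, k N ≤ N)
    (S : (N : ℕ) → Fin (m N) → Ω → Subbagging.Subsample N (k N))
    (hS : ∀ N, Subbagging.IsSubsampling μ Z N (k N) (m N) (S N))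
    -- the estimator that solves the estimating equations
    (θhat : (n : ℕ) → (Fin n → Subbagging.Vec p) → Subbagging.Vec d)
    (hθhat : Subbagging.IsZEstimator P ψ Θ θhat)
    -- conditions common to both parts
    (hΘ : UniqueDiffOn ℝ Θ)
    (hC1 : Subbagging.CondC1 P ψ Θ θ₀)
    (hC2_I : Subbagging.CondMeasurable ψ Θ)
    (hC2_II : Subbagging.CondSmooth P ψ Θ 3)
    (hC3_I : ∀ κ ≤ 3, Subbagging.CondEnvelope P ψ Θ κ)
    (hC3_II : (Subbagging.Sig P ψ θ₀).det ≠ 0 ∧ (Subbagging.V P ψ Θ θ₀).det ≠ 0)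
    (hC4_I : Subbagging.CondFourth P ψ Θ θ₀ 0)
    (hk : Tendsto k atTop atTop)
    (hkN : Tendsto (fun N => (k N : ℝ) / N) atTop (𝓝 0)) :
    (Subbagging.Setting k m →
      ∀ a b : Fin d, TendstoInMeasure μ
        (fun N ω => (k N : ℝ) *
          Subbagging.Omega (fun j => θhat (k N) (Subbagging.pick (fun i => Z i ω) (S N j ω))) a b)
        atTop (fun _ => Subbagging.Xi P ψ Θ θ₀ a b)) ∧
    (Subbagging.CondSmooth P ψ Θ 4 →
      Subbagging.CondEnvelope P ψ Θ 4 →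
      (∀ κ ≤ 3, Subbagging.CondFourth P ψ Θ θ₀ κ) →
      Subbagging.SettingBC k m →
      ∀ θbc : (n : ℕ) → (Fin n → Subbagging.Vec p) → Subbagging.Vec d,
        -- `θbc` is one of the three bias-corrected estimators
        (((∀ θ ∈ Θ, (Subbagging.V P ψ Θ θ).det ≠ 0) ∧ Subbagging.IsBC1 P ψ Θ θhat θbc) ∨
          (∃ K : Set (Subbagging.Vec d), Bornology.IsBounded K ∧ Θ ⊆ K ∧
            Subbagging.IsBC2 P ψ Θ K θhat θbc) ∨
          ((∀ θ ∈ Θ, (Subbagging.V P ψ Θ θ).det ≠ 0) ∧ Subbagging.IsBC3 P ψ Θ θbc)) →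
        ∀ a b : Fin d, TendstoInMeasure μ
          (fun N ω => (k N : ℝ) *
            Subbagging.Omega
              (fun j => θbc (k N) (Subbagging.pick (fun i => Z i ω) (S N j ω))) a b)
          atTop (fun _ => Subbagging.Xi P ψ Θ θ₀ a b)) := by
  have h : Subbagging.Regular P ψ Θ θ₀ := ⟨hΘ, hC1, hC2_I, hC2_II, hC3_I⟩
  obtain ⟨L, hL, hLV⟩ := h.exists_equiv hC3_II.2
  -- The covariance of the influence function is the sandwich matrix, so both parts reduce to
  -- asymptotic linearity with this one influence function and to `m` tending to infinity.
  have hmain : ∀ T : (n : ℕ) → (Fin n → Subbagging.Vec p) → Subbagging.Vec d,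
      Subbagging.AsympLinear P (Subbagging.influence L ψ θ₀) θ₀ T → Tendsto m atTop atTop →
      ∀ a b : Fin d, TendstoInMeasure μ
        (fun N ω => (k N : ℝ) *
          Subbagging.Omega (fun j => T (k N) (Subbagging.pick (fun i => Z i ω) (S N j ω))) a b)
        atTop (fun _ => Subbagging.Xi P ψ Θ θ₀ a b) := fun T hT hm a b => by
    rw [← h.integral_influence_mul hLV a b]
    exact Subbagging.tendstoInMeasure_omega hZ_meas hZ_law hZ_indep hk_le hS hk hkN hm
      (h.measurable_influence L) (h.memLp_influence hC4_I L) (h.integral_influence L) hT a b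
  refine ⟨fun hset => hmain _ (h.asympLinear_zEstimator hC4_I hL hθhat) (hset.tendsto hkN),
    fun _ _ h4 hset θbc hbc => hmain _ ?_ (hset.tendsto hkN)⟩
  have h1 := h4 1 (by norm_num)
  rcases hbc with ⟨hV, hT⟩ | ⟨K, hK, hΘK, hT⟩ | ⟨hV, hT⟩
  · exact h.asympLinear_bc1 hC4_I hL hV hθhat hT
  · exact h.asympLinear_bc2 hC4_I h1 hL hK hΘK hθhat hT
  · exact h.asympLinear_bc3 hC4_I h1 hL hV hT
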